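/- **Setting.** Let $\mathcal G$ be a finite group with a central element $p\neq 1$, $p^2=1$ (fermion parity), let $b:\mathcal G\to G_b$, $g\mapsto\bar g$, be a surjective homomorphism with kernel $\{1,p\}$, and let $u,r:G_b\to\mathbb Z/2$ be homomorphisms; $g$ is *anti-unitary* if $u(\bar g)=1$ and *orientation-reversing* if $r(\bar g)=1$. Put $x=u+r$ (so $x=u$ if nothing reverses orientation, and $x=r$ if nothing is anti-unitary). $\mathcal G$ is *split* if there is a homomorphism $\mathcal G\to\mathbb Z/2$ with $p\mapsto 1$. Fix $t:\mathcal G\to\mathbb Z/2$ with $t(1)=0$ and $t(pg)=t(g)+1$, a homomorphism if $\mathcal G$ is split, and define $\rho$ on $G_b$ by $\rho(\bar h,\bar k)=t(h)+t(k)-t(hk)$. Write $U(1)=\mathbb R/\mathbb Z$, let $\tfrac12:\mathbb Z/2\hookrightarrow\mathbb R/\mathbb Z$ be the inclusion, $(\beta\cup\beta')(g,h)=\beta(g)\beta'(h)$, and let $\delta_T$ denote coboundaries twisted by $x$: $(\delta_TL)(g,h)=(-1)^{x(g)}L(h)-L(gh)+L(g)$ and $(\delta_T\alpha)(g,h,k)=(-1)^{x(g)}\alpha(h,k)-\alpha(gh,k)+\alpha(g,hk)-\alpha(g,h)$.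 **Algebras.** An *equivariant algebra* is a finite-dimensional associative unital complex algebra $A$ with an action $R$ of $\mathcal G$ by real-linear bijections, where $R(g)$ is $\mathbb C$-linear or anti-linear according to $u(\bar g)=0,1$ and an automorphism or an anti-automorphism according to $r(\bar g)=0,1$. It is $\mathbb Z/2$-graded by $R(p)$. The *supertensor product* $A_1\mathbin{\widehat\otimes}A_2$ has product $(a_1\mathbin{\widehat\otimes} a_2)(b_1\mathbin{\widehat\otimes} b_2)=(-1)^{|a_2||b_1|}a_1b_1\mathbin{\widehat\otimes} a_2b_2$ and action $R(g)(a_1\mathbin{\widehat\otimes} a_2)=(-1)^{r(\bar g)|a_1||a_2|}R_1(g)a_1\mathbin{\widehat\otimes} R_2(g)a_2$. Two equivariant algebras are *Morita equivalent* if they are isomorphic to the full corners $eCe$ and $(1-e)C(1-e)$ of an equivariant algebra $C$ with an invariant idempotent $e$. For $K\in\{\mathcal G,G_b\}$, a *projective action* of $K$ on $\mathbb C^n$ ($n\ge1$) with cochain $\omega$ is a family of unitary matrices $M(g)$ with $M(g)\,\overline{M(h)}^{\,x(g)}=e^{2\pi i\omega(g,h)}M(gh)$, where the bar (entrywise complex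 conjugation) is present iff $x(g)=1$. For a matrix $N$ let $N^{[g]}$ be $N$, conjugated entrywise if $u(\bar g)=1$ and transposed if $r(\bar g)=1$. Let $\mathbb C\ell(1)=\mathbb C[\Gamma]/(\Gamma^2-1)$. An equivariant algebra is * *even SRE* if it is equivariantly isomorphic to $M_n(\mathbb C)$ with $R(g)N=M(g)N^{[g]}M(g)^{-1}$ for a projective action of $\mathcal G$; * *odd SRE* if it is equivariantly isomorphic to $M_n(\mathbb C)\otimes\mathbb C\ell(1)$ with $R(g)(N\otimes\Gamma^m)=(-1)^{\chi(g)m}M(\bar g)N^{[g]}M(\bar g)^{-1}\otimes\Gamma^m$ for a projective action of $G_b$ and some $\chi:\mathcal G\to\mathbb Z/2$ with $\chi(p)=1$. It is *SRE* if it is even or odd SRE. *Fermionic SRE phases* are the Morita classes of SRE algebras. An SRE algebra *has invariants* $(\alpha,\beta,\gamma)$, where $\alpha:G_b\times G_b\to\mathbb R/\mathbb Z$, $\beta:G_b\to\mathbb Z/2$ and $\gamma\in\mathbb Z/2$, if either $\gamma=0$ and it is as in the first item with $\omega(g,h)=\alpha(\bar g,\bar h)+\tfrac12\beta(\bar g)t(h)$,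 or $\gamma=1$ and it is as in the second item with $\omega=\alpha$ and $\chi(g)=\beta(\bar g)+t(g)$. **Theorem.** 1. An equivariant algebra is SRE if and only if it has some invariants. A triple $(\alpha,\beta,\gamma)$ occurs if and only if $\delta\beta=0$, $\delta_T\alpha=\tfrac12\beta\cup\rho$, and $\gamma=0$ or $\mathcal G$ is split. SRE algebras with invariants $(\alpha,\beta,\gamma)$ and $(\alpha',\beta',\gamma')$ are Morita equivalent if and only if $\beta=\beta'$, $\gamma=\gamma'$ and the pullback of $\alpha-\alpha'$ to $\mathcal G$ is $\delta_TL$ for some $L:\mathcal G\to\mathbb R/\mathbb Z$. 2. The supertensor product of two SRE algebras is SRE, and it induces a commutative group structure on the set of SRE phases. 3. If $A_1$, $A_2$ are SRE algebras with invariants $(\alpha_1,\beta_1,\gamma_1)$, $(\alpha_2,\beta_2,\gamma_2)$, then $A_1\mathbin{\widehat\otimes}A_2$ has the invariants $$\begin{aligned} &(\alpha_1+\alpha_2+\tfrac12\beta_1\cup\beta_2,\ \beta_1+\beta_2,\ 0) && (\gamma_1,\gamma_2)=(0,0),\\ &(\alpha_1+\alpha_2+\tfrac12\beta_1\cup\beta_2+\tfrac12\beta_1\cup\beta_1,\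 \beta_1+\beta_2,\ 1) && (\gamma_1,\gamma_2)=(0,1),\\ &(\alpha_1+\alpha_2+\tfrac12\beta_1\cup\beta_2+\tfrac12\beta_2\cup\beta_2,\ \beta_1+\beta_2,\ 1) && (\gamma_1,\gamma_2)=(1,0),\\ &(\alpha_1+\alpha_2+\tfrac12\beta_1\cup\beta_2,\ \beta_1+\beta_2+x,\ 0) && (\gamma_1,\gamma_2)=(1,1). \end{aligned}$$ 4. If $\mathcal G$ is not split, there are no odd SRE algebras and every invariant has $\gamma=0$, so that only the first rule applies. -/

import Mathlib

open scoped TensorProduct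

noncomputable section

namespace FermionicStacking

/-! ### Symmetry classes -/

/-- A symmetry class: a supergroup `G` (a group with a central involution `p`, fermion parity),
presented as a central extension `b : G → Gb` of the group `Gb` of bosonic symmetries by `{1, p}`,
together with homomorphisms `Gb → ℤ/2` recording which symmetries are anti-unitary (`anti = 1`)
and which reverse the orientation of space (`refl = 1`). -/
structure SymmetryClass (G Gb : Type*) [Group G] [Group Gb] where
  p : G
  b : G →* Gb
  p_ne_one : p ≠ 1
  p_mul_p : p * p = 1
  p_central : ∀ g, p * g = g * p
  b_surjective : Function.Surjective b
  b_eq_one_iff : ∀ g, b g = 1 ↔ g = 1 ∨ g = p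
  anti : Gb → ZMod 2
  anti_mul : ∀ g h, anti (g * h) = anti g + anti h
  refl : Gb → ZMod 2
  refl_mul : ∀ g h, refl (g * h) = refl g + refl h

variable {G Gb : Type*} [Group G] [Group Gb]

namespace SymmetryClass

variable (S : SymmetryClass G Gb)

/-- The twist `x`. It equals `anti` if no symmetry reverses orientation, and `refl` if every
symmetry is unitary; an element that is anti-unitary and orientation-reversing is untwisted. -/
def x (g : Gb) : ZMod 2 := S.anti g + S.refl g

/-- `G` is split: `G ≃ Gb × {1, p}`, i.e. there is a homomorphism `G → ℤ/2` with `p ↦ 1`. -/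
def Splits : Prop := ∃ τ : G → ZMod 2, (∀ g h, τ (g * h) = τ g + τ h) ∧ τ S.p = 1

/-- A trivialization `t : G → ℤ/2`; when `G` is split it is required to be a splitting. -/
structure Trivialization where
  t : G → ZMod 2
  t_one : t 1 = 0
  t_p_mul : ∀ g, t (S.p * g) = t g + 1
  map_mul_of_splits : S.Splits → ∀ g h, t (g * h) = t g + t h

/-- The field automorphism of `ℂ` over which `g` acts. -/
def scal (g : Gb) : ℂ →+* ℂ := if S.anti g = 1 then starRingEnd ℂ else RingHom.id ℂ

theorem b_p : S.b S.p = 1 := (S.b_eq_one_iff _).2 (Or.inr rfl)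

theorem anti_one : S.anti 1 = 0 := by simpa using S.anti_mul 1 1

theorem refl_one : S.refl 1 = 0 := by simpa using S.refl_mul 1 1

theorem scal_b_p : S.scal (S.b S.p) = RingHom.id ℂ := by
  simp [scal, b_p, anti_one]

end SymmetryClass

/-! ### Equivariant algebras -/

/-- A finite-dimensional associative complex algebra with an action of `G`: the element `g` acts
linearly or anti-linearly according to `anti`, and as an automorphism or an anti-automorphism
according to `refl`. -/
structure EquivariantAlgebra (S : SymmetryClass G Gb) where
  carrier : Type
  [ring : Ring carrier]
  [algebra : Algebra ℂ carrier]
  [finite : Module.Finite ℂ carrier]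
  act : (g : G) → carrier →ₛₗ[S.scal (S.b g)] carrier
  act_one : ∀ a, act 1 a = a
  act_mul : ∀ g h a, act (g * h) a = act g (act h a)
  act_map_one : ∀ g, act g 1 = 1
  act_map_mul : ∀ g a a', act g (a * a') =
    if S.refl (S.b g) = 1 then act g a' * act g a else act g a * act g a'

attribute [instance] EquivariantAlgebra.ring EquivariantAlgebra.algebra EquivariantAlgebra.finite

namespace EquivariantAlgebra

variable {S : SymmetryClass G Gb} (A B : EquivariantAlgebra S)

/-- The action of fermion parity, as a complex-linear map. -/
def parity : A.carrier →ₗ[ℂ] A.carrier where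
  toFun := A.act S.p
  map_add' := map_add _
  map_smul' c a := by
    rw [LinearMap.map_smulₛₗ]
    exact congrArg (fun f : ℂ →+* ℂ => f c • A.act S.p a) S.scal_b_p

theorem parity_apply (a : A.carrier) : A.parity a = A.act S.p a := rfl

theorem parity_parity (a : A.carrier) : A.parity (A.parity a) = a := by
  rw [parity_apply, parity_apply, ← A.act_mul, S.p_mul_p, A.act_one]

theorem parity_act (g : G) (a : A.carrier) : A.parity (A.act g a) = A.act g (A.parity a) := by
  rw [parity_apply, parity_apply, ← A.act_mul, ← A.act_mul, S.p_central]

theorem parity_one : A.parity 1 = 1 := A.act_map_one _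

theorem parity_mul (a a' : A.carrier) : A.parity (a * a') = A.parity a * A.parity a' := by
  simp [parity_apply, A.act_map_mul, S.b_p, S.refl_one]

/-- The `ℤ/2`-grading by fermion parity: `a` has degree `i` iff `R(p) a = (-1)^i a`. -/
def deg (i : ZMod 2) : Submodule ℂ A.carrier where
  carrier := {a | A.parity a = (-1 : ℤˣ) ^ i • a}
  add_mem' {a a'} ha ha' := by
    exact (map_add A.parity a a').trans ((congrArg₂ _ ha ha').trans (smul_add _ a a').symm)
  zero_mem' := by simp
  smul_mem' c a ha := by
    exact (map_smul A.parity c a).trans ((congrArg _ ha).trans (smul_comm c _ a))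

theorem mem_deg {i : ZMod 2} {a : A.carrier} :
    a ∈ A.deg i ↔ A.parity a = (-1 : ℤˣ) ^ i • a := Iff.rfl

theorem mem_deg_zero {a : A.carrier} : a ∈ A.deg 0 ↔ A.parity a = a := by
  rw [mem_deg, uzpow_zero, one_smul]

theorem mem_deg_one {a : A.carrier} : a ∈ A.deg 1 ↔ A.parity a = -a := by
  rw [mem_deg, uzpow_one, Units.neg_smul, one_smul]

theorem zmod_two_cases (i : ZMod 2) : i = 0 ∨ i = 1 := by
  revert i; decide

theorem act_mem_deg (g : G) {i : ZMod 2} {a : A.carrier} (h : a ∈ A.deg i) :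
    A.act g a ∈ A.deg i := by
  rcases zmod_two_cases i with rfl | rfl
  · rw [mem_deg_zero] at *
    rw [parity_act, h]
  · rw [mem_deg_one] at *
    rw [parity_act, h, map_neg]

theorem half_add_mem (a : A.carrier) : (1 / 2 : ℂ) • (a + A.parity a) ∈ A.deg 0 := by
  rw [mem_deg_zero, map_smul, map_add, parity_parity, add_comm]

theorem half_sub_mem (a : A.carrier) : (1 / 2 : ℂ) • (a - A.parity a) ∈ A.deg 1 := by
  rw [mem_deg_one, map_smul, map_sub, parity_parity, ← smul_neg, neg_sub]

/-- The decomposition of an element into its even and odd parts. -/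
def decomposeHom : A.carrier →+ DirectSum (ZMod 2) (fun i => A.deg i) where
  toFun a := DirectSum.of (fun i => A.deg i) 0 ⟨_, A.half_add_mem a⟩ +
    DirectSum.of (fun i => A.deg i) 1 ⟨_, A.half_sub_mem a⟩
  map_zero' := by
    have h0 : (⟨_, A.half_add_mem 0⟩ : A.deg 0) = 0 := by ext; simp
    have h1 : (⟨_, A.half_sub_mem 0⟩ : A.deg 1) = 0 := by ext; simp
    rw [h0, h1, map_zero, map_zero, add_zero]
  map_add' a a' := by
    have h0 : (⟨_, A.half_add_mem (a + a')⟩ : A.deg 0) =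
        ⟨_, A.half_add_mem a⟩ + ⟨_, A.half_add_mem a'⟩ := by
      ext; simp only [map_add, Submodule.coe_add]; module
    have h1 : (⟨_, A.half_sub_mem (a + a')⟩ : A.deg 1) =
        ⟨_, A.half_sub_mem a⟩ + ⟨_, A.half_sub_mem a'⟩ := by
      ext; simp only [map_add, Submodule.coe_add]; module
    rw [h0, h1, map_add, map_add]
    abel

theorem decomposeHom_apply (a : A.carrier) : decomposeHom A a =
    DirectSum.of (fun i => A.deg i) 0 ⟨_, A.half_add_mem a⟩ +
      DirectSum.of (fun i => A.deg i) 1 ⟨_, A.half_sub_mem a⟩ := rfl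

instance : GradedAlgebra A.deg where
  one_mem := A.mem_deg_zero.2 A.parity_one
  mul_mem i j a a' ha ha' := by
    rw [mem_deg] at *
    rw [parity_mul, ha, ha', uzpow_add, smul_mul_smul_comm]
  decompose' := decomposeHom A
  left_inv a := by
    rw [decomposeHom_apply, map_add, DirectSum.coeAddMonoidHom_of, DirectSum.coeAddMonoidHom_of]
    module
  right_inv z := by
    induction z using DirectSum.induction_on with
    | zero => simp
    | of i a =>
      obtain ⟨a, ha⟩ := a
      rw [DirectSum.coeAddMonoidHom_of, decomposeHom_apply]
      rcases zmod_two_cases i with rfl | rfl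
      · have h := A.mem_deg_zero.1 ha
        have h0 : (⟨_, A.half_add_mem a⟩ : A.deg 0) = ⟨a, ha⟩ := by
          ext; simp only [h]; module
        have h1 : (⟨_, A.half_sub_mem a⟩ : A.deg 1) = 0 := by
          ext; simp only [h, sub_self, smul_zero, ZeroMemClass.coe_zero]
        rw [h0, h1, map_zero, add_zero]
      · have h := A.mem_deg_one.1 ha
        have h0 : (⟨_, A.half_add_mem a⟩ : A.deg 0) = 0 := by
          ext; simp only [h, add_neg_cancel, smul_zero, ZeroMemClass.coe_zero]
        have h1 : (⟨_, A.half_sub_mem a⟩ : A.deg 1) = ⟨a, ha⟩ := by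
          ext; simp only [h]; module
        rw [h0, h1, map_zero, zero_add]
    | add z w hz hw => rw [map_add, map_add, hz, hw]

/-- Every additive statement about the supertensor product may be checked on `a ⊗ a'` with `a`
and `a'` homogeneous. -/
theorem tensor_induction {P : A.deg ᵍ⊗[ℂ] B.deg → Prop}
    (hadd : ∀ z w, P z → P w → P (z + w))
    (h : ∀ i j a a', a ∈ A.deg i → a' ∈ B.deg j → P (a ᵍ⊗ₜ[ℂ] a')) (z) : P z := by
  have key : ∀ (a : A.carrier) (a' : B.carrier), P (a ᵍ⊗ₜ[ℂ] a') := by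
    intro a a'
    have e : (a ᵍ⊗ₜ[ℂ] a' : A.deg ᵍ⊗[ℂ] B.deg) =
        ((1 / 2 : ℂ) • (a + A.parity a)) ᵍ⊗ₜ[ℂ] ((1 / 2 : ℂ) • (a' + B.parity a')) +
        ((1 / 2 : ℂ) • (a + A.parity a)) ᵍ⊗ₜ[ℂ] ((1 / 2 : ℂ) • (a' - B.parity a')) +
        (((1 / 2 : ℂ) • (a - A.parity a)) ᵍ⊗ₜ[ℂ] ((1 / 2 : ℂ) • (a' + B.parity a')) +
        ((1 / 2 : ℂ) • (a - A.parity a)) ᵍ⊗ₜ[ℂ] ((1 / 2 : ℂ) • (a' - B.parity a'))) := by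
      simp only [GradedTensorProduct.tmul, ← map_add, ← TensorProduct.tmul_add,
        ← TensorProduct.add_tmul]
      congr 2 <;> module
    rw [e]
    exact hadd _ _
      (hadd _ _ (h _ _ _ _ (A.half_add_mem a) (B.half_add_mem a'))
        (h _ _ _ _ (A.half_add_mem a) (B.half_sub_mem a')))
      (hadd _ _ (h _ _ _ _ (A.half_sub_mem a) (B.half_add_mem a'))
        (h _ _ _ _ (A.half_sub_mem a) (B.half_sub_mem a')))
  induction z using TensorProduct.induction_on with
  | zero =>
    have h0 := key 0 0
    rwa [GradedTensorProduct.tmul, TensorProduct.zero_tmul, map_zero] at h0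
  | tmul a a' => exact key a a'
  | add z w hz hw => exact hadd z w hz hw

/-- The Koszul sign operator `a ⊗ a' ↦ (-1)^(|a| |a'|) a ⊗ a'`. -/
def koszul : A.carrier ⊗[ℂ] B.carrier →ₗ[ℂ] A.carrier ⊗[ℂ] B.carrier :=
  (1 / 2 : ℂ) • (TensorProduct.map LinearMap.id LinearMap.id +
    TensorProduct.map A.parity LinearMap.id + TensorProduct.map LinearMap.id B.parity -
    TensorProduct.map A.parity B.parity)

/-- The action of `g` on the supertensor product: `a ⊗ a' ↦ R(g) a ⊗ R(g) a'`, with the Koszul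
sign `(-1)^(|a| |a'|)` if `g` reverses the orientation, i.e. the order of factors. -/
def tensorAct (g : G) :
    A.deg ᵍ⊗[ℂ] B.deg →ₛₗ[S.scal (S.b g)] A.deg ᵍ⊗[ℂ] B.deg :=
  (GradedTensorProduct.of ℂ A.deg B.deg).toLinearMap.comp
    ((TensorProduct.map (A.act g) (B.act g)).comp
      ((if S.refl (S.b g) = 1 then koszul A B else LinearMap.id).comp
        (GradedTensorProduct.of ℂ A.deg B.deg).symm.toLinearMap))

theorem tensorAct_tmul (g : G) {i j : ZMod 2} {a : A.carrier} {a' : B.carrier}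
    (ha : a ∈ A.deg i) (ha' : a' ∈ B.deg j) :
    tensorAct A B g (a ᵍ⊗ₜ[ℂ] a') =
      (-1 : ℤˣ) ^ (S.refl (S.b g) * (i * j)) • (A.act g a ᵍ⊗ₜ[ℂ] B.act g a') := by
  have hmap : ∀ (a : A.carrier) (a' : B.carrier),
      (GradedTensorProduct.of ℂ A.deg B.deg)
        (TensorProduct.map (A.act g) (B.act g) (a ⊗ₜ[ℂ] a')) =
      A.act g a ᵍ⊗ₜ[ℂ] B.act g a' := fun _ _ => rfl
  change (GradedTensorProduct.of ℂ A.deg B.deg) (TensorProduct.map (A.act g) (B.act g)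
    ((if S.refl (S.b g) = 1 then koszul A B else LinearMap.id) (a ⊗ₜ[ℂ] a'))) = _
  rcases zmod_two_cases (S.refl (S.b g)) with hr | hr
  · rw [hr, if_neg (by decide), LinearMap.id_apply, hmap, zero_mul, uzpow_zero, one_smul]
  · have hk : koszul A B (a ⊗ₜ[ℂ] a') = (-1 : ℤˣ) ^ (i * j) • (a ⊗ₜ[ℂ] a') := by
      simp only [koszul, LinearMap.smul_apply, LinearMap.add_apply, LinearMap.sub_apply,
        TensorProduct.map_tmul, LinearMap.id_apply]
      rcases zmod_two_cases i with rfl | rfl <;> rcases zmod_two_cases j with rfl | rfl <;>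
        simp only [mem_deg_zero, mem_deg_one] at ha ha' <;>
        simp only [ha, ha', mul_zero, mul_one, uzpow_zero, uzpow_one, one_smul,
          Units.neg_smul, TensorProduct.neg_tmul, TensorProduct.tmul_neg] <;>
        module
    rw [hr, if_pos rfl, hk, one_mul, ← hmap]
    rcases zmod_two_cases (i * j) with h | h <;> rw [h] <;>
      simp only [uzpow_zero, uzpow_one, one_smul, Units.neg_smul, map_neg]

theorem map_units_smul {V W : Type*} [AddCommGroup V] [AddCommGroup W] {F : Type*}
    [FunLike F V W] [AddMonoidHomClass F V W] (f : F) (u : ℤˣ) (v : V) : f (u • v) = u • f v := by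
  rcases Int.units_eq_one_or u with rfl | rfl <;> simp

theorem tensorAct_tmul_mul (g : G) {i j k l : ZMod 2} {a c : A.carrier} {a' c' : B.carrier}
    (ha : a ∈ A.deg i) (ha' : a' ∈ B.deg j) (hc : c ∈ A.deg k) (hc' : c' ∈ B.deg l) :
    tensorAct A B g (a ᵍ⊗ₜ[ℂ] a' * c ᵍ⊗ₜ[ℂ] c') =
      if S.refl (S.b g) = 1 then
        tensorAct A B g (c ᵍ⊗ₜ[ℂ] c') * tensorAct A B g (a ᵍ⊗ₜ[ℂ] a')
      else tensorAct A B g (a ᵍ⊗ₜ[ℂ] a') * tensorAct A B g (c ᵍ⊗ₜ[ℂ] c') := by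
  have hmul : ∀ {i j k l : ZMod 2} {a c : A.carrier} {a' c' : B.carrier} (_ : a ∈ A.deg i)
      (_ : a' ∈ B.deg j) (_ : c ∈ A.deg k) (_ : c' ∈ B.deg l),
      (a ᵍ⊗ₜ[ℂ] a' * c ᵍ⊗ₜ[ℂ] c' : A.deg ᵍ⊗[ℂ] B.deg) =
        (-1 : ℤˣ) ^ (j * k) • ((a * c) ᵍ⊗ₜ[ℂ] (a' * c')) := by
    intro i j k l a c a' c' _ ha' hc _
    exact GradedTensorProduct.tmul_coe_mul_coe_tmul A.deg B.deg a ⟨a', ha'⟩ ⟨c, hc⟩ c'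
  rw [hmul ha ha' hc hc', map_units_smul, tensorAct_tmul A B g (SetLike.mul_mem_graded ha hc)
    (SetLike.mul_mem_graded ha' hc'), tensorAct_tmul A B g ha ha', tensorAct_tmul A B g hc hc',
    smul_mul_smul_comm, smul_mul_smul_comm,
    hmul (A.act_mem_deg g ha) (B.act_mem_deg g ha') (A.act_mem_deg g hc) (B.act_mem_deg g hc'),
    hmul (A.act_mem_deg g hc) (B.act_mem_deg g hc') (A.act_mem_deg g ha) (B.act_mem_deg g ha'),
    A.act_map_mul, B.act_map_mul]
  rcases zmod_two_cases (S.refl (S.b g)) with hr | hr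
  · simp only [hr, if_neg (show ¬ ((0 : ZMod 2) = 1) by decide), zero_mul, uzpow_zero, one_smul,
      one_mul]
  · simp only [hr, if_true, one_mul, smul_smul, ← uzpow_add]
    congr 2
    have key : ∀ i j k l : ZMod 2,
        j * k + (i + k) * (j + l) = k * l + i * j + l * i := by decide
    exact key i j k l

/-- Stacking: the supertensor product of equivariant algebras. -/
def stack : EquivariantAlgebra S where
  carrier := A.deg ᵍ⊗[ℂ] B.deg
  finite := Module.Finite.equiv (GradedTensorProduct.of ℂ A.deg B.deg)
  act := tensorAct A B
  act_one z := by
    induction z using tensor_induction with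
    | hadd z w hz hw => rw [map_add, hz, hw]
    | h i j a a' ha ha' =>
      rw [tensorAct_tmul A B 1 ha ha', A.act_one, B.act_one, map_one, S.refl_one, zero_mul,
        uzpow_zero, one_smul]
  act_mul g h z := by
    induction z using tensor_induction with
    | hadd z w hz hw => rw [map_add, map_add, map_add, hz, hw]
    | h i j a a' ha ha' =>
      rw [tensorAct_tmul A B _ ha ha', tensorAct_tmul A B h ha ha', map_units_smul,
        tensorAct_tmul A B g (A.act_mem_deg h ha) (B.act_mem_deg h ha'), A.act_mul, B.act_mul, map_mul,
        S.refl_mul, smul_smul, ← uzpow_add, ← add_mul, add_comm]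
  act_map_one g := by
    have h := tensorAct_tmul A B g (A.mem_deg_zero.2 A.parity_one) (B.mem_deg_zero.2 B.parity_one)
    rw [mul_zero, mul_zero, uzpow_zero, one_smul, A.act_map_one, B.act_map_one] at h
    exact h
  act_map_mul g z w := by
    induction z using tensor_induction with
    | hadd z z' hz hz' =>
      rw [add_mul, map_add, map_add, hz, hz']
      split_ifs
      · rw [mul_add]
      · rw [add_mul]
    | h i j a a' ha ha' =>
      induction w using tensor_induction with
      | hadd w w' hw hw' =>
        rw [mul_add, map_add, map_add, hw, hw']
        split_ifs
        · rw [add_mul]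
        · rw [mul_add]
      | h k l c c' hc hc' => exact tensorAct_tmul_mul A B g ha ha' hc hc'

end EquivariantAlgebra

/-! ### Cochains -/

/-- The inclusion `½ : ℤ/2 → U(1) = ℝ/ℤ`. -/
def half (i : ZMod 2) : UnitAddCircle := (((i.val : ℝ) / 2 : ℝ) : UnitAddCircle)

/-- The action `(-1)^i` of `ℤ/2` on `U(1) = ℝ/ℤ`. -/
def twist (i : ZMod 2) (a : UnitAddCircle) : UnitAddCircle := if i = 1 then -a else a

/-- The phase `e^{2πia}`. -/
def phase (a : UnitAddCircle) : ℂ := (AddCircle.toCircle a : ℂ)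

/-- The `x`-twisted coboundary of a `U(1)`-valued 1-cochain. -/
def dOne {K : Type*} [Group K] (x : K → ZMod 2) (L : K → UnitAddCircle) (g h : K) :
    UnitAddCircle := twist (x g) (L h) - L (g * h) + L g

/-- The `x`-twisted coboundary of a `U(1)`-valued 2-cochain. -/
def dTwo {K : Type*} [Group K] (x : K → ZMod 2) (a : K → K → UnitAddCircle) (g h k : K) :
    UnitAddCircle := twist (x g) (a h k) - a (g * h) k + a g (h * k) - a g h

/-- Cochain-level data of the invariants `(α, β, γ)`. -/
structure Invariants (Gb : Type*) where
  α : Gb → Gb → UnitAddCircle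
  β : Gb → ZMod 2
  γ : ZMod 2

section

variable {S : SymmetryClass G Gb}

/-- The conditions on `(α, β, γ)`: `δβ = 0`, `δ_T α = ½ β ∪ ρ` where `ρ = δt`, and `γ = 1` only if
`G` is split. -/
structure Invariants.Admissible (t : S.Trivialization) (I : Invariants Gb) : Prop where
  dβ : ∀ g h, I.β (g * h) = I.β g + I.β h
  dα : ∀ g h k : G, dTwo S.x I.α (S.b g) (S.b h) (S.b k) =
    half (I.β (S.b g) * (t.t h + t.t k - t.t (h * k)))
  dγ : I.γ = 1 → S.Splits

/-- Equivalence of invariants: `β` and `γ` agree, and the 2-cochains `α` differ by a twisted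
coboundary on `G` that only depends on arguments in `Gb`. -/
def Invariants.Equivalent (S : SymmetryClass G Gb) (I J : Invariants Gb) : Prop :=
  I.β = J.β ∧ I.γ = J.γ ∧ ∃ L : G → UnitAddCircle, ∀ g h : G,
    I.α (S.b g) (S.b h) - J.α (S.b g) (S.b h) = dOne (fun k => S.x (S.b k)) L g h

/-- The twisted 2-cocycle `ω(g,h) = α(ḡ,h̄) + ½ β(ḡ) t(h)` on `G`. -/
def Invariants.omega (t : S.Trivialization) (I : Invariants Gb) (g h : G) : UnitAddCircle :=
  I.α (S.b g) (S.b h) + half (I.β (S.b g) * t.t h)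

/-! ### Projective actions and SRE algebras -/

/-- The unitary matrices `M g` make the operators `Q g = M g ∘ K^(x g)`, with `K` complex
conjugation, a projective action with 2-cochain `ω`: `Q g ∘ Q h = e^{2πiω(g,h)} Q (g h)`. -/
def IsProjective {K : Type*} [Group K] (x : K → ZMod 2) {n : ℕ}
    (M : K → Matrix.unitaryGroup (Fin n) ℂ) (ω : K → K → UnitAddCircle) : Prop :=
  ∀ g h, (M g : Matrix (Fin n) (Fin n) ℂ) *
      (if x g = 1 then (M h : Matrix (Fin n) (Fin n) ℂ).map (starRingEnd ℂ) else M h) =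
    phase (ω g h) • (M (g * h) : Matrix (Fin n) (Fin n) ℂ)

/-- The operation on matrices underlying the action of `g`: entrywise complex conjugation if `g` is
anti-unitary, and transposition if `g` reverses orientation. -/
def matrixOp (S : SymmetryClass G Gb) {n : ℕ} (g : Gb) (N : Matrix (Fin n) (Fin n) ℂ) :
    Matrix (Fin n) (Fin n) ℂ :=
  if S.refl g = 1 then (N.map (S.scal g)).transpose else N.map (S.scal g)

/-- The Clifford algebra `ℂℓ(1) = ℂ ⊕ ℂΓ` on one generator with `Γ² = 1`. -/
abbrev Cl1 : Type := QuadraticAlgebra ℂ 1 0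

/-- The generator of `ℂℓ(1)`. -/
def Gam : Cl1 := ⟨0, 1⟩

theorem Gam_mul_Gam : Gam * Gam = 1 := by
  ext <;> simp [Gam, QuadraticAlgebra.re_one, QuadraticAlgebra.im_one]

/-- `A` is equivariantly isomorphic to `End U`, `U = ℂⁿ ≠ 0` a projective representation of `G`
with 2-cocycle `ω`. -/
def EvenWith (A : EquivariantAlgebra S) (ω : G → G → UnitAddCircle) : Prop :=
  ∃ (n : ℕ) (_ : 0 < n) (M : G → Matrix.unitaryGroup (Fin n) ℂ)
    (φ : A.carrier ≃ₐ[ℂ] Matrix (Fin n) (Fin n) ℂ),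
    IsProjective (fun g => S.x (S.b g)) M ω ∧
    ∀ g a, φ (A.act g a) = (M g : Matrix (Fin n) (Fin n) ℂ) * matrixOp S (S.b g) (φ a) *
      ((M g)⁻¹ : Matrix.unitaryGroup (Fin n) ℂ)

/-- `A` is equivariantly isomorphic to `End U_b ⊗ ℂℓ(1)`, where `U_b = ℂⁿ ≠ 0` is a projective
representation of `Gb` with 2-cocycle `α` and `g` acts on `Γ` by the sign `(-1)^(χ g)`. -/
def OddWith (A : EquivariantAlgebra S) (α : Gb → Gb → UnitAddCircle) (χ : G → ZMod 2) : Prop :=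
  ∃ (n : ℕ) (_ : 0 < n) (M : Gb → Matrix.unitaryGroup (Fin n) ℂ)
    (φ : A.carrier ≃ₐ[ℂ] Matrix (Fin n) (Fin n) ℂ ⊗[ℂ] Cl1),
    IsProjective S.x M α ∧
    ∀ (g : G) (N : Matrix (Fin n) (Fin n) ℂ) (m : ℕ),
      φ (A.act g (φ.symm (N ⊗ₜ[ℂ] Gam ^ m))) = (-1 : ℤˣ) ^ (χ g * (m : ZMod 2)) •
        (((M (S.b g) : Matrix (Fin n) (Fin n) ℂ) * matrixOp S (S.b g) N *
          ((M (S.b g))⁻¹ : Matrix.unitaryGroup (Fin n) ℂ)) ⊗ₜ[ℂ] Gam ^ m)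

/-- Even SRE algebras. -/
def IsEven (A : EquivariantAlgebra S) : Prop := ∃ ω, EvenWith A ω

/-- Odd SRE algebras; fermion parity acts by `Γ ↦ -Γ`. -/
def IsOdd (A : EquivariantAlgebra S) : Prop := ∃ α χ, χ S.p = 1 ∧ OddWith A α χ

/-- The algebras of fixed points in short-range entangled (SRE) phases. -/
def IsSRE (A : EquivariantAlgebra S) : Prop := IsEven A ∨ IsOdd A

/-- `(α, β, γ)` are invariants of the SRE algebra `A`, relative to the trivialization `t`. If
`γ = 0`, then `A ≃ End U` where `U` has cocycle `α + ½ β t`; if `γ = 1`, then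
`A ≃ End U_b ⊗ ℂℓ(1)` where `U_b` has cocycle `α` and `g` acts on `Γ` by `(-1)^(β(g) + t(g))`. -/
def HasInvariants (t : S.Trivialization) (A : EquivariantAlgebra S) (I : Invariants Gb) : Prop :=
  (I.γ = 0 ∧ EvenWith A (I.omega t)) ∨
  (I.γ = 1 ∧ OddWith A I.α (fun g => I.β (S.b g) + t.t g))

/-! ### Morita classes -/

/-- `A` is equivariantly isomorphic to the full corner `e C e` at an invariant idempotent `e`. -/
def IsFullCorner (A C : EquivariantAlgebra S) (e : C.carrier) : Prop :=
  e * e = e ∧ (∀ g, C.act g e = e) ∧ TwoSidedIdeal.span {e} = ⊤ ∧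
  ∃ ι : A.carrier →ₗ[ℂ] C.carrier, Function.Injective ι ∧
    (∀ a a', ι (a * a') = ι a * ι a') ∧ (∀ c, c ∈ Set.range ι ↔ e * c * e = c) ∧
    ∀ g a, ι (A.act g a) = C.act g (ι a)

/-- Equivariant Morita equivalence: `A` and `B` are complementary full corners of an equivariant
linking algebra. (If no symmetry reverses orientation, the off-diagonal corners form an
invertible equivariant bimodule; an orientation-reversing symmetry exchanges them.) -/
def MoritaEquivalent (A B : EquivariantAlgebra S) : Prop :=
  ∃ (C : EquivariantAlgebra S) (e : C.carrier), IsFullCorner A C e ∧ IsFullCorner B C (1 - e)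

end

/-- Fermionic SRE phases with symmetry `S`: Morita classes of SRE algebras. -/
def Phase (S : SymmetryClass G Gb) : Type _ :=
  Quot (fun A B : {A : EquivariantAlgebra S // IsSRE A} => MoritaEquivalent A.1 B.1)

/-- The phase of an SRE algebra. -/
def Phase.mk {S : SymmetryClass G Gb} (A : EquivariantAlgebra S) (hA : IsSRE A) : Phase S :=
  Quot.mk _ ⟨A, hA⟩

end FermionicStacking

end

open FermionicStacking

open scoped TensorProduct

noncomputable section

namespace FermionicStacking

open scoped Kronecker

section

/-! ### Phases and signs -/

/-! Transposition is conjugate transposition composed with complex conjugation. Hence `g` acts on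
matrices by `x(g)` complex conjugations, then `r(g)` conjugate transpositions, then conjugation by a
unitary. Conjugate transposition is compatible with conjugation by a unitary, so only `x` twists the
cocycles (`matrixOp_eq`, `op_conj`). Since ℂℓ(1) ≃ ℂ × ℂ with Γ = (1, -1), an odd algebra is `M_n ×
M_n`, where `χ(g) = 1` exchanges the factors (`oddWith_iff`).

Invariants. In an even algebra one rescales `M` so that `M(pg) = P M(g)` with `P² = 1`. Each `g`
commutes with `P` up to a sign (-1)^{β(g)}, and the cocycle minus ½ β t then descends to the bosonic
group. The cocycle condition on α + ½ β t is exactly admissibility. Conversely, every twisted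
cocycle of a finite group is realized by its twisted regular representation (`exists_isProj`).

Morita equivalence. If the cocycles agree, the endomorphisms of the direct sum of the two
representations form a linking algebra. In the other direction, a rank-one idempotent in each corner
gives off-diagonal elements that are unique up to scalars. The phases by which the symmetries act on
them form a cochain relating the two cocycles (`MatrixCorner.exists_cochain`). For odd algebras this
is applied to the parity-even part of the linking algebra. The central involution Γ and its signs,
which pass through full corners, determine γ and β.

Stacking. In each parity case one exhibits supercommuting copies of the two algebras that generate a
matrix algebra, or a product of two, of the right dimension (`exists_stack_equiv`). The Koszul sign
is produced by inserting powers of the parity operator, or by Pauli matrices when both factors are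
odd. Compensating these insertions in the action gives the cup products and the shift by `x`. The
group axioms are then checked on invariants, where the discrepancies are explicit coboundaries,
including ½ f ∪ f + ½ x ∪ f = δ_T(f/4). -/

theorem phase_add (a b : UnitAddCircle) : phase (a + b) = phase a * phase b := by
  simp [phase, AddCircle.toCircle_add]

theorem phase_zero : phase 0 = 1 := by simp [phase]

theorem phase_neg (a : UnitAddCircle) : phase (-a) = (phase a)⁻¹ := by
  simp [phase, AddCircle.toCircle_neg]

theorem norm_phase (a : UnitAddCircle) : ‖phase a‖ = 1 := Circle.norm_coe _

theorem phase_injective : Function.Injective phase := fun _ _ h =>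
  AddCircle.injective_toCircle one_ne_zero (Subtype.ext h)

theorem star_phase (a : UnitAddCircle) : starRingEnd ℂ (phase a) = phase (-a) := by
  rw [phase, phase, AddCircle.toCircle_neg, Circle.coe_inv_eq_conj]

theorem exists_phase {z : ℂ} (hz : ‖z‖ = 1) : ∃ a, z = phase a := by
  obtain ⟨a, ha⟩ := (AddCircle.homeomorphCircle (one_ne_zero (α := ℝ))).surjective
    ⟨z, mem_sphere_zero_iff_norm.2 hz⟩
  refine ⟨a, ?_⟩
  rw [AddCircle.homeomorphCircle_apply] at ha
  exact (congrArg Subtype.val ha).symm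

theorem exists_norm_mul_phase {z : ℂ} (hz : z ≠ 0) : ∃ a, z = (‖z‖ : ℂ) * phase a := by
  have h : (‖z‖ : ℂ) ≠ 0 := by exact_mod_cast norm_ne_zero_iff.2 hz
  obtain ⟨a, ha⟩ := exists_phase (z := z / ‖z‖) (by
    rw [norm_div, Complex.norm_real, norm_norm, div_self (norm_ne_zero_iff.2 hz)])
  exact ⟨a, by rw [← ha, mul_div_cancel₀ _ h]⟩

/-- Intertwiners between corners are not normalized, so their scalars carry moduli; this discards
the moduli and keeps the phases. -/
theorem eq_of_pos_mul_phase {r s : ℝ} (hr : 0 < r) (hs : 0 < s) {a b : UnitAddCircle}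
    (h : (r : ℂ) * phase a = s * phase b) : a = b := by
  have h1 := congrArg norm h
  rw [norm_mul, norm_mul, norm_phase, norm_phase, Complex.norm_real, Complex.norm_real,
    Real.norm_of_nonneg hr.le, Real.norm_of_nonneg hs.le, mul_one, mul_one] at h1
  subst h1
  exact phase_injective (mul_left_cancel₀ (by exact_mod_cast hr.ne') h)

/-- The sign `(-1)^i`. -/
def sgn (i : ZMod 2) : ℂ := if i = 1 then -1 else 1

@[simp] theorem sgn_zero : sgn 0 = 1 := rfl

@[simp] theorem sgn_one : sgn 1 = -1 := rfl

theorem zcases (i : ZMod 2) : i = 0 ∨ i = 1 := EquivariantAlgebra.zmod_two_cases i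

theorem sgn_add (i j : ZMod 2) : sgn (i + j) = sgn i * sgn j := by
  rcases zcases i with rfl | rfl <;> rcases zcases j with rfl | rfl <;>
    simp [show (1 + 1 : ZMod 2) = 0 from rfl]

theorem sgn_mul_self (i : ZMod 2) : sgn i * sgn i = 1 := by
  rcases zcases i with rfl | rfl <;> simp

theorem sgn_injective : Function.Injective sgn := by
  intro i j h
  rcases zcases i with rfl | rfl <;> rcases zcases j with rfl | rfl <;>
    first | rfl | (norm_num at h)

theorem units_smul_eq_sgn {V : Type*} [AddCommGroup V] [Module ℂ V] (i : ZMod 2) (v : V) :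
    (-1 : ℤˣ) ^ i • v = sgn i • v := by
  rcases zcases i with rfl | rfl <;> simp [Units.neg_smul]

theorem half_zero : half 0 = 0 := by simp [half]

theorem half_one_add_half_one : half 1 + half 1 = 0 := by
  simp only [half, ← AddCircle.coe_add, ZMod.val_one]
  norm_num


theorem half_add (i j : ZMod 2) : half (i + j) = half i + half j := by
  rcases zcases i with rfl | rfl <;> rcases zcases j with rfl | rfl <;>
    simp [half_zero, show (1 + 1 : ZMod 2) = 0 from rfl, half_one_add_half_one]

theorem half_add_self (i : ZMod 2) : half i + half i = 0 := by
  rw [← half_add, CharTwo.add_self_eq_zero, half_zero]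

theorem neg_half (i : ZMod 2) : -half i = half i := by
  rw [neg_eq_iff_add_eq_zero, half_add_self]

theorem phase_half (i : ZMod 2) : phase (half i) = sgn i := by
  rcases zcases i with rfl | rfl
  · rw [half_zero, phase_zero, sgn_zero]
  · have h : half 1 = ((1 / 2 : ℝ) : UnitAddCircle) := by simp [half, ZMod.val_one]
    rw [h, phase, AddCircle.toCircle_apply_mk, Circle.coe_exp, sgn_one, ← Complex.exp_pi_mul_I]
    congr 1
    push_cast
    ring

theorem half_injective : Function.Injective half := fun i j h =>
  sgn_injective (by rw [← phase_half, ← phase_half, h])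

theorem twist_zero_left (a : UnitAddCircle) : twist 0 a = a := rfl

theorem twist_one_left (a : UnitAddCircle) : twist 1 a = -a := rfl

theorem twist_add (i : ZMod 2) (a b : UnitAddCircle) :
    twist i (a + b) = twist i a + twist i b := by
  rcases zcases i with rfl | rfl <;> simp [twist_zero_left, twist_one_left, add_comm]

theorem twist_zero (i : ZMod 2) : twist i 0 = 0 := by
  rcases zcases i with rfl | rfl <;> simp [twist_zero_left, twist_one_left]

theorem twist_neg (i : ZMod 2) (a : UnitAddCircle) : twist i (-a) = -twist i a := by
  rcases zcases i with rfl | rfl <;> simp [twist_zero_left, twist_one_left]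

theorem twist_half (i j : ZMod 2) : twist i (half j) = half j := by
  rcases zcases i with rfl | rfl <;> simp [twist_zero_left, twist_one_left, neg_half]

theorem twist_twist (i j : ZMod 2) (a : UnitAddCircle) :
    twist i (twist j a) = twist (i + j) a := by
  rcases zcases i with rfl | rfl <;> rcases zcases j with rfl | rfl <;>
    simp [twist_zero_left, twist_one_left, show (1 + 1 : ZMod 2) = 0 from rfl]

/-- The field automorphism of `ℂ` given by `i : ℤ/2`. -/
def conjPow (i : ZMod 2) : ℂ →+* ℂ := if i = 1 then starRingEnd ℂ else RingHom.id ℂ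

theorem conjPow_zero : conjPow 0 = RingHom.id ℂ := rfl

theorem conjPow_one : conjPow 1 = starRingEnd ℂ := rfl

theorem conjPow_phase (i : ZMod 2) (a : UnitAddCircle) :
    conjPow i (phase a) = phase (twist i a) := by
  rcases zcases i with rfl | rfl
  · rfl
  · exact star_phase a

theorem conjPow_sgn (i j : ZMod 2) : conjPow i (sgn j) = sgn j := by
  rcases zcases i with rfl | rfl <;> rcases zcases j with rfl | rfl <;>
    simp [conjPow_zero, conjPow_one]

theorem conjPow_half (i : ZMod 2) : conjPow i (1 / 2 : ℂ) = 1 / 2 := by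
  rw [map_div₀, map_one, map_ofNat]

theorem conjPow_add (i j : ZMod 2) (c : ℂ) : conjPow (i + j) c = conjPow i (conjPow j c) := by
  rcases zcases i with rfl | rfl <;> rcases zcases j with rfl | rfl <;>
    simp [conjPow_zero, conjPow_one, show (1 + 1 : ZMod 2) = 0 from rfl]

theorem scal_eq {G Gb : Type*} [Group G] [Group Gb] (S : SymmetryClass G Gb) (g : Gb) :
    S.scal g = conjPow (S.anti g) := rfl

/-! ### Conjugation and adjunction of matrices -/

section Matrices

set_option linter.unusedSectionVars false

variable {ι κ : Type*} [Fintype ι] [DecidableEq ι] [Fintype κ] [DecidableEq κ]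

/-- Entrywise complex conjugation, applied `i` times. -/
def cj (i : ZMod 2) : Matrix ι ι ℂ →+* Matrix ι ι ℂ := (conjPow i).mapMatrix

theorem cj_apply (i : ZMod 2) (N : Matrix ι ι ℂ) : cj i N = N.map (conjPow i) := rfl

theorem cj_zero (N : Matrix ι ι ℂ) : cj 0 N = N := by
  ext; simp [cj_apply, conjPow_zero]

theorem cj_add (i j : ZMod 2) (N : Matrix ι ι ℂ) : cj (i + j) N = cj i (cj j N) := by
  ext; simp [cj_apply, conjPow_add]

theorem cj_eq_ite (i : ZMod 2) (N : Matrix ι ι ℂ) :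
    cj i N = if i = 1 then N.map (starRingEnd ℂ) else N := by
  rcases zcases i with rfl | rfl
  · rw [cj_zero, if_neg (by decide)]
  · rfl

theorem cj_smul (i : ZMod 2) (c : ℂ) (N : Matrix ι ι ℂ) :
    cj i (c • N) = conjPow i c • cj i N := by
  ext; simp [cj_apply]

theorem cj_star (i : ZMod 2) (N : Matrix ι ι ℂ) : cj i (star N) = star (cj i N) := by
  rcases zcases i with rfl | rfl
  · rw [cj_zero, cj_zero]
  · ext; simp [cj_apply, conjPow_one, Matrix.star_apply]

theorem cj_kronecker (i : ZMod 2) (N : Matrix ι ι ℂ) (N' : Matrix κ κ ℂ) :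
    cj i (N ⊗ₖ N') = cj i N ⊗ₖ cj i N' := by
  ext; simp [cj_apply, Matrix.kroneckerMap_apply]

theorem cj_fromBlocks (i : ZMod 2) (N : Matrix ι ι ℂ) (N' : Matrix κ κ ℂ) :
    cj i (Matrix.fromBlocks N 0 0 N') = Matrix.fromBlocks (cj i N) 0 0 (cj i N') := by
  rw [cj_apply, Matrix.fromBlocks_map, Matrix.map_zero _ (map_zero _),
    Matrix.map_zero _ (map_zero _)]
  rfl

theorem cj_reindex (i : ZMod 2) (e : ι ≃ κ) (N : Matrix ι ι ℂ) :
    cj i (Matrix.reindexAlgEquiv ℂ ℂ e N) = Matrix.reindexAlgEquiv ℂ ℂ e (cj i N) := by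
  ext; simp [cj_apply]

/-- Conjugate transposition, applied `i` times. -/
def starPow (i : ZMod 2) (N : Matrix ι ι ℂ) : Matrix ι ι ℂ := if i = 1 then star N else N

theorem starPow_zero (N : Matrix ι ι ℂ) : starPow 0 N = N := rfl

theorem starPow_one (N : Matrix ι ι ℂ) : starPow 1 N = star N := rfl

theorem star_reindex (e : ι ≃ κ) (N : Matrix ι ι ℂ) :
    star (Matrix.reindexAlgEquiv ℂ ℂ e N) = Matrix.reindexAlgEquiv ℂ ℂ e (star N) := by
  ext; simp [Matrix.star_apply]

theorem star_kron (N : Matrix ι ι ℂ) (N' : Matrix κ κ ℂ) :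
    star (N ⊗ₖ N') = star N ⊗ₖ star N' := by
  simp only [Matrix.star_eq_conjTranspose, Matrix.conjTranspose_kronecker]

theorem star_blocks (N : Matrix ι ι ℂ) (N' : Matrix κ κ ℂ) :
    star (Matrix.fromBlocks N 0 0 N') = Matrix.fromBlocks (star N) 0 0 (star N') := by
  simp only [Matrix.star_eq_conjTranspose, Matrix.fromBlocks_conjTranspose,
    Matrix.conjTranspose_zero]

/-- The operation underlying the action of a symmetry with `refl = r` and `x = x`. -/
def op (r x : ZMod 2) (N : Matrix ι ι ℂ) : Matrix ι ι ℂ := starPow r (cj x N)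

theorem op_add_arg (r x : ZMod 2) (N N' : Matrix ι ι ℂ) :
    op r x (N + N') = op r x N + op r x N' := by
  rcases zcases r with rfl | rfl <;> simp [op, starPow_zero, starPow_one]

theorem op_one (r x : ZMod 2) : op r x (1 : Matrix ι ι ℂ) = 1 := by
  rcases zcases r with rfl | rfl <;> simp [op, starPow_zero, starPow_one]

theorem op_smul (r x : ZMod 2) (c : ℂ) (N : Matrix ι ι ℂ) :
    op r x (c • N) = conjPow (x + r) c • op r x N := by
  rcases zcases r with rfl | rfl
  · simp [op, starPow_zero, cj_smul]
  · rw [op, op, starPow_one, starPow_one, cj_smul, star_smul, add_comm, conjPow_add]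
    rfl

theorem op_mul (r x : ZMod 2) (N N' : Matrix ι ι ℂ) :
    op r x (N * N') = if r = 1 then op r x N' * op r x N else op r x N * op r x N' := by
  rcases zcases r with rfl | rfl <;> simp [op, starPow_zero, starPow_one]

theorem op_op (r x r' x' : ZMod 2) (N : Matrix ι ι ℂ) :
    op r x (op r' x' N) = op (r + r') (x + x') N := by
  rcases zcases r with rfl | rfl <;> rcases zcases r' with rfl | rfl <;>
    simp [op, starPow_zero, starPow_one, cj_add, cj_star, show (1 + 1 : ZMod 2) = 0 from rfl]

theorem op_zero_zero (N : Matrix ι ι ℂ) : op 0 0 N = N := cj_zero N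

/-- Conjugate transposition sends `U N U*` to `U N* U*`, so reversing the order of products leaves
the unitary in place and only the conjugation by `x` reaches it. With plain transposition `U` would
be altered as well. -/
theorem op_conj (r x : ZMod 2) (U N : Matrix ι ι ℂ) :
    op r x (U * N * star U) = cj x U * op r x N * star (cj x U) := by
  rcases zcases r with rfl | rfl <;>
    simp [op, starPow_zero, starPow_one, cj_star, mul_assoc]

theorem op_reindex (r x : ZMod 2) (e : ι ≃ κ) (N : Matrix ι ι ℂ) :
    op r x (Matrix.reindexAlgEquiv ℂ ℂ e N) = Matrix.reindexAlgEquiv ℂ ℂ e (op r x N) := by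
  rcases zcases r with rfl | rfl <;>
    simp only [op, starPow_zero, starPow_one, cj_reindex, star_reindex]

theorem op_kronecker (r x : ZMod 2) (N : Matrix ι ι ℂ) (N' : Matrix κ κ ℂ) :
    op r x (N ⊗ₖ N') = op r x N ⊗ₖ op r x N' := by
  rcases zcases r with rfl | rfl <;>
    simp only [op, starPow_zero, starPow_one, cj_kronecker, star_kron]

theorem op_fromBlocks (r x : ZMod 2) (N : Matrix ι ι ℂ) (N' : Matrix κ κ ℂ) :
    op r x (Matrix.fromBlocks N 0 0 N') = Matrix.fromBlocks (op r x N) 0 0 (op r x N') := by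
  rcases zcases r with rfl | rfl <;>
    simp only [op, starPow_zero, starPow_one, cj_fromBlocks, star_blocks]

end Matrices

theorem x_add_refl {G Gb : Type*} [Group G] [Group Gb] (S : SymmetryClass G Gb) (g : Gb) :
    S.x g + S.refl g = S.anti g := by
  rw [SymmetryClass.x, add_assoc, CharTwo.add_self_eq_zero, add_zero]

theorem x_mul {G Gb : Type*} [Group G] [Group Gb] (S : SymmetryClass G Gb) (g h : Gb) :
    S.x (g * h) = S.x g + S.x h := by
  rw [SymmetryClass.x, SymmetryClass.x, SymmetryClass.x, S.anti_mul, S.refl_mul]; ring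

theorem x_one {G Gb : Type*} [Group G] [Group Gb] (S : SymmetryClass G Gb) : S.x 1 = 0 := by
  rw [SymmetryClass.x, S.anti_one, S.refl_one, add_zero]

/-- This trades the pair (anti-unitary, transpose) for the pair (`x`, conjugate transpose), which
explains why projective actions are twisted by `x`. -/
theorem matrixOp_eq {G Gb : Type*} [Group G] [Group Gb] (S : SymmetryClass G Gb) {n : ℕ} (g : Gb)
    (N : Matrix (Fin n) (Fin n) ℂ) : matrixOp S g N = op (S.refl g) (S.x g) N := by
  rcases zcases (S.refl g) with hr | hr
  · rw [matrixOp, hr, if_neg (by decide), op, starPow_zero, SymmetryClass.x, hr, add_zero]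
    rfl
  · rw [matrixOp, hr, if_pos rfl, op, starPow_one, scal_eq, ← x_add_refl, hr]
    ext i j
    simp only [Matrix.transpose_apply, Matrix.map_apply, Matrix.star_apply, cj_apply]
    rw [add_comm, conjPow_add]
    rfl

end

section

/-! ### Projective actions on general index types -/

section Projective

set_option linter.unusedSectionVars false

variable {K : Type*} [Group K] {ι κ : Type*} [Fintype ι] [DecidableEq ι] [Fintype κ]
  [DecidableEq κ]

/-- `M g ∘ K^(x g)` is a projective action with 2-cochain `ω`. -/
def IsProj (x : K → ZMod 2) (M : K → Matrix.unitaryGroup ι ℂ) (ω : K → K → UnitAddCircle) : Prop :=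
  ∀ g h, (M g : Matrix ι ι ℂ) * cj (x g) (M h) = phase (ω g h) • (M (g * h) : Matrix ι ι ℂ)

theorem isProjective_iff {x : K → ZMod 2} {n : ℕ} {M : K → Matrix.unitaryGroup (Fin n) ℂ}
    {ω : K → K → UnitAddCircle} : IsProjective x M ω ↔ IsProj x M ω := by
  simp only [IsProjective, IsProj, cj_eq_ite]

theorem unitary_mul_star (U : Matrix.unitaryGroup ι ℂ) :
    (U : Matrix ι ι ℂ) * star (U : Matrix ι ι ℂ) = 1 := Matrix.mem_unitaryGroup_iff.1 U.2

theorem unitary_star_mul (U : Matrix.unitaryGroup ι ℂ) :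
    star (U : Matrix ι ι ℂ) * (U : Matrix ι ι ℂ) = 1 := Matrix.mem_unitaryGroup_iff'.1 U.2

theorem unitary_mul_cancel (U : Matrix.unitaryGroup ι ℂ) {N N' : Matrix ι ι ℂ}
    (h : (U : Matrix ι ι ℂ) * N = U * N') : N = N' := by
  rw [← one_mul N, ← unitary_star_mul U, mul_assoc, h, ← mul_assoc, unitary_star_mul, one_mul]

/-- Multiplication of a unitary matrix by a phase. -/
def rephase (a : UnitAddCircle) (U : Matrix.unitaryGroup ι ℂ) : Matrix.unitaryGroup ι ℂ :=
  ⟨phase a • (U : Matrix ι ι ℂ), by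
    rw [Matrix.mem_unitaryGroup_iff, star_smul, smul_mul_smul_comm, unitary_mul_star,
      Complex.star_def, star_phase, ← phase_add, add_neg_cancel, phase_zero, one_smul]⟩

theorem coe_rephase (a : UnitAddCircle) (U : Matrix.unitaryGroup ι ℂ) :
    (rephase a U : Matrix ι ι ℂ) = phase a • (U : Matrix ι ι ℂ) := rfl

theorem star_coe_rephase (a : UnitAddCircle) (U : Matrix.unitaryGroup ι ℂ) :
    star (rephase a U : Matrix ι ι ℂ) = phase (-a) • star (U : Matrix ι ι ℂ) := by
  rw [coe_rephase, star_smul, Complex.star_def, star_phase]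

theorem rephase_conj (a : UnitAddCircle) (U : Matrix.unitaryGroup ι ℂ) (N : Matrix ι ι ℂ) :
    (rephase a U : Matrix ι ι ℂ) * N * star (rephase a U : Matrix ι ι ℂ) =
      U * N * star (U : Matrix ι ι ℂ) := by
  rw [star_coe_rephase, coe_rephase, smul_mul_assoc, smul_mul_smul_comm, ← phase_add,
    add_neg_cancel, phase_zero, one_smul]

variable {x : K → ZMod 2} {M : K → Matrix.unitaryGroup ι ℂ} {ω : K → K → UnitAddCircle}

theorem IsProj.rephase (hM : IsProj x M ω) (L : K → UnitAddCircle) :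
    IsProj x (fun g => rephase (L g) (M g)) (fun g h => ω g h + dOne x L g h) := by
  intro g h
  rw [coe_rephase, coe_rephase, coe_rephase, cj_smul, smul_mul_smul_comm, hM, smul_smul, smul_smul,
    conjPow_phase, ← phase_add, ← phase_add, ← phase_add]
  congr 2
  dsimp only [dOne]
  abel

theorem IsProj.congr (hM : IsProj x M ω) {ω' : K → K → UnitAddCircle}
    (h : ∀ g h, ω g h = ω' g h) : IsProj x M ω' := by
  intro g k
  rw [← h, hM]

theorem IsProj.comp {K' : Type*} [Group K'] (hM : IsProj x M ω) (f : K' →* K) :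
    IsProj (fun g => x (f g)) (fun g => M (f g)) (fun g h => ω (f g) (f h)) := by
  intro g h
  simp only [map_mul]
  exact hM _ _

theorem IsProj.apply_one (hx : x 1 = 0) (hM : IsProj x M ω) :
    (M 1 : Matrix ι ι ℂ) = phase (ω 1 1) • (1 : Matrix ι ι ℂ) := by
  have h := hM 1 1
  rw [hx, cj_zero, mul_one] at h
  refine unitary_mul_cancel (M 1) ?_
  rw [h, mul_smul_comm, mul_one]

/-- Transport along a bijection of index types. -/
def reindexUnitary (e : ι ≃ κ) (U : Matrix.unitaryGroup ι ℂ) : Matrix.unitaryGroup κ ℂ :=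
  ⟨Matrix.reindexAlgEquiv ℂ ℂ e U, by
    rw [Matrix.mem_unitaryGroup_iff, star_reindex, ← map_mul, unitary_mul_star, map_one]⟩

theorem coe_reindexUnitary (e : ι ≃ κ) (U : Matrix.unitaryGroup ι ℂ) :
    (reindexUnitary e U : Matrix κ κ ℂ) = Matrix.reindexAlgEquiv ℂ ℂ e U := rfl

theorem IsProj.reindex (hM : IsProj x M ω) (e : ι ≃ κ) :
    IsProj x (fun g => reindexUnitary e (M g)) ω := by
  intro g h
  rw [coe_reindexUnitary, coe_reindexUnitary, coe_reindexUnitary, cj_reindex, ← map_mul, hM,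
    map_smul]

/-- The unitary `U ⊗ V`. -/
def kronUnitary (U : Matrix.unitaryGroup ι ℂ) (V : Matrix.unitaryGroup κ ℂ) :
    Matrix.unitaryGroup (ι × κ) ℂ :=
  ⟨(U : Matrix ι ι ℂ) ⊗ₖ (V : Matrix κ κ ℂ), Matrix.kronecker_mem_unitary U.2 V.2⟩

theorem coe_kronUnitary (U : Matrix.unitaryGroup ι ℂ) (V : Matrix.unitaryGroup κ ℂ) :
    (kronUnitary U V : Matrix (ι × κ) (ι × κ) ℂ) = (U : Matrix ι ι ℂ) ⊗ₖ (V : Matrix κ κ ℂ) := rfl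

theorem IsProj.kron (hM : IsProj x M ω) {M' : K → Matrix.unitaryGroup κ ℂ}
    {ω' : K → K → UnitAddCircle} (hM' : IsProj x M' ω') :
    IsProj x (fun g => kronUnitary (M g) (M' g)) (fun g h => ω g h + ω' g h) := by
  intro g h
  rw [coe_kronUnitary, coe_kronUnitary, coe_kronUnitary, cj_kronecker, ← Matrix.mul_kronecker_mul,
    hM, hM', Matrix.smul_kronecker, Matrix.kronecker_smul, smul_smul, phase_add]

/-- The block sum of unitaries. -/
def blockUnitary (U : Matrix.unitaryGroup ι ℂ) (V : Matrix.unitaryGroup κ ℂ) :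
    Matrix.unitaryGroup (ι ⊕ κ) ℂ :=
  ⟨Matrix.fromBlocks U 0 0 V, by
    rw [Matrix.mem_unitaryGroup_iff, star_blocks, Matrix.fromBlocks_multiply]
    simp⟩

theorem coe_blockUnitary (U : Matrix.unitaryGroup ι ℂ) (V : Matrix.unitaryGroup κ ℂ) :
    (blockUnitary U V : Matrix (ι ⊕ κ) (ι ⊕ κ) ℂ) = Matrix.fromBlocks U 0 0 V := rfl

theorem IsProj.block (hM : IsProj x M ω) {M' : K → Matrix.unitaryGroup κ ℂ}
    (hM' : IsProj x M' ω) : IsProj x (fun g => blockUnitary (M g) (M' g)) ω := by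
  intro g h
  rw [coe_blockUnitary, coe_blockUnitary, coe_blockUnitary, cj_fromBlocks,
    Matrix.fromBlocks_multiply, Matrix.fromBlocks_smul, ← hM, ← hM']
  simp

end Projective

/-! ### Equivariant isomorphism and model algebras -/

variable {G Gb : Type*} [Group G] [Group Gb] {S : SymmetryClass G Gb}

/-- Equivariant isomorphism. -/
def EqvIso (A B : EquivariantAlgebra S) : Prop :=
  ∃ φ : A.carrier ≃ₐ[ℂ] B.carrier, ∀ g a, φ (A.act g a) = B.act g (φ a)

section Models

set_option linter.unusedSectionVars false

variable {ι κ : Type} [Fintype ι] [DecidableEq ι] [Fintype κ] [DecidableEq κ]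

variable (S) in
/-- The operation `N ↦ U N^{[g]} U⁻¹`. -/
def adAct (g : Gb) (U : Matrix.unitaryGroup ι ℂ) (N : Matrix ι ι ℂ) : Matrix ι ι ℂ :=
  U * op (S.refl g) (S.x g) N * star (U : Matrix ι ι ℂ)

theorem adAct_add (g : Gb) (U : Matrix.unitaryGroup ι ℂ) (N N' : Matrix ι ι ℂ) :
    adAct S g U (N + N') = adAct S g U N + adAct S g U N' := by
  rw [adAct, op_add_arg, mul_add, add_mul, adAct, adAct]

theorem adAct_smul (g : Gb) (U : Matrix.unitaryGroup ι ℂ) (c : ℂ) (N : Matrix ι ι ℂ) :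
    adAct S g U (c • N) = S.scal g c • adAct S g U N := by
  rw [adAct, op_smul, mul_smul_comm, smul_mul_assoc, x_add_refl, scal_eq, adAct]

theorem adAct_one (g : Gb) (U : Matrix.unitaryGroup ι ℂ) : adAct S g U 1 = 1 := by
  rw [adAct, op_one, mul_one, unitary_mul_star]

theorem adAct_mul (g : Gb) (U : Matrix.unitaryGroup ι ℂ) (N N' : Matrix ι ι ℂ) :
    adAct S g U (N * N') = if S.refl g = 1 then adAct S g U N' * adAct S g U N
      else adAct S g U N * adAct S g U N' := by
  have h : ∀ X Y : Matrix ι ι ℂ, (U * X * star (U : Matrix ι ι ℂ)) *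
      (U * Y * star (U : Matrix ι ι ℂ)) = U * (X * Y) * star (U : Matrix ι ι ℂ) := by
    intro X Y
    simp only [mul_assoc]
    rw [← mul_assoc (star (U : Matrix ι ι ℂ)) (U : Matrix ι ι ℂ), unitary_star_mul, one_mul]
  simp only [adAct, op_mul, h]
  split_ifs <;> rfl

theorem adAct_rephase (g : Gb) (a : UnitAddCircle) (U : Matrix.unitaryGroup ι ℂ)
    (N : Matrix ι ι ℂ) : adAct S g (rephase a U) N = adAct S g U N := rephase_conj _ _ _

/-- The projective phase is a scalar of modulus one and cancels in a conjugation, so a projective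
action on vectors gives an honest action on matrices. -/
theorem adAct_adAct {ω : G → G → UnitAddCircle} {M : G → Matrix.unitaryGroup ι ℂ}
    (hM : IsProj (fun g => S.x (S.b g)) M ω) (g h : G) (N : Matrix ι ι ℂ) :
    adAct S (S.b (g * h)) (M (g * h)) N = adAct S (S.b g) (M g) (adAct S (S.b h) (M h) N) := by
  rw [adAct, adAct, adAct, op_conj, ← mul_assoc, ← mul_assoc, mul_assoc _ (star _) (star _),
    ← star_mul, hM, op_op, map_mul, S.refl_mul, x_mul]
  exact (rephase_conj (ω g h) (M (g * h)) _).symm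

theorem adAct_group_one {ω : G → G → UnitAddCircle} {M : G → Matrix.unitaryGroup ι ℂ}
    (hM : IsProj (fun g => S.x (S.b g)) M ω) (N : Matrix ι ι ℂ) :
    adAct S (S.b 1) (M 1) N = N := by
  have h1 : (M 1) = rephase (ω 1 1) 1 :=
    Subtype.ext (hM.apply_one (by rw [map_one, x_one]))
  rw [h1, adAct_rephase, adAct, map_one, S.refl_one, x_one, op_zero_zero]
  simp

/-- The equivariant algebra `End U` of a projective representation `U`. -/
def evenModel {ω : G → G → UnitAddCircle} (M : G → Matrix.unitaryGroup ι ℂ)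
    (hM : IsProj (fun g => S.x (S.b g)) M ω) : EquivariantAlgebra S where
  carrier := Matrix ι ι ℂ
  act g :=
    { toFun := adAct S (S.b g) (M g)
      map_add' := adAct_add _ _
      map_smul' := adAct_smul _ _ }
  act_one := adAct_group_one hM
  act_mul := adAct_adAct hM
  act_map_one _ := adAct_one _ _
  act_map_mul _ := adAct_mul _ _

/-- Exchange of the factors, applied `i` times. -/
def swapPow {R : Type*} (i : ZMod 2) (y : R × R) : R × R := if i = 1 then y.swap else y

theorem swapPow_zero {R : Type*} (y : R × R) : swapPow 0 y = y := rfl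

theorem swapPow_one {R : Type*} (y : R × R) : swapPow 1 y = y.swap := rfl

theorem swapPow_swapPow {R : Type*} (i j : ZMod 2) (y : R × R) :
    swapPow i (swapPow j y) = swapPow (i + j) y := by
  rcases zcases i with rfl | rfl <;> rcases zcases j with rfl | rfl <;>
    simp [swapPow_zero, swapPow_one, show (1 + 1 : ZMod 2) = 0 from rfl]

variable (S) in
/-- The action of a symmetry on `End U ⊗ ℂℓ(1)`, realized as `End U × End U` with
`Γ = (1, -1)`. -/
def oddAct (g : Gb) (U : Matrix.unitaryGroup ι ℂ) (i : ZMod 2) (y : Matrix ι ι ℂ × Matrix ι ι ℂ) :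
    Matrix ι ι ℂ × Matrix ι ι ℂ := swapPow i (adAct S g U y.1, adAct S g U y.2)

theorem oddAct_zero (g : Gb) (U : Matrix.unitaryGroup ι ℂ) (y : Matrix ι ι ℂ × Matrix ι ι ℂ) :
    oddAct S g U 0 y = (adAct S g U y.1, adAct S g U y.2) := rfl

theorem oddAct_one_right (g : Gb) (U : Matrix.unitaryGroup ι ℂ)
    (y : Matrix ι ι ℂ × Matrix ι ι ℂ) :
    oddAct S g U 1 y = (adAct S g U y.2, adAct S g U y.1) := rfl

theorem oddAct_add (g : Gb) (U : Matrix.unitaryGroup ι ℂ) (i : ZMod 2)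
    (y z : Matrix ι ι ℂ × Matrix ι ι ℂ) :
    oddAct S g U i (y + z) = oddAct S g U i y + oddAct S g U i z := by
  rcases zcases i with rfl | rfl <;> simp [oddAct_zero, oddAct_one_right, adAct_add]

theorem oddAct_smul (g : Gb) (U : Matrix.unitaryGroup ι ℂ) (i : ZMod 2) (c : ℂ)
    (y : Matrix ι ι ℂ × Matrix ι ι ℂ) :
    oddAct S g U i (c • y) = S.scal g c • oddAct S g U i y := by
  rcases zcases i with rfl | rfl <;> simp [oddAct_zero, oddAct_one_right, adAct_smul]

theorem oddAct_mul (g : Gb) (U : Matrix.unitaryGroup ι ℂ) (i : ZMod 2)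
    (y z : Matrix ι ι ℂ × Matrix ι ι ℂ) :
    oddAct S g U i (y * z) = if S.refl g = 1 then oddAct S g U i z * oddAct S g U i y
      else oddAct S g U i y * oddAct S g U i z := by
  rcases zcases i with rfl | rfl <;>
    simp only [oddAct_zero, oddAct_one_right, Prod.fst_mul, Prod.snd_mul, adAct_mul] <;>
    split_ifs <;> rfl

/-- The equivariant algebra `End U ⊗ ℂℓ(1)`. -/
def oddModel {ω : G → G → UnitAddCircle} (M : G → Matrix.unitaryGroup ι ℂ)
    (hM : IsProj (fun g => S.x (S.b g)) M ω) (χ : G → ZMod 2)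
    (hχ : ∀ g h, χ (g * h) = χ g + χ h) : EquivariantAlgebra S where
  carrier := Matrix ι ι ℂ × Matrix ι ι ℂ
  act g :=
    { toFun := oddAct S (S.b g) (M g) (χ g)
      map_add' := oddAct_add _ _ _
      map_smul' := oddAct_smul _ _ _ }
  act_one y := by
    have h1 : χ 1 = 0 := by simpa using hχ 1 1
    change oddAct S (S.b 1) (M 1) (χ 1) y = y
    rw [h1, oddAct_zero, adAct_group_one hM, adAct_group_one hM]
  act_mul g h y := by
    change oddAct S (S.b (g * h)) (M (g * h)) (χ (g * h)) y =
      oddAct S (S.b g) (M g) (χ g) (oddAct S (S.b h) (M h) (χ h) y)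
    rw [hχ, oddAct, adAct_adAct hM, adAct_adAct hM, ← swapPow_swapPow]
    rcases zcases (χ h) with h | h <;> rw [h] <;> rfl
  act_map_one g := by
    change oddAct S (S.b g) (M g) (χ g) 1 = 1
    rcases zcases (χ g) with h | h <;> rw [h] <;>
      simp only [oddAct_zero, oddAct_one_right, Prod.fst_one, Prod.snd_one, adAct_one] <;> rfl
  act_map_mul g := oddAct_mul _ _ _

/-- `A` is equivariantly isomorphic to `End U`. -/
def EvenBy (A : EquivariantAlgebra S) (M : G → Matrix.unitaryGroup ι ℂ) : Prop :=
  ∃ φ : A.carrier ≃ₐ[ℂ] Matrix ι ι ℂ, ∀ g a, φ (A.act g a) = adAct S (S.b g) (M g) (φ a)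

/-- `A` is equivariantly isomorphic to `End U ⊗ ℂℓ(1)`. -/
def OddBy (A : EquivariantAlgebra S) (M : G → Matrix.unitaryGroup ι ℂ) (χ : G → ZMod 2) : Prop :=
  ∃ φ : A.carrier ≃ₐ[ℂ] Matrix ι ι ℂ × Matrix ι ι ℂ,
    ∀ g a, φ (A.act g a) = oddAct S (S.b g) (M g) (χ g) (φ a)

theorem evenBy_evenModel {ω : G → G → UnitAddCircle} (M : G → Matrix.unitaryGroup ι ℂ)
    (hM : IsProj (fun g => S.x (S.b g)) M ω) : EvenBy (evenModel M hM) M :=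
  ⟨AlgEquiv.refl, fun _ _ => rfl⟩

theorem oddBy_oddModel {ω : G → G → UnitAddCircle} (M : G → Matrix.unitaryGroup ι ℂ)
    (hM : IsProj (fun g => S.x (S.b g)) M ω) (χ : G → ZMod 2)
    (hχ : ∀ g h, χ (g * h) = χ g + χ h) : OddBy (oddModel M hM χ hχ) M χ :=
  ⟨AlgEquiv.refl, fun _ _ => rfl⟩

theorem adAct_reindex (e : ι ≃ κ) (g : Gb) (U : Matrix.unitaryGroup ι ℂ) (N : Matrix ι ι ℂ) :
    adAct S g (reindexUnitary e U) (Matrix.reindexAlgEquiv ℂ ℂ e N) =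
      Matrix.reindexAlgEquiv ℂ ℂ e (adAct S g U N) := by
  rw [adAct, adAct, coe_reindexUnitary, op_reindex, star_reindex, map_mul, map_mul]

theorem EvenBy.reindex {A : EquivariantAlgebra S} {M : G → Matrix.unitaryGroup ι ℂ}
    (h : EvenBy A M) (e : ι ≃ κ) : EvenBy A (fun g => reindexUnitary e (M g)) := by
  obtain ⟨φ, hφ⟩ := h
  refine ⟨φ.trans (Matrix.reindexAlgEquiv ℂ ℂ e), fun g a => ?_⟩
  rw [AlgEquiv.trans_apply, hφ, AlgEquiv.trans_apply, adAct_reindex]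

theorem OddBy.reindex {A : EquivariantAlgebra S} {M : G → Matrix.unitaryGroup ι ℂ}
    {χ : G → ZMod 2} (h : OddBy A M χ) (e : ι ≃ κ) :
    OddBy A (fun g => reindexUnitary e (M g)) χ := by
  obtain ⟨φ, hφ⟩ := h
  refine ⟨φ.trans (AlgEquiv.prodCongr (Matrix.reindexAlgEquiv ℂ ℂ e)
    (Matrix.reindexAlgEquiv ℂ ℂ e)), fun g a => ?_⟩
  rw [AlgEquiv.trans_apply, hφ, AlgEquiv.trans_apply]
  rcases zcases (χ g) with h | h <;> rw [h] <;>
    simp only [oddAct_zero, oddAct_one_right, AlgEquiv.prodCongr_apply, Equiv.prodCongr_apply,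
      Prod.map, EquivLike.coe_coe, adAct_reindex]

theorem EvenBy.rephase {A : EquivariantAlgebra S} {M : G → Matrix.unitaryGroup ι ℂ}
    (h : EvenBy A M) (L : G → UnitAddCircle) : EvenBy A (fun g => rephase (L g) (M g)) := by
  obtain ⟨φ, hφ⟩ := h
  exact ⟨φ, fun g a => by rw [hφ, adAct_rephase]⟩

theorem OddBy.rephase {A : EquivariantAlgebra S} {M : G → Matrix.unitaryGroup ι ℂ}
    {χ : G → ZMod 2} (h : OddBy A M χ) (L : G → UnitAddCircle) :
    OddBy A (fun g => rephase (L g) (M g)) χ := by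
  obtain ⟨φ, hφ⟩ := h
  exact ⟨φ, fun g a => by rw [hφ, oddAct, oddAct, adAct_rephase, adAct_rephase]⟩

theorem EvenBy.congr {A B : EquivariantAlgebra S} (h : EqvIso A B)
    {M : G → Matrix.unitaryGroup ι ℂ} (hB : EvenBy B M) : EvenBy A M := by
  obtain ⟨φ, hφ⟩ := h
  obtain ⟨ψ, hψ⟩ := hB
  exact ⟨φ.trans ψ, fun g a => by rw [AlgEquiv.trans_apply, hφ, hψ, AlgEquiv.trans_apply]⟩

theorem OddBy.congr {A B : EquivariantAlgebra S} (h : EqvIso A B)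
    {M : G → Matrix.unitaryGroup ι ℂ} {χ : G → ZMod 2} (hB : OddBy B M χ) : OddBy A M χ := by
  obtain ⟨φ, hφ⟩ := h
  obtain ⟨ψ, hψ⟩ := hB
  exact ⟨φ.trans ψ, fun g a => by rw [AlgEquiv.trans_apply, hφ, hψ, AlgEquiv.trans_apply]⟩

end Models

/-! ### Comparison of SRE algebras with the models -/

theorem evenWith_iff {A : EquivariantAlgebra S} {ω : G → G → UnitAddCircle} :
    EvenWith A ω ↔ ∃ (n : ℕ) (_ : 0 < n) (M : G → Matrix.unitaryGroup (Fin n) ℂ)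
      (_ : IsProj (fun g => S.x (S.b g)) M ω), EvenBy A M := by
  constructor
  · rintro ⟨n, hn, M, φ, hM, hφ⟩
    refine ⟨n, hn, M, isProjective_iff.1 hM, φ, fun g a => ?_⟩
    rw [hφ, matrixOp_eq]
    rfl
  · rintro ⟨n, hn, M, hM, φ, hφ⟩
    refine ⟨n, hn, M, φ, isProjective_iff.2 hM, fun g a => ?_⟩
    rw [hφ, matrixOp_eq]
    rfl

theorem EvenBy.evenWith {A : EquivariantAlgebra S} {ω : G → G → UnitAddCircle} {ι : Type}
    [Fintype ι] [DecidableEq ι] [Nonempty ι] {M : G → Matrix.unitaryGroup ι ℂ} (h : EvenBy A M)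
    (hM : IsProj (fun g => S.x (S.b g)) M ω) : EvenWith A ω :=
  evenWith_iff.2 ⟨Fintype.card ι, Fintype.card_pos, _, hM.reindex (Fintype.equivFin ι),
    h.reindex _⟩

theorem evenWith_congr {A B : EquivariantAlgebra S} (h : EqvIso A B) {ω : G → G → UnitAddCircle}
    (hB : EvenWith B ω) : EvenWith A ω := by
  obtain ⟨n, hn, M, hM, hB⟩ := evenWith_iff.1 hB
  exact evenWith_iff.2 ⟨n, hn, M, hM, hB.congr h⟩

/-- The cocycle of an even SRE algebra may be changed by a coboundary. -/
theorem EvenWith.rephase {A : EquivariantAlgebra S} {ω ω' : G → G → UnitAddCircle}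
    (h : EvenWith A ω) (L : G → UnitAddCircle)
    (hL : ∀ g k, ω g k + dOne (fun g => S.x (S.b g)) L g k = ω' g k) : EvenWith A ω' := by
  obtain ⟨n, hn, M, hM, h⟩ := evenWith_iff.1 h
  exact evenWith_iff.2 ⟨n, hn, _, (hM.rephase L).congr hL, h.rephase L⟩

/-- `ℂℓ(1) ≃ ℂ × ℂ`. -/
def cl1Equiv : Cl1 ≃ₐ[ℂ] ℂ × ℂ where
  toFun z := (z.re + z.im, z.re - z.im)
  invFun w := ⟨(w.1 + w.2) / 2, (w.1 - w.2) / 2⟩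
  left_inv z := by ext <;> simp
  right_inv w := by ext <;> simp <;> ring
  map_mul' z w := by ext <;> simp <;> ring
  map_add' z w := by ext <;> simp <;> ring
  commutes' c := by ext <;> simp [QuadraticAlgebra.algebraMap_eq]

theorem cl1Equiv_Gam : cl1Equiv Gam = (1, -1) := by
  change ((0 : ℂ) + 1, (0 : ℂ) - 1) = _
  simp

/-- `M_n ⊗ ℂℓ(1) ≃ M_n × M_n`. -/
def tensorCl1Equiv (R : Type) [Ring R] [Algebra ℂ R] : R ⊗[ℂ] Cl1 ≃ₐ[ℂ] R × R :=
  (Algebra.TensorProduct.congr AlgEquiv.refl cl1Equiv).trans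
    ((Algebra.TensorProduct.prodRight ℂ ℂ R ℂ ℂ).trans
      (AlgEquiv.prodCongr (Algebra.TensorProduct.rid ℂ ℂ R) (Algebra.TensorProduct.rid ℂ ℂ R)))

theorem tensorCl1Equiv_tmul_Gam (R : Type) [Ring R] [Algebra ℂ R] (N : R) :
    tensorCl1Equiv R (N ⊗ₜ Gam) = (N, -N) := by
  rw [tensorCl1Equiv, AlgEquiv.trans_apply, Algebra.TensorProduct.congr_apply,
    Algebra.TensorProduct.map_tmul, AlgEquiv.trans_apply]
  change AlgEquiv.prodCongr (Algebra.TensorProduct.rid ℂ ℂ R) (Algebra.TensorProduct.rid ℂ ℂ R)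
    (Algebra.TensorProduct.prodRight ℂ ℂ R ℂ ℂ (N ⊗ₜ cl1Equiv Gam)) = _
  rw [cl1Equiv_Gam, Algebra.TensorProduct.prodRight_tmul]
  simp

/-- Splitting into eigenvectors of the exchange of factors, i.e. into the components along 1 and Γ.
-/
theorem prod_eq_add {V : Type*} [AddCommGroup V] [Module ℂ V] (y : V × V) :
    y = (((1 / 2 : ℂ) • (y.1 + y.2)), ((1 / 2 : ℂ) • (y.1 + y.2))) +
      (((1 / 2 : ℂ) • (y.1 - y.2)), -((1 / 2 : ℂ) • (y.1 - y.2))) := by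
  ext <;> simp only [Prod.mk_add_mk] <;> module

theorem adAct_neg {ι : Type} [Fintype ι] [DecidableEq ι] (g : Gb) (U : Matrix.unitaryGroup ι ℂ)
    (N : Matrix ι ι ℂ) : adAct S g U (-N) = -adAct S g U N := by
  rw [← neg_one_smul ℂ, adAct_smul, map_neg, map_one, neg_one_smul]

theorem adAct_pow {ι : Type} [Fintype ι] [DecidableEq ι] (g : Gb) (U : Matrix.unitaryGroup ι ℂ)
    (N : Matrix ι ι ℂ) (m : ℕ) : adAct S g U (N ^ m) = adAct S g U N ^ m := by
  induction m with
  | zero => rw [pow_zero, pow_zero, adAct_one]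
  | succ m ih => rw [pow_succ, adAct_mul, ih, ← pow_succ, ← pow_succ', ite_self]

theorem sgn_natCast (m : ℕ) : sgn m = (-1) ^ m := by
  induction m with
  | zero => simp
  | succ m ih => rw [pow_succ, ← ih, Nat.cast_succ, sgn_add, sgn_one]

/-- Over ℂ × ℂ the sign on Γ becomes an exchange of the two matrix factors. Additivity of `χ` need
not be assumed: it is forced because the signs on Γ come from a group action. -/
theorem oddWith_iff {A : EquivariantAlgebra S} {α : Gb → Gb → UnitAddCircle} {χ : G → ZMod 2} :
    OddWith A α χ ↔ ∃ (n : ℕ) (_ : 0 < n) (M : Gb → Matrix.unitaryGroup (Fin n) ℂ)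
      (_ : IsProj S.x M α) (_ : ∀ g h, χ (g * h) = χ g + χ h), OddBy A (fun g => M (S.b g)) χ := by
  constructor
  · rintro ⟨n, hn, M, φ, hM, hφ⟩
    have : Nonempty (Fin n) := ⟨⟨0, hn⟩⟩
    set ψ := φ.trans (tensorCl1Equiv _) with hψ
    have key1 : ∀ (g : G) (N : Matrix (Fin n) (Fin n) ℂ),
        ψ (A.act g (ψ.symm (N, -N))) = sgn (χ g) •
        (adAct S (S.b g) (M (S.b g)) N, -adAct S (S.b g) (M (S.b g)) N) := by
      intro g N
      have h1 : ψ.symm (N, -N) = φ.symm (N ⊗ₜ Gam) := by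
        rw [AlgEquiv.symm_apply_eq, hψ, AlgEquiv.trans_apply, AlgEquiv.apply_symm_apply,
          tensorCl1Equiv_tmul_Gam]
      have h2 := hφ g N 1
      rw [pow_one, pow_one, Nat.cast_one, mul_one] at h2
      rw [h1, hψ, AlgEquiv.trans_apply, h2, units_smul_eq_sgn, map_smul, tensorCl1Equiv_tmul_Gam,
        matrixOp_eq]
      rfl
    have key0 : ∀ (g : G) (N : Matrix (Fin n) (Fin n) ℂ),
        ψ (A.act g (ψ.symm (N, N))) =
        (adAct S (S.b g) (M (S.b g)) N, adAct S (S.b g) (M (S.b g)) N) := by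
      intro g N
      -- The even part is `N ⊗ 1 = (N ⊗ Γ)(1 ⊗ Γ)`, so the formula for odd elements already
      -- determines it and the two signs cancel.
      have h1 : ((N, N) : Matrix (Fin n) (Fin n) ℂ × Matrix (Fin n) (Fin n) ℂ) =
          (N, -N) * (1, -1) := by simp
      rw [h1, map_mul, A.act_map_mul, apply_ite ψ, map_mul, map_mul, key1, key1, adAct_one,
        smul_mul_smul_comm, smul_mul_smul_comm, sgn_mul_self, one_smul, one_smul]
      simp
    have hχ : ∀ g h, χ (g * h) = χ g + χ h := by
      intro g h
      have e1 := key1 (g * h) 1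
      have e2 := key1 h 1
      have e3 := key1 g 1
      rw [adAct_one] at e1 e2 e3
      rw [A.act_mul, ← ψ.symm_apply_apply (A.act h _), e2, map_smul, LinearMap.map_smulₛₗ,
        map_smul, e3, scal_eq, conjPow_sgn, smul_smul, ← sgn_add] at e1
      have e4 := congrFun (congrFun (congrArg Prod.fst e1) ⟨0, hn⟩) ⟨0, hn⟩
      simp only [Prod.smul_mk, Matrix.smul_apply, Matrix.one_apply_eq, smul_eq_mul, mul_one] at e4
      rw [← sgn_injective e4, add_comm]
    refine ⟨n, hn, M, isProjective_iff.1 hM, hχ, ψ, fun g a => ?_⟩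
    obtain ⟨y, rfl⟩ := ψ.symm.surjective a
    rw [AlgEquiv.apply_symm_apply, oddAct]
    conv_lhs => rw [prod_eq_add y]
    rw [map_add, map_add, map_add, key0, key1]
    conv_rhs => rw [prod_eq_add y]
    simp only [Prod.fst_add, Prod.snd_add, adAct_add, adAct_neg]
    rcases zcases (χ g) with h | h <;> rw [h]
    · rw [swapPow_zero, sgn_zero, one_smul]; rfl
    · rw [swapPow_one, sgn_one, neg_one_smul]
      ext <;> simp
  · rintro ⟨n, hn, M, hM, hχ, ψ, hψ⟩
    refine ⟨n, hn, M, ψ.trans (tensorCl1Equiv _).symm, isProjective_iff.2 hM, fun g N m => ?_⟩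
    rw [AlgEquiv.trans_apply, AlgEquiv.symm_apply_eq, hψ]
    have h1 : ψ ((ψ.trans (tensorCl1Equiv _).symm).symm ((N ⊗ₜ Gam) ^ m)) = (N, -N) ^ m := by
      rw [map_pow, map_pow, AlgEquiv.symm_trans_apply, AlgEquiv.apply_symm_apply,
        AlgEquiv.symm_symm, tensorCl1Equiv_tmul_Gam]
    rw [h1, oddAct, units_smul_eq_sgn, map_smul, map_pow, tensorCl1Equiv_tmul_Gam, matrixOp_eq]
    change swapPow (χ g) (adAct S (S.b g) (M (S.b g)) (N ^ m),
        adAct S (S.b g) (M (S.b g)) ((-N) ^ m)) = sgn (χ g * m) •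
      ((adAct S (S.b g) (M (S.b g)) N) ^ m, (-adAct S (S.b g) (M (S.b g)) N) ^ m)
    rw [adAct_pow, adAct_pow, adAct_neg]
    rcases zcases (χ g) with h | h <;> rw [h]
    · rw [zero_mul, sgn_zero, one_smul, swapPow_zero]
    · rw [one_mul, sgn_natCast, swapPow_one, Prod.swap_prod_mk, Prod.smul_mk, ← smul_pow,
        ← smul_pow, neg_one_smul, neg_one_smul, neg_neg]

theorem oddWith_congr {A B : EquivariantAlgebra S} (h : EqvIso A B) {α : Gb → Gb → UnitAddCircle}
    {χ : G → ZMod 2} (hB : OddWith B α χ) : OddWith A α χ := by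
  obtain ⟨n, hn, M, hM, hχ, hB⟩ := oddWith_iff.1 hB
  exact oddWith_iff.2 ⟨n, hn, M, hM, hχ, hB.congr h⟩

theorem OddBy.oddWith {A : EquivariantAlgebra S} {α : Gb → Gb → UnitAddCircle} {χ : G → ZMod 2}
    {ι : Type} [Fintype ι] [DecidableEq ι] [Nonempty ι] {M : Gb → Matrix.unitaryGroup ι ℂ}
    (h : OddBy A (fun g => M (S.b g)) χ) (hM : IsProj S.x M α)
    (hχ : ∀ g h, χ (g * h) = χ g + χ h) : OddWith A α χ :=
  oddWith_iff.2 ⟨Fintype.card ι, Fintype.card_pos, _, hM.reindex (Fintype.equivFin ι), hχ,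
    h.reindex _⟩

theorem OddWith.rephase {A : EquivariantAlgebra S} {α α' : Gb → Gb → UnitAddCircle}
    {χ : G → ZMod 2} (h : OddWith A α χ) (L : Gb → UnitAddCircle)
    (hL : ∀ g k, α g k + dOne S.x L g k = α' g k) : OddWith A α' χ := by
  obtain ⟨n, hn, M, hM, hχ, h⟩ := oddWith_iff.1 h
  exact oddWith_iff.2 ⟨n, hn, _, (hM.rephase L).congr hL, hχ, h.rephase fun g => L (S.b g)⟩

theorem hasInvariants_congr {t : S.Trivialization} {A B : EquivariantAlgebra S} (h : EqvIso A B)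
    {I : Invariants Gb} (hB : HasInvariants t B I) : HasInvariants t A I :=
  hB.imp (And.imp_right (evenWith_congr h)) (And.imp_right (oddWith_congr h))

end

section

/-! ### Projective actions and twisted cocycles -/

section Cocycles

set_option linter.unusedSectionVars false

variable {K : Type*} [Group K] {ι : Type*} [Fintype ι] [DecidableEq ι]
  {x : K → ZMod 2} {M : K → Matrix.unitaryGroup ι ℂ} {ω : K → K → UnitAddCircle}

theorem unitary_ne_zero [Nonempty ι] (U : Matrix.unitaryGroup ι ℂ) : (U : Matrix ι ι ℂ) ≠ 0 := by
  intro h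
  have := unitary_mul_star U
  rw [h, zero_mul] at this
  exact zero_ne_one this

theorem phase_smul_unitary_injective [Nonempty ι] (U : Matrix.unitaryGroup ι ℂ)
    {a b : UnitAddCircle} (h : phase a • (U : Matrix ι ι ℂ) = phase b • (U : Matrix ι ι ℂ)) :
    a = b :=
  phase_injective (smul_left_injective ℂ (unitary_ne_zero U) h)

/-- Associativity: the product of three operators is evaluated with both bracketings, and the
scalars in front of the same unitary are compared. -/
theorem IsProj.dTwo_eq_zero [Nonempty ι] (hM : IsProj x M ω)
    (hx : ∀ g h, x (g * h) = x g + x h) (g h k : K) : dTwo x ω g h k = 0 := by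
  have e1 : (M g : Matrix ι ι ℂ) * cj (x g) ((M h : Matrix ι ι ℂ) * cj (x h) (M k)) =
      phase (twist (x g) (ω h k) + ω g (h * k)) • (M (g * (h * k)) : Matrix ι ι ℂ) := by
    rw [hM, cj_smul, conjPow_phase, mul_smul_comm, hM, smul_smul, phase_add]
  have e2 : (M g : Matrix ι ι ℂ) * cj (x g) ((M h : Matrix ι ι ℂ) * cj (x h) (M k)) =
      phase (ω g h + ω (g * h) k) • (M (g * (h * k)) : Matrix ι ι ℂ) := by
    rw [map_mul, ← mul_assoc, hM, ← cj_add, smul_mul_assoc, ← hx, hM, smul_smul, phase_add,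
      mul_assoc]
  have := phase_smul_unitary_injective _ (e1.symm.trans e2)
  rw [dTwo, ← sub_eq_zero.2 this]
  abel

/-- The twisted regular representation. -/
theorem exists_isProj [Finite K] (hω : ∀ g h k, dTwo x ω g h k = 0) :
    ∃ (n : ℕ) (_ : 0 < n) (M : K → Matrix.unitaryGroup (Fin n) ℂ), IsProj x M ω := by
  classical
  have := Fintype.ofFinite K
  -- The operator of `g` sends the basis vector `j` to `g j` with phase `ω g j`.
  let R : K → Matrix K K ℂ := fun g => Matrix.of fun i j =>
    if j = g⁻¹ * i then phase (ω g j) else 0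
  have hR : ∀ g, R g ∈ Matrix.unitaryGroup K ℂ := by
    intro g
    rw [Matrix.mem_unitaryGroup_iff]
    ext i j
    have hc : ∀ k, starRingEnd ℂ (if k = g⁻¹ * j then phase (ω g k) else 0) =
        if k = g⁻¹ * j then phase (-ω g k) else 0 := by
      intro k
      split_ifs
      · exact star_phase _
      · exact map_zero _
    simp only [R, Matrix.mul_apply, Matrix.star_apply, Matrix.of_apply, Complex.star_def, hc,
      ite_mul, zero_mul, Finset.sum_ite_eq', Finset.mem_univ, if_true,
      mul_right_inj, Matrix.one_apply, mul_ite, mul_zero, ← phase_add, add_neg_cancel, phase_zero,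
      eq_comm (a := j)]
  have hproj : IsProj x (fun g => (⟨R g, hR g⟩ : Matrix.unitaryGroup K ℂ)) ω := by
    intro g h
    ext i j
    have hc : ∀ k, conjPow (x g) (if j = h⁻¹ * k then phase (ω h j) else 0) =
        if j = h⁻¹ * k then phase (twist (x g) (ω h j)) else 0 := by
      intro k
      split_ifs
      · exact conjPow_phase _ _
      · exact map_zero _
    simp only [R, cj_apply, Matrix.mul_apply, Matrix.map_apply, Matrix.of_apply, hc,
      Matrix.smul_apply, smul_eq_mul]
    rw [Finset.sum_eq_single (g⁻¹ * i) (fun k _ hk => by rw [if_neg hk, zero_mul]) (by simp),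
      if_pos rfl, mul_inv_rev, mul_assoc]
    split_ifs with hj
    -- On the support, the product law is the cocycle identity at `(g, h, j)`.
    · have h1 : g⁻¹ * i = h * j := by rw [hj]; group
      rw [h1, ← phase_add, ← phase_add]
      congr 1
      rw [← sub_eq_zero, ← hω g h j, dTwo]
      abel
    · rw [mul_zero, mul_zero]
  exact ⟨Fintype.card K, Fintype.card_pos, _, hproj.reindex (Fintype.equivFin K)⟩

end Cocycles

variable {G Gb : Type*} [Group G] [Group Gb] {S : SymmetryClass G Gb}

/-! ### The trivialization -/

theorem b_p_mul (S : SymmetryClass G Gb) (g : G) : S.b (S.p * g) = S.b g := by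
  rw [map_mul, S.b_p, one_mul]

theorem eq_or_eq_p_mul (S : SymmetryClass G Gb) {g h : G} (hgh : S.b g = S.b h) :
    h = g ∨ h = S.p * g := by
  have h1 : S.b (h * g⁻¹) = 1 := by rw [map_mul, map_inv, hgh, mul_inv_cancel]
  rcases (S.b_eq_one_iff _).1 h1 with h2 | h2
  · exact Or.inl (mul_inv_eq_one.1 h2)
  · exact Or.inr (mul_inv_eq_iff_eq_mul.1 h2)

/-- A function on `G` that is invariant under `p` descends to `Gb`. -/
theorem exists_descent (S : SymmetryClass G Gb) {X : Type*} (f : G → X)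
    (hf : ∀ g, f (S.p * g) = f g) : ∃ f' : Gb → X, ∀ g, f' (S.b g) = f g := by
  refine ⟨fun k => f (Function.surjInv S.b_surjective k), fun g => ?_⟩
  rcases eq_or_eq_p_mul S (Function.surjInv_eq S.b_surjective (S.b g)).symm with h | h
  · exact congrArg f h
  · exact (congrArg f h).trans (hf g)

theorem SymmetryClass.Trivialization.t_p (t : S.Trivialization) : t.t S.p = 1 := by
  have := t.t_p_mul 1
  rwa [mul_one, t.t_one, zero_add] at this

theorem x_b_mul (S : SymmetryClass G Gb) (g h : G) :
    S.x (S.b (g * h)) = S.x (S.b g) + S.x (S.b h) := by rw [map_mul, x_mul]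

theorem x_b_p (S : SymmetryClass G Gb) : S.x (S.b S.p) = 0 := by rw [S.b_p, x_one]

theorem p_mul_p_mul (S : SymmetryClass G Gb) (g : G) : S.p * (S.p * g) = g := by
  rw [← mul_assoc, S.p_mul_p, one_mul]

theorem OddWith.chi_mul {A : EquivariantAlgebra S} {α : Gb → Gb → UnitAddCircle} {χ : G → ZMod 2}
    (h : OddWith A α χ) (g k : G) : χ (g * k) = χ g + χ k := by
  obtain ⟨_, _, _, _, hχ, _⟩ := oddWith_iff.1 h
  exact hχ g k

theorem OddWith.splits {A : EquivariantAlgebra S} {α : Gb → Gb → UnitAddCircle} {χ : G → ZMod 2}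
    (h : OddWith A α χ) (hp : χ S.p = 1) : S.Splits := ⟨χ, h.chi_mul, hp⟩

/-- Additivity of `χ` at the unit gives `β 1 = 0`, without knowing yet that `β` is a homomorphism.
-/
theorem chi_p {A : EquivariantAlgebra S} {α : Gb → Gb → UnitAddCircle} {β : Gb → ZMod 2}
    {t : S.Trivialization} (h : OddWith A α fun g => β (S.b g) + t.t g) :
    β (S.b S.p) + t.t S.p = 1 := by
  have h1 := h.chi_mul 1 1
  simp only [mul_one, map_one, t.t_one, add_zero, left_eq_add] at h1
  rw [S.b_p, h1, t.t_p, zero_add]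

theorem HasInvariants.isSRE {t : S.Trivialization} {A : EquivariantAlgebra S}
    {I : Invariants Gb} (h : HasInvariants t A I) : IsSRE A := by
  rcases h with ⟨_, h⟩ | ⟨_, h⟩
  · exact Or.inl ⟨_, h⟩
  · exact Or.inr ⟨_, _, chi_p h, h⟩

theorem exists_double (c : UnitAddCircle) : ∃ a, a + a = c := by
  obtain ⟨r, rfl⟩ := QuotientAddGroup.mk_surjective c
  exact ⟨((r / 2 : ℝ) : UnitAddCircle), by rw [← AddCircle.coe_add, add_halves]⟩

theorem exists_half {e : UnitAddCircle} (h : e + e = 0) : ∃ i, e = half i := by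
  have h1 : phase e * phase e = 1 := by rw [← phase_add, h, phase_zero]
  rcases mul_self_eq_one_iff.1 h1 with h1 | h1
  · exact ⟨0, phase_injective (by rw [h1, phase_half, sgn_zero])⟩
  · exact ⟨1, phase_injective (by rw [h1, phase_half, sgn_one])⟩

/-- A projective action of `G` can be rephased so that fermion parity squares to one and multiplies
without phases from the left. -/
theorem exists_normalized {ι : Type*} [Fintype ι] [DecidableEq ι] (t : S.Trivialization)
    {ω : G → G → UnitAddCircle} {M : G → Matrix.unitaryGroup ι ℂ}
    (hM : IsProj (fun g => S.x (S.b g)) M ω) :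
    ∃ (L : G → UnitAddCircle) (d : UnitAddCircle) (P : Matrix ι ι ℂ), P * P = 1 ∧
      P = phase d • (rephase (L S.p) (M S.p) : Matrix ι ι ℂ) ∧
      ∀ g, (rephase (L (S.p * g)) (M (S.p * g)) : Matrix ι ι ℂ) =
        P * (rephase (L g) (M g) : Matrix ι ι ℂ) := by
  have hx1 : S.x (S.b 1) = 0 := by rw [map_one, x_one]
  have hpp : ∀ g, (M S.p : Matrix ι ι ℂ) * M g = phase (ω S.p g) • (M (S.p * g) : Matrix ι ι ℂ) := by
    intro g
    rw [← hM]
    dsimp only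
    rw [x_b_p, cj_zero]
  -- The square of the parity operator is a scalar phase; a square root of its inverse makes `P` an
  -- involution.
  obtain ⟨a, ha⟩ := exists_double (-(ω S.p S.p + ω 1 1))
  set P : Matrix ι ι ℂ := phase a • (M S.p : Matrix ι ι ℂ) with hP
  have hPP : P * P = 1 := by
    rw [hP, smul_mul_smul_comm, ← phase_add, ha, hpp, S.p_mul_p, hM.apply_one hx1, smul_smul,
      smul_smul, ← phase_add, ← phase_add, add_assoc, neg_add_cancel, phase_zero, one_smul]
  -- In each pair `{g, pg}` the element with `t = 0` keeps its operator, and the other one is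
  -- redefined as `P` times it.
  let L : G → UnitAddCircle := fun g => if t.t g = 1 then a + ω S.p (S.p * g) else 0
  have hL1 : ∀ g, t.t g = 1 → (rephase (L g) (M g) : Matrix ι ι ℂ) = P * M (S.p * g) := by
    intro g hg
    rw [coe_rephase, hP, smul_mul_assoc, hpp, p_mul_p_mul, smul_smul, ← phase_add]
    simp only [L, hg, if_true]
  have hL0 : ∀ g, t.t g = 0 → (rephase (L g) (M g) : Matrix ι ι ℂ) = M g := by
    intro g hg
    rw [coe_rephase]
    simp only [L, hg, zero_ne_one, if_false, phase_zero, one_smul]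
  refine ⟨L, -ω 1 1, P, hPP, ?_, fun g => ?_⟩
  · rw [hL1 _ t.t_p, S.p_mul_p, hM.apply_one hx1, mul_smul_comm, smul_smul, ← phase_add,
      neg_add_cancel, phase_zero, one_smul, mul_one]
  · have htg := t.t_p_mul g
    rcases zcases (t.t g) with h | h
    · rw [hL0 g h, hL1 _ (by rw [htg, h, zero_add]), p_mul_p_mul]
    · rw [hL1 g h, hL0 _ (by rw [htg, h]; rfl), ← mul_assoc, hPP, one_mul]

/-- After normalization, `β` is the sign in the commutation of `M g` with the parity operator. The
dependence of the cocycle on fermion parity in the second argument is then exactly ½ β t, and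
removing it leaves a cochain on the bosonic group. -/
theorem exists_invariants_of_evenWith (t : S.Trivialization) {A : EquivariantAlgebra S}
    {ω : G → G → UnitAddCircle} (h : EvenWith A ω) : ∃ I : Invariants Gb, HasInvariants t A I := by
  obtain ⟨n, hn, M₀, hM₀, hA₀⟩ := evenWith_iff.1 h
  have : Nonempty (Fin n) := ⟨⟨0, hn⟩⟩
  obtain ⟨L, d, P, hPP, hP, hpM⟩ := exists_normalized t hM₀
  have hA := hA₀.rephase L
  have hM := hM₀.rephase L
  set M := fun g => rephase (L g) (M₀ g) with hMdef
  set ω' := fun g h => ω g h + dOne (fun g => S.x (S.b g)) L g h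
  change P = phase d • (M S.p : Matrix (Fin n) (Fin n) ℂ) at hP
  change ∀ g, (M (S.p * g) : Matrix (Fin n) (Fin n) ℂ) = P * M g at hpM
  have hM' : ∀ g h, (M g : Matrix (Fin n) (Fin n) ℂ) * cj (S.x (S.b g)) (M h) =
    phase (ω' g h) • (M (g * h) : Matrix (Fin n) (Fin n) ℂ) := hM
  have hcomm : ∀ g, ∃ e, (M g : Matrix (Fin n) (Fin n) ℂ) * cj (S.x (S.b g)) P =
      phase e • (P * (M g : Matrix (Fin n) (Fin n) ℂ)) := by
    intro g
    refine ⟨twist (S.x (S.b g)) d + ω' g S.p, ?_⟩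
    rw [hP, cj_smul, mul_smul_comm, hM g S.p, conjPow_phase, smul_smul, ← phase_add, ← hP,
      ← S.p_central, hpM]
  choose e he using hcomm
  -- Commuting past `P` twice is commuting past `P² = 1`, so the commutation phase is a sign.
  have hee : ∀ g, e g + e g = 0 := by
    intro g
    have h1 : (M g : Matrix (Fin n) (Fin n) ℂ) * cj (S.x (S.b g)) P * cj (S.x (S.b g)) P =
        phase 0 • (M g : Matrix (Fin n) (Fin n) ℂ) := by
      rw [mul_assoc, ← map_mul, hPP, map_one, mul_one, phase_zero, one_smul]
    rw [he, smul_mul_assoc, mul_assoc, he, mul_smul_comm, ← mul_assoc, hPP, one_mul, smul_smul,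
      ← phase_add] at h1
    exact phase_smul_unitary_injective _ h1
  choose β₀ hβ₀ using fun g => exists_half (hee g)
  have hβp : ∀ g, β₀ (S.p * g) = β₀ g := by
    intro g
    refine half_injective ?_
    rw [← hβ₀, ← hβ₀]
    have h1 := he (S.p * g)
    rw [b_p_mul, hpM, mul_assoc, he, mul_smul_comm, ← hpM] at h1
    have h2 := congrArg (fun N => P * N) h1
    simp only [mul_smul_comm] at h2
    rw [← mul_assoc, hPP, one_mul] at h2
    exact (phase_smul_unitary_injective _ h2).symm
  obtain ⟨β, hβ⟩ := exists_descent S β₀ hβp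
  have hω1 : ∀ g h, ω' (S.p * g) h = ω' g h := by
    intro g h
    have h1 := hM' (S.p * g) h
    rw [b_p_mul, hpM, mul_assoc, hM', mul_smul_comm, ← hpM, mul_assoc S.p] at h1
    exact (phase_smul_unitary_injective _ h1).symm
  -- Bringing `P` from the second factor to the front costs the commutation sign of `g`.
  have hω2 : ∀ g h, ω' g (S.p * h) = ω' g h + half (β₀ g) := by
    intro g h
    have h1 := hM' g (S.p * h)
    rw [hpM, map_mul, ← mul_assoc, he, smul_mul_assoc, mul_assoc, hM', mul_smul_comm, ← hpM, smul_smul,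
      ← phase_add, hβ₀, ← mul_assoc g, ← S.p_central, mul_assoc S.p] at h1
    rw [← phase_smul_unitary_injective _ h1, add_comm]
  -- The correction ½ β t jumps by ½ β(g) under `h ↦ ph`, as the cocycle does, so the difference is
  -- `p`-invariant in both arguments and descends one argument at a time.
  obtain ⟨α₁, hα₁⟩ := exists_descent S (fun g h => ω' g h - half (β₀ g * t.t h)) (by
    intro g; funext h; rw [hω1, hβp])
  obtain ⟨α₂, hα₂⟩ := exists_descent S (fun h k => α₁ k h) (by
    intro h; funext k
    obtain ⟨g, rfl⟩ := S.b_surjective k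
    rw [hα₁]
    simp only []
    rw [hω2, t.t_p_mul, mul_add, mul_one, half_add]
    abel)
  refine ⟨⟨fun g h => α₂ h g, β, 0⟩, Or.inl ⟨rfl, hA.evenWith (hM.congr fun g h => ?_)⟩⟩
  rw [Invariants.omega]
  simp only []
  rw [hα₂, hβ]
  simp only []
  rw [hα₁]
  simp only [sub_add_cancel]

/-- Both `χ` and `t` change by 1 under multiplication by `p`, so their difference descends and
serves as `β`. -/
theorem exists_invariants_of_oddWith (t : S.Trivialization) {A : EquivariantAlgebra S}
    {α : Gb → Gb → UnitAddCircle} {χ : G → ZMod 2} (h : OddWith A α χ) (hp : χ S.p = 1) :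
    ∃ I : Invariants Gb, HasInvariants t A I := by
  obtain ⟨β, hβ⟩ := exists_descent S (fun g => χ g + t.t g) (by
    intro g
    rw [h.chi_mul, t.t_p_mul, hp, add_comm 1, add_add_add_comm]
    simp [show (1 + 1 : ZMod 2) = 0 from rfl, add_comm])
  refine ⟨⟨α, β, 1⟩, Or.inr ⟨rfl, ?_⟩⟩
  have : (fun g => β (S.b g) + t.t g) = χ := by
    funext g
    rw [hβ, add_assoc, CharTwo.add_self_eq_zero, add_zero]
  rwa [this]

theorem isSRE_iff (t : S.Trivialization) (A : EquivariantAlgebra S) :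
    IsSRE A ↔ ∃ I, HasInvariants t A I := by
  constructor
  · rintro (⟨ω, h⟩ | ⟨α, χ, hp, h⟩)
    · exact exists_invariants_of_evenWith t h
    · exact exists_invariants_of_oddWith t h hp
  · rintro ⟨I, h⟩
    exact h.isSRE

/-! ### Admissible invariants -/

/-- Half-integers are their own negatives, so the twist and all signs disappear from the ½ β t
terms. -/
theorem dTwo_omega (t : S.Trivialization) (I : Invariants Gb) (g h k : G) :
    dTwo (fun g => S.x (S.b g)) (I.omega t) g h k =
      dTwo S.x I.α (S.b g) (S.b h) (S.b k) + half (I.β (S.b h) * t.t k +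
        I.β (S.b (g * h)) * t.t k + I.β (S.b g) * t.t (h * k) + I.β (S.b g) * t.t h) := by
  simp only [dTwo, Invariants.omega, twist_add, twist_half, half_add, map_mul, sub_eq_add_neg,
    neg_add, neg_half]
  abel

/-- For γ = 0 admissibility says that α + ½ β t is a twisted cocycle on `G`. For γ = 1 the
trivialization is a homomorphism, so ρ = 0 and α itself is a twisted cocycle on `Gb`. The twisted
regular representation realizes either one. -/
theorem Invariants.Admissible.exists_hasInvariants [Finite G] {t : S.Trivialization}
    {I : Invariants Gb} (h : I.Admissible t) :
    ∃ A : EquivariantAlgebra S, HasInvariants t A I := by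
  rcases zcases I.γ with hγ | hγ
  · obtain ⟨n, hn, M, hM⟩ := exists_isProj (x := fun g => S.x (S.b g)) (ω := I.omega t) (by
      intro g k l
      rw [dTwo_omega, h.dα, map_mul, h.dβ, ← half_add, ← half_zero]
      congr 1
      have := CharTwo.two_eq_zero (R := ZMod 2)
      linear_combination (I.β (S.b k) * t.t l + I.β (S.b g) * t.t l + I.β (S.b g) * t.t k) * this)
    have : Nonempty (Fin n) := ⟨⟨0, hn⟩⟩
    exact ⟨_, Or.inl ⟨hγ, (evenBy_evenModel M hM).evenWith hM⟩⟩
  · have ht := t.map_mul_of_splits (h.dγ hγ)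
    have := Finite.of_surjective _ S.b_surjective
    obtain ⟨n, hn, M, hM⟩ := exists_isProj (x := S.x) (ω := I.α) (by
      intro g k l
      obtain ⟨g, rfl⟩ := S.b_surjective g
      obtain ⟨k, rfl⟩ := S.b_surjective k
      obtain ⟨l, rfl⟩ := S.b_surjective l
      rw [h.dα, ht, sub_self, mul_zero, half_zero])
    have : Nonempty (Fin n) := ⟨⟨0, hn⟩⟩
    have hχ : ∀ g k, I.β (S.b (g * k)) + t.t (g * k) =
        (I.β (S.b g) + t.t g) + (I.β (S.b k) + t.t k) := by
      intro g k
      rw [map_mul, h.dβ, ht, add_add_add_comm]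
    exact ⟨_, Or.inr ⟨hγ, (oddBy_oddModel _ (hM.comp S.b) _ hχ).oddWith hM hχ⟩⟩

/-- The cocycle identity for α + ½ β t contains both conditions: its dependence on fermion parity of
the last argument gives additivity of `β`, and the rest is the equation for α. In the odd case `β`
is a difference of two homomorphisms. -/
theorem HasInvariants.admissible {t : S.Trivialization} {A : EquivariantAlgebra S}
    {I : Invariants Gb} (h : HasInvariants t A I) : I.Admissible t := by
  rcases h with ⟨hγ, h⟩ | ⟨hγ, h⟩
  · obtain ⟨n, hn, M, hM, -⟩ := evenWith_iff.1 h
    have : Nonempty (Fin n) := ⟨⟨0, hn⟩⟩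
    have hd : ∀ g h k, _ := fun g h k => (dTwo_omega t I g h k).symm.trans
      (hM.dTwo_eq_zero (x_b_mul S) g h k)
    have hβ : ∀ g h : G, I.β (S.b (g * h)) = I.β (S.b g) + I.β (S.b h) := by
      intro g h
      -- Replacing the last argument 1 by `p` changes only the values of `t`, by 1, which isolates
      -- β(h) + β(gh) + β(g).
      have h1 := (hd g h (S.p * 1)).trans (hd g h 1).symm
      rw [b_p_mul, add_right_inj, ← mul_assoc, ← S.p_central, mul_assoc, t.t_p_mul, t.t_p_mul,
        mul_one] at h1
      have h2 := half_injective h1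
      have := CharTwo.two_eq_zero (R := ZMod 2)
      linear_combination h2 - (I.β (S.b g) + I.β (S.b h)) * this
    refine ⟨fun g h => ?_, fun g h k => ?_, fun h => ?_⟩
    · obtain ⟨g, rfl⟩ := S.b_surjective g
      obtain ⟨h, rfl⟩ := S.b_surjective h
      rw [← map_mul, hβ]
    · have h1 := hd g h k
      rw [hβ] at h1
      rw [← sub_eq_zero, ← h1, sub_eq_add_neg, neg_half]
      congr 2
      have := CharTwo.two_eq_zero (R := ZMod 2)
      linear_combination (-I.β (S.b h) * t.t k - I.β (S.b g) * t.t (h * k)) * this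
    · rw [hγ] at h
      exact absurd h (by decide)
  · have hs := h.splits (chi_p h)
    have ht := t.map_mul_of_splits hs
    have hχ := h.chi_mul
    obtain ⟨n, hn, M, hM, -⟩ := oddWith_iff.1 h
    have : Nonempty (Fin n) := ⟨⟨0, hn⟩⟩
    refine ⟨fun g h => ?_, fun g h k => ?_, fun _ => hs⟩
    · obtain ⟨g, rfl⟩ := S.b_surjective g
      obtain ⟨h, rfl⟩ := S.b_surjective h
      have := hχ g h
      rw [ht, map_mul] at this
      linear_combination this
    · rw [hM.dTwo_eq_zero (x_mul S), ht, sub_self, mul_zero, half_zero]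

theorem admissible_iff [Finite G] (t : S.Trivialization) (I : Invariants Gb) :
    I.Admissible t ↔ ∃ A : EquivariantAlgebra S, HasInvariants t A I :=
  ⟨fun h => h.exists_hasInvariants, fun ⟨_, h⟩ => h.admissible⟩

theorem not_isOdd_of_not_splits (hs : ¬ S.Splits) (A : EquivariantAlgebra S) : ¬ IsOdd A :=
  fun ⟨_, _, hp, h⟩ => hs (h.splits hp)

theorem HasInvariants.gamma_eq_zero {t : S.Trivialization} (hs : ¬ S.Splits)
    {A : EquivariantAlgebra S} {I : Invariants Gb} (h : HasInvariants t A I) : I.γ = 0 := by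
  rcases h with ⟨hγ, _⟩ | ⟨_, h⟩
  · exact hγ
  · exact absurd (h.splits (chi_p h)) hs

end

section

variable {G Gb : Type*} [Group G] [Group Gb] {S : SymmetryClass G Gb}

/-! ### Recognition of stacked algebras -/

/-- A finite-dimensional algebra generated by supercommuting equivariant images of `A` and `B`, of
the right dimension, is the stack of `A` and `B`. -/
theorem exists_stack_equiv (A B : EquivariantAlgebra S) {R : Type} [Ring R] [Algebra ℂ R]
    [Module.Finite ℂ R] (T : G → R → R) (f₁ : A.carrier →ₐ[ℂ] R) (f₂ : B.carrier →ₐ[ℂ] R)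
    (hTadd : ∀ g y z, T g (y + z) = T g y + T g z)
    (hTmul : ∀ g y z, T g (y * z) = if S.refl (S.b g) = 1 then T g z * T g y else T g y * T g z)
    (hcomm : ∀ i j a b, a ∈ A.deg i → b ∈ B.deg j → f₁ a * f₂ b = sgn (i * j) • (f₂ b * f₁ a))
    (h₁ : ∀ g a, f₁ (A.act g a) = T g (f₁ a)) (h₂ : ∀ g b, f₂ (B.act g b) = T g (f₂ b))
    (hgen : ∀ U : Subalgebra ℂ R, (∀ a, f₁ a ∈ U) → (∀ b, f₂ b ∈ U) → U = ⊤)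
    (hdim : Module.finrank ℂ A.carrier * Module.finrank ℂ B.carrier = Module.finrank ℂ R) :
    ∃ φ : (A.stack B).carrier ≃ₐ[ℂ] R, ∀ g z, φ ((A.stack B).act g z) = T g (φ z) := by
  let Φ : (A.deg ᵍ⊗[ℂ] B.deg) →ₐ[ℂ] R := GradedTensorProduct.lift A.deg B.deg f₁ f₂ (by
    intro i j a b
    rw [hcomm i j a b a.2 b.2, units_smul_eq_sgn, mul_comm])
  have hΦ : ∀ a b, Φ (a ᵍ⊗ₜ[ℂ] b) = f₁ a * f₂ b := fun a b => rfl
  have hsurj : Function.Surjective Φ := by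
    rw [← AlgHom.range_eq_top]
    refine hgen _ (fun a => ⟨a ᵍ⊗ₜ[ℂ] 1, ?_⟩) (fun b => ⟨1 ᵍ⊗ₜ[ℂ] b, ?_⟩)
    · exact (hΦ a 1).trans (by rw [map_one, mul_one])
    · exact (hΦ 1 b).trans (by rw [map_one, one_mul])
  have : Module.Finite ℂ (A.deg ᵍ⊗[ℂ] B.deg) := (A.stack B).finite
  have hd : Module.finrank ℂ (A.deg ᵍ⊗[ℂ] B.deg) = Module.finrank ℂ R := by
    rw [← hdim, ← Module.finrank_tensorProduct]
    exact (LinearEquiv.finrank_eq (GradedTensorProduct.of ℂ A.deg B.deg)).symm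
  -- The dimensions agree, so generation of the target already makes the map bijective.
  have hinj : Function.Injective Φ :=
    (LinearMap.injective_iff_surjective_of_finrank_eq_finrank (f := Φ.toLinearMap) hd).2 hsurj
  refine ⟨AlgEquiv.ofBijective Φ ⟨hinj, hsurj⟩, fun g z => ?_⟩
  change Φ (EquivariantAlgebra.tensorAct A B g z) = T g (Φ z)
  have hl : ∀ i a, a ∈ A.deg i → Φ (EquivariantAlgebra.tensorAct A B g (a ᵍ⊗ₜ[ℂ] 1)) =
      T g (f₁ a) := by
    intro i a ha
    rw [EquivariantAlgebra.tensorAct_tmul A B g ha (B.mem_deg_zero.2 B.parity_one), mul_zero,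
      mul_zero, uzpow_zero, one_smul, B.act_map_one, hΦ, map_one, mul_one, h₁]
  have hr : ∀ j b, b ∈ B.deg j → Φ (EquivariantAlgebra.tensorAct A B g (1 ᵍ⊗ₜ[ℂ] b)) =
      T g (f₂ b) := by
    intro j b hb
    rw [EquivariantAlgebra.tensorAct_tmul A B g (A.mem_deg_zero.2 A.parity_one) hb, zero_mul,
      mul_zero, uzpow_zero, one_smul, A.act_map_one, hΦ, map_one, one_mul, h₂]
  induction z using EquivariantAlgebra.tensor_induction with
  | hadd z w hz hw => rw [map_add, map_add, map_add, hz, hw, hTadd]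
  | h i j a b ha hb =>
    -- Both actions have the same behaviour on products, so equivariance reduces to the two tensor
    -- factors. For reversing symmetries the Koszul sign of the stacked action is absorbed in the
    -- reversed product.
    have e : (a ᵍ⊗ₜ[ℂ] b : A.deg ᵍ⊗[ℂ] B.deg) = (a ᵍ⊗ₜ[ℂ] 1 * 1 ᵍ⊗ₜ[ℂ] b : A.deg ᵍ⊗[ℂ] B.deg) :=
      (GradedTensorProduct.tmul_one_mul_one_tmul A.deg B.deg a b).symm
    have hm : EquivariantAlgebra.tensorAct A B g
        ((a ᵍ⊗ₜ[ℂ] 1 : A.deg ᵍ⊗[ℂ] B.deg) * (1 ᵍ⊗ₜ[ℂ] b : A.deg ᵍ⊗[ℂ] B.deg)) =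
      if S.refl (S.b g) = 1 then EquivariantAlgebra.tensorAct A B g (1 ᵍ⊗ₜ[ℂ] b) *
        EquivariantAlgebra.tensorAct A B g (a ᵍ⊗ₜ[ℂ] 1) else
      EquivariantAlgebra.tensorAct A B g (a ᵍ⊗ₜ[ℂ] 1) *
        EquivariantAlgebra.tensorAct A B g (1 ᵍ⊗ₜ[ℂ] b) :=
      (A.stack B).act_map_mul g _ _
    rw [hΦ, hTmul, e, hm, apply_ite Φ, map_mul, map_mul, hl i a ha, hr j b hb]

/-! ### Involutions and their spectral projections -/

section Involutions

variable {R R' : Type*} [Ring R] [Algebra ℂ R] [Ring R'] [Algebra ℂ R']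

/-- The spectral projection of an involution `z` at the eigenvalue `(-1)^i`. -/
def spec (z : R) (i : ZMod 2) : R := (1 / 2 : ℂ) • (1 + sgn i • z)

theorem spec_add_spec (z : R) : spec z 0 + spec z 1 = 1 := by
  simp only [spec, sgn_zero, sgn_one]
  module

theorem spec_sub_spec (z : R) : spec z 0 - spec z 1 = z := by
  simp only [spec, sgn_zero, sgn_one]
  module

theorem spec_neg (z : R) (i : ZMod 2) : spec (-z) i = spec z (i + 1) := by
  rw [spec, spec, sgn_add, sgn_one, smul_neg, mul_neg_one, neg_smul]

theorem spec_mul_spec {z : R} (hz : z * z = 1) (i j : ZMod 2) :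
    spec z i * spec z j = if i = j then spec z i else 0 := by
  have key : spec z i * spec z j = (1 / 2 : ℂ) • ((1 / 2 : ℂ) •
      ((1 + sgn i * sgn j) • (1 : R) + (sgn i + sgn j) • z)) := by
    simp only [spec, smul_mul_assoc, mul_smul_comm, add_mul, mul_add, one_mul,
      mul_one, hz]
    module
  rw [key]
  rcases zcases i with rfl | rfl <;> rcases zcases j with rfl | rfl <;>
    simp [spec] <;> module

/-- The homomorphism `R × R → R'` that equals `k` on the diagonal and sends `(1, -1)` to `z`. -/
def pairHom (k : R →ₐ[ℂ] R') (z : R') (hz : z * z = 1) (hk : ∀ a, z * k a = k a * z) :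
    R × R →ₐ[ℂ] R' :=
  have hs : ∀ i a, spec z i * k a = k a * spec z i := fun i a => by
    simp only [spec, smul_mul_assoc, mul_smul_comm, add_mul, mul_add, one_mul, mul_one, hk]
  AlgHom.ofLinearMap
    (LinearMap.coprod ((LinearMap.mulRight ℂ (spec z 0)).comp k.toLinearMap)
      ((LinearMap.mulRight ℂ (spec z 1)).comp k.toLinearMap))
    (by simp [spec_add_spec])
    (fun y y' => by
      simp only [LinearMap.coprod_apply, LinearMap.comp_apply, LinearMap.mulRight_apply,
        AlgHom.toLinearMap_apply, Prod.fst_mul, Prod.snd_mul, map_mul, mul_add, add_mul]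
      have h : ∀ i j (a a' : R), k a * spec z i * (k a' * spec z j) =
          if i = j then k a * k a' * spec z i else 0 := by
        intro i j a a'
        rw [mul_assoc, ← mul_assoc (spec z i), hs, mul_assoc (k a'), spec_mul_spec hz]
        split_ifs <;> simp [mul_assoc]
      rw [h, h, h, h]
      simp)

theorem pairHom_apply (k : R →ₐ[ℂ] R') (z : R') (hz : z * z = 1) (hk : ∀ a, z * k a = k a * z)
    (y : R × R) : pairHom k z hz hk y = k y.1 * spec z 0 + k y.2 * spec z 1 := rfl

/-- `z ^ i` for `i : ℤ/2`. -/
def powTwo {R : Type*} [One R] (z : R) (i : ZMod 2) : R := if i = 1 then z else 1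

theorem powTwo_zero {R : Type*} [One R] (z : R) : powTwo z 0 = 1 := rfl

theorem powTwo_one {R : Type*} [One R] (z : R) : powTwo z 1 = z := rfl

theorem pairHom_homogeneous (k : R →ₐ[ℂ] R') (z : R') (hz : z * z = 1)
    (hk : ∀ a, z * k a = k a * z) (i : ZMod 2) (a : R) :
    pairHom k z hz hk (a, sgn i • a) = k a * powTwo z i := by
  rw [pairHom_apply]
  rcases zcases i with rfl | rfl
  · simp [← mul_add, spec_add_spec, powTwo_zero]
  · rw [sgn_one, neg_one_smul, map_neg, neg_mul, ← sub_eq_add_neg, ← mul_sub, spec_sub_spec,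
      powTwo_one]

theorem pairHom_diag (k : R →ₐ[ℂ] R') (z : R') (hz : z * z = 1)
    (hk : ∀ a, z * k a = k a * z) (a : R) : pairHom k z hz hk (a, a) = k a := by
  have := pairHom_homogeneous k z hz hk 0 a
  rwa [sgn_zero, one_smul, powTwo_zero, mul_one] at this

theorem pairHom_one_neg_one (k : R →ₐ[ℂ] R') (z : R') (hz : z * z = 1)
    (hk : ∀ a, z * k a = k a * z) : pairHom k z hz hk (1, -1) = z := by
  have := pairHom_homogeneous k z hz hk 1 1
  rwa [sgn_one, neg_one_smul, powTwo_one, map_one, one_mul] at this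

/-- Changing the sign of the involution exchanges its two spectral projections. -/
theorem pairHom_neg (k : R →ₐ[ℂ] R') (z : R') (hz : z * z = 1)
    (hk : ∀ a, z * k a = k a * z) (hz' : -z * -z = 1) (hk' : ∀ a, -z * k a = k a * -z) (y : R × R) :
    pairHom k (-z) hz' hk' y = pairHom k z hz hk y.swap := by
  rw [pairHom_apply, pairHom_apply, spec_neg, spec_neg, add_comm]
  rfl

/-- The graded embedding `a ↦ (a, z a z)`. -/
def gradedHom (z : R) (hz : z * z = 1) : R →ₐ[ℂ] R × R :=
  AlgHom.prod (AlgHom.id ℂ R) (AlgHom.ofLinearMap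
    ((LinearMap.mulLeft ℂ z).comp (LinearMap.mulRight ℂ z)) (by simp [hz]) (fun a b => by
      simp only [LinearMap.comp_apply, LinearMap.mulLeft_apply, LinearMap.mulRight_apply]
      calc z * (a * b * z) = z * (a * (z * z) * b * z) := by rw [hz, mul_one]
        _ = z * (a * z) * (z * (b * z)) := by simp only [mul_assoc]))

theorem gradedHom_apply (z : R) (hz : z * z = 1) (a : R) :
    gradedHom z hz a = (a, z * (a * z)) := rfl

end Involutions

/-! ### Generators of matrix algebras -/

section Kron

variable (ι κ : Type) [Fintype ι] [DecidableEq ι] [Fintype κ] [DecidableEq κ]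

/-- `a ↦ a ⊗ 1`. -/
def kronLeft : Matrix ι ι ℂ →ₐ[ℂ] Matrix (ι × κ) (ι × κ) ℂ :=
  AlgHom.ofLinearMap
    { toFun := fun a => a ⊗ₖ (1 : Matrix κ κ ℂ)
      map_add' := fun a b => Matrix.add_kronecker a b 1
      map_smul' := fun c a => Matrix.smul_kronecker c a 1 }
    Matrix.one_kronecker_one (fun a b => by
      change (a * b) ⊗ₖ (1 : Matrix κ κ ℂ) = a ⊗ₖ (1 : Matrix κ κ ℂ) * b ⊗ₖ (1 : Matrix κ κ ℂ)
      rw [← Matrix.mul_kronecker_mul, one_mul])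

/-- `b ↦ 1 ⊗ b`. -/
def kronRight : Matrix κ κ ℂ →ₐ[ℂ] Matrix (ι × κ) (ι × κ) ℂ :=
  AlgHom.ofLinearMap
    { toFun := fun b => (1 : Matrix ι ι ℂ) ⊗ₖ b
      map_add' := fun a b => Matrix.kronecker_add 1 a b
      map_smul' := fun c a => Matrix.kronecker_smul c 1 a }
    Matrix.one_kronecker_one (fun a b => by
      change (1 : Matrix ι ι ℂ) ⊗ₖ (a * b) = (1 : Matrix ι ι ℂ) ⊗ₖ a * (1 : Matrix ι ι ℂ) ⊗ₖ b
      rw [← Matrix.mul_kronecker_mul, one_mul])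

variable {ι κ}

theorem kronLeft_apply (a : Matrix ι ι ℂ) : kronLeft ι κ a = a ⊗ₖ (1 : Matrix κ κ ℂ) := rfl

theorem kronRight_apply (b : Matrix κ κ ℂ) : kronRight ι κ b = (1 : Matrix ι ι ℂ) ⊗ₖ b := rfl

theorem kronLeft_mul_kronRight (a : Matrix ι ι ℂ) (b : Matrix κ κ ℂ) :
    kronLeft ι κ a * kronRight ι κ b = a ⊗ₖ b := by
  rw [kronLeft_apply, kronRight_apply, ← Matrix.mul_kronecker_mul, mul_one, one_mul]

theorem kronRight_mul_kronLeft (a : Matrix ι ι ℂ) (b : Matrix κ κ ℂ) :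
    kronRight ι κ b * kronLeft ι κ a = kronLeft ι κ a * kronRight ι κ b := by
  rw [kronLeft_mul_kronRight, kronLeft_apply, kronRight_apply, ← Matrix.mul_kronecker_mul, mul_one,
    one_mul]

/-- Every matrix unit of the product index type is a Kronecker product of matrix units. -/
theorem eq_top_of_kron (U : Subalgebra ℂ (Matrix (ι × κ) (ι × κ) ℂ))
    (h₁ : ∀ a, kronLeft ι κ a ∈ U) (h₂ : ∀ b, kronRight ι κ b ∈ U) : U = ⊤ := by
  rw [eq_top_iff]
  intro N _
  rw [Matrix.matrix_eq_sum_single N]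
  refine Subalgebra.sum_mem _ fun i _ => Subalgebra.sum_mem _ fun j _ => ?_
  have : Matrix.single i j (N i j) =
      kronLeft ι κ (Matrix.single i.1 j.1 (N i j)) * kronRight ι κ (Matrix.single i.2 j.2 1) := by
    rw [kronLeft_mul_kronRight, Matrix.single_kronecker_single, mul_one]
  rw [this]
  exact U.mul_mem (h₁ _) (h₂ _)

theorem adAct_kron (g : Gb) (U : Matrix.unitaryGroup ι ℂ) (V : Matrix.unitaryGroup κ ℂ)
    (a : Matrix ι ι ℂ) (b : Matrix κ κ ℂ) :
    adAct S g (kronUnitary U V) (a ⊗ₖ b) = adAct S g U a ⊗ₖ adAct S g V b := by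
  rw [adAct, adAct, adAct, coe_kronUnitary, op_kronecker, star_kron, ← Matrix.mul_kronecker_mul,
    ← Matrix.mul_kronecker_mul]

theorem adAct_kronLeft (g : Gb) (U : Matrix.unitaryGroup ι ℂ) (V : Matrix.unitaryGroup κ ℂ)
    (a : Matrix ι ι ℂ) :
    adAct S g (kronUnitary U V) (kronLeft ι κ a) = kronLeft ι κ (adAct S g U a) := by
  rw [kronLeft_apply, adAct_kron, adAct_one, kronLeft_apply]

theorem adAct_kronRight (g : Gb) (U : Matrix.unitaryGroup ι ℂ) (V : Matrix.unitaryGroup κ ℂ)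
    (b : Matrix κ κ ℂ) :
    adAct S g (kronUnitary U V) (kronRight ι κ b) = kronRight ι κ (adAct S g V b) := by
  rw [kronRight_apply, adAct_kron, adAct_one, kronRight_apply]

theorem adAct_spec (g : Gb) (U : Matrix.unitaryGroup ι ℂ) {z : Matrix ι ι ℂ} {c : ZMod 2}
    (hz : adAct S g U z = sgn c • z) (i : ZMod 2) :
    adAct S g U (spec z i) = spec z (i + c) := by
  rw [spec, spec, adAct_smul, adAct_add, adAct_one, adAct_smul, hz, scal_eq, conjPow_half,
    conjPow_sgn, smul_smul, sgn_add]

/-- Equivariance of `pairHom`. -/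
theorem adAct_pairHom (g : Gb) (U : Matrix.unitaryGroup ι ℂ) (V : Matrix.unitaryGroup κ ℂ)
    (k : Matrix ι ι ℂ →ₐ[ℂ] Matrix κ κ ℂ) (z : Matrix κ κ ℂ) (hz : z * z = 1)
    (hk : ∀ a, z * k a = k a * z) (hkU : ∀ a, adAct S g V (k a) = k (adAct S g U a)) {c : ZMod 2}
    (hzV : adAct S g V z = sgn c • z) (y : Matrix ι ι ℂ × Matrix ι ι ℂ) :
    adAct S g V (pairHom k z hz hk y) = pairHom k z hz hk (oddAct S g U c y) := by
  have hs : ∀ i a, spec z i * k a = k a * spec z i := fun i a => by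
    simp only [spec, smul_mul_assoc, mul_smul_comm, add_mul, mul_add, one_mul, mul_one, hk]
  rw [pairHom_apply, adAct_add, adAct_mul, adAct_mul, adAct_spec g V hzV, adAct_spec g V hzV, hkU,
    hkU, hs, hs, ite_self, ite_self, pairHom_apply]
  rcases zcases c with rfl | rfl
  · rw [oddAct_zero, zero_add, add_zero]
  · rw [oddAct_one_right, zero_add, show (1 + 1 : ZMod 2) = 0 from rfl, add_comm]

end Kron

end

section

variable {G Gb : Type*} [Group G] [Group Gb] {S : SymmetryClass G Gb}

/-! ### Fermion parity in a projective action -/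

section PowTwo

set_option linter.unusedSectionVars false

variable {R : Type*} [Ring R] [Algebra ℂ R]

theorem powTwo_mul_powTwo {z : R} (hz : z * z = 1) (i j : ZMod 2) :
    powTwo z i * powTwo z j = powTwo z (i + j) := by
  rcases zcases i with rfl | rfl <;> rcases zcases j with rfl | rfl <;>
    simp [powTwo_zero, powTwo_one, hz, show (1 + 1 : ZMod 2) = 0 from rfl]

theorem powTwo_mul_comm {z y : R} {j : ZMod 2} (h : z * y = sgn j • (y * z)) (i : ZMod 2) :
    powTwo z i * y = sgn (i * j) • (y * powTwo z i) := by
  rcases zcases i with rfl | rfl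
  · simp [powTwo_zero]
  · rw [powTwo_one, one_mul, h]

theorem mul_powTwo_comm {z y : R} {j : ZMod 2} (h : y * z = sgn j • (z * y)) (i : ZMod 2) :
    y * powTwo z i = sgn (j * i) • (powTwo z i * y) := by
  rcases zcases i with rfl | rfl
  · simp [powTwo_zero]
  · rw [powTwo_one, mul_one, h]

end PowTwo

section Parity

set_option linter.unusedSectionVars false

variable {ι : Type*} [Fintype ι] [DecidableEq ι]

theorem coe_powTwo (P : Matrix.unitaryGroup ι ℂ) (i : ZMod 2) :
    ((powTwo P i : Matrix.unitaryGroup ι ℂ) : Matrix ι ι ℂ) = powTwo (P : Matrix ι ι ℂ) i := by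
  rcases zcases i with rfl | rfl <;> rfl

theorem cj_powTwo (x : ZMod 2) (z : Matrix ι ι ℂ) (i : ZMod 2) :
    cj x (powTwo z i) = powTwo (cj x z) i := by
  rcases zcases i with rfl | rfl
  · exact map_one _
  · rfl

theorem star_of_mul_self {P : Matrix.unitaryGroup ι ℂ}
    (h : (P : Matrix ι ι ℂ) * (P : Matrix ι ι ℂ) = 1) :
    star (P : Matrix ι ι ℂ) = (P : Matrix ι ι ℂ) := by
  rw [← mul_one (star _), ← h, ← mul_assoc, unitary_star_mul, one_mul]

theorem op_of_star {z : Matrix ι ι ℂ} (hz : star z = z) (r x : ZMod 2) : op r x z = cj x z := by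
  rcases zcases r with rfl | rfl
  · rfl
  · rw [op, starPow_one, ← cj_star, hz]

/-- `P` is the normalized operator of fermion parity in the projective action `M`. -/
structure IsParity (S : SymmetryClass G Gb) (M : G → Matrix.unitaryGroup ι ℂ)
    (P : Matrix.unitaryGroup ι ℂ) (β : Gb → ZMod 2) : Prop where
  mul_self : (P : Matrix ι ι ℂ) * (P : Matrix ι ι ℂ) = 1
  rephase : ∃ d, M S.p = FermionicStacking.rephase d P
  left : ∀ g, M (S.p * g) = P * M g
  comm : ∀ g, (M g : Matrix ι ι ℂ) * cj (S.x (S.b g)) P =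
    sgn (β (S.b g)) • ((P : Matrix ι ι ℂ) * (M g : Matrix ι ι ℂ))

/-- `M 1` is a scalar, which determines α(1, ·) and α(·, 1) from α(1, 1). Dividing `M p` by this one
phase therefore normalizes the square and all left multiplications at once. The sign (-1)^{β(g)}
remains because `t p = 1`. -/
theorem exists_isParity [Nonempty ι] {t : S.Trivialization} {I : Invariants Gb} (hβ : I.β 1 = 0)
    {M : G → Matrix.unitaryGroup ι ℂ} (hM : IsProj (fun g => S.x (S.b g)) M (I.omega t)) :
    ∃ P, IsParity S M P I.β := by
  have hM' : ∀ g h, (M g : Matrix ι ι ℂ) * cj (S.x (S.b g)) (M h) =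
    phase (I.omega t g h) • (M (g * h) : Matrix ι ι ℂ) := hM
  have hω : ∀ g, I.omega t 1 g = I.α 1 (S.b g) := fun g => by
    rw [Invariants.omega, map_one, hβ, zero_mul, half_zero, add_zero]
  have hωp : ∀ g, I.omega t S.p g = I.α 1 (S.b g) := fun g => by
    rw [Invariants.omega, S.b_p, hβ, zero_mul, half_zero, add_zero]
  have hM1 : (M 1 : Matrix ι ι ℂ) = phase (I.α 1 1) • (1 : Matrix ι ι ℂ) := by
    have h1 := hM.apply_one (by simp only [map_one, x_one])
    rwa [hω, map_one] at h1
  have hα1 : ∀ g, I.α 1 (S.b g) = I.α 1 1 := by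
    intro g
    have h1 := hM' 1 g
    rw [map_one, x_one, cj_zero, hω, one_mul, hM1, smul_mul_assoc, one_mul] at h1
    exact (phase_smul_unitary_injective _ h1).symm
  have hα2 : ∀ g, I.α (S.b g) 1 = twist (S.x (S.b g)) (I.α 1 1) := by
    intro g
    have h1 := hM' g 1
    rw [hM1, cj_smul, conjPow_phase, map_one, mul_smul_comm, mul_one, mul_one, Invariants.omega,
      map_one, t.t_one, mul_zero, half_zero, add_zero] at h1
    exact (phase_smul_unitary_injective _ h1).symm
  have hpp : ∀ g, (M S.p : Matrix ι ι ℂ) * M g = phase (I.α 1 1) • (M (S.p * g) : Matrix ι ι ℂ) := by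
    intro g
    have h1 := hM' S.p g
    rwa [x_b_p, cj_zero, hωp, hα1] at h1
  refine ⟨rephase (-I.α 1 1) (M S.p), ?_, ⟨I.α 1 1, ?_⟩, fun g => ?_, fun g => ?_⟩
  · rw [coe_rephase, smul_mul_smul_comm, hpp, S.p_mul_p, hM1, smul_smul, smul_smul, ← phase_add,
      ← phase_add, ← phase_add, neg_add_cancel_right, neg_add_cancel, phase_zero, one_smul]
  · refine Subtype.ext ?_
    rw [coe_rephase, coe_rephase, smul_smul, ← phase_add, add_neg_cancel, phase_zero, one_smul]
  · refine Subtype.ext ?_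
    change (M (S.p * g) : Matrix ι ι ℂ) = (phase (-I.α 1 1) • (M S.p : Matrix ι ι ℂ)) * M g
    rw [smul_mul_assoc, hpp, smul_smul, ← phase_add, neg_add_cancel, phase_zero, one_smul]
  · rw [coe_rephase, cj_smul, conjPow_phase, mul_smul_comm, hM', smul_mul_assoc, hpp,
      Invariants.omega, S.b_p, t.t_p, mul_one, hα2, S.p_central, smul_smul, smul_smul, smul_smul,
      ← phase_half, ← phase_add, ← phase_add, ← phase_add, twist_neg]
    congr 2
    abel

variable {M : G → Matrix.unitaryGroup ι ℂ} {P : Matrix.unitaryGroup ι ℂ} {β : Gb → ZMod 2}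

theorem IsParity.comm_powTwo (h : IsParity S M P β) (g : G) (i : ZMod 2) :
    (M g : Matrix ι ι ℂ) * cj (S.x (S.b g)) (powTwo (P : Matrix ι ι ℂ) i) =
      sgn (β (S.b g) * i) • (powTwo (P : Matrix ι ι ℂ) i * (M g : Matrix ι ι ℂ)) := by
  rcases zcases i with rfl | rfl
  · simp [powTwo_zero]
  · rw [mul_one, powTwo_one, h.comm]

/-- Moving `M g` past the parity operator contributes the sign (-1)^{β(g)c(k)}; this is the source
of every cup product β ∪ c in the stacking law. -/
theorem IsParity.isProj (h : IsParity S M P β) {ω : G → G → UnitAddCircle}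
    (hM : IsProj (fun g => S.x (S.b g)) M ω) {c : G → ZMod 2} (hc : ∀ g k, c (g * k) = c g + c k) :
    IsProj (fun g => S.x (S.b g)) (fun g => powTwo P (c g) * M g)
      (fun g k => ω g k + half (β (S.b g) * c k)) := by
  intro g k
  have hM' : (M g : Matrix ι ι ℂ) * cj (S.x (S.b g)) (M k) =
    phase (ω g k) • (M (g * k) : Matrix ι ι ℂ) := hM g k
  simp only [Matrix.UnitaryGroup.mul_val, coe_powTwo]
  rw [map_mul, mul_assoc, ← mul_assoc (M g : Matrix ι ι ℂ), h.comm_powTwo, smul_mul_assoc, mul_assoc,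
    hM', mul_smul_comm, mul_smul_comm, mul_smul_comm, ← mul_assoc, powTwo_mul_powTwo h.mul_self,
    ← hc, smul_smul, phase_add, phase_half, mul_comm (sgn _)]

end Parity

section ParityAct

set_option linter.unusedSectionVars false

variable {ι : Type} [Fintype ι] [DecidableEq ι]
  {M : G → Matrix.unitaryGroup ι ℂ} {P : Matrix.unitaryGroup ι ℂ} {β : Gb → ZMod 2}

theorem adAct_of_comm {g : Gb} {U : Matrix.unitaryGroup ι ℂ} {z : Matrix ι ι ℂ} {c : ZMod 2}
    (h : (U : Matrix ι ι ℂ) * op (S.refl g) (S.x g) z = sgn c • (z * U)) :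
    adAct S g U z = sgn c • z := by
  rw [adAct, h, smul_mul_assoc, mul_assoc, unitary_mul_star, mul_one]

theorem IsParity.adAct_self (h : IsParity S M P β) (g : G) :
    adAct S (S.b g) (M g) P = sgn (β (S.b g)) • (P : Matrix ι ι ℂ) :=
  adAct_of_comm (by rw [op_of_star (star_of_mul_self h.mul_self), h.comm])

theorem IsParity.adAct_p (h : IsParity S M P β) (N : Matrix ι ι ℂ) :
    adAct S (S.b S.p) (M S.p) N = P * (N * P) := by
  obtain ⟨d, hd⟩ := h.rephase
  rw [hd, adAct_rephase, adAct, S.b_p, S.refl_one, x_one, op_zero_zero,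
    star_of_mul_self h.mul_self, mul_assoc]

theorem IsParity.adAct_conj (h : IsParity S M P β) (g : G) (N : Matrix ι ι ℂ) :
    adAct S (S.b g) (M g) (P * (N * P)) = P * (adAct S (S.b g) (M g) N * P) := by
  simp only [adAct_mul, h.adAct_self]
  split_ifs <;> simp only [smul_mul_assoc, mul_smul_comm, smul_smul, sgn_mul_self, one_smul,
    mul_assoc]

theorem IsParity.adAct_powTwo_mul (h : IsParity S M P β) (g : G) (i : ZMod 2) (N : Matrix ι ι ℂ) :
    adAct S (S.b g) (powTwo P i * M g) N =
      powTwo (P : Matrix ι ι ℂ) i * adAct S (S.b g) (M g) N * powTwo (P : Matrix ι ι ℂ) i := by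
  have hs : star (powTwo (P : Matrix ι ι ℂ) i) = powTwo (P : Matrix ι ι ℂ) i := by
    rcases zcases i with rfl | rfl
    · exact star_one _
    · exact star_of_mul_self h.mul_self
  rw [adAct, adAct, Matrix.UnitaryGroup.mul_val, coe_powTwo, star_mul, hs]
  simp only [mul_assoc]

/-- The twisted action exchanges the components of the graded embedding. -/
theorem IsParity.swapPow_gradedHom (h : IsParity S M P β) (g : G) (i : ZMod 2)
    (N : Matrix ι ι ℂ) :
    oddAct S (S.b g) (powTwo P i * M g) i (gradedHom _ h.mul_self N) =
      gradedHom _ h.mul_self (adAct S (S.b g) (M g) N) := by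
  rw [gradedHom_apply, oddAct]
  simp only [h.adAct_powTwo_mul, h.adAct_conj, gradedHom_apply]
  rcases zcases i with rfl | rfl
  · simp only [powTwo_zero, swapPow_zero, one_mul, mul_one]
  · have e : ∀ X : Matrix ι ι ℂ, (P : Matrix ι ι ℂ) * (P * (X * P)) * P = X := fun X => by
      rw [← mul_assoc, h.mul_self, one_mul, mul_assoc, h.mul_self, mul_one]
    simp only [powTwo_one, swapPow_one, Prod.swap_prod_mk, e, mul_assoc (P : Matrix ι ι ℂ)]

/-- Homogeneous elements of an even algebra. -/
theorem IsParity.conj_of_mem_deg (h : IsParity S M P β) {A : EquivariantAlgebra S}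
    {φ : A.carrier ≃ₐ[ℂ] Matrix ι ι ℂ}
    (hφ : ∀ g a, φ (A.act g a) = adAct S (S.b g) (M g) (φ a)) {i : ZMod 2} {a : A.carrier}
    (ha : a ∈ A.deg i) : (P : Matrix ι ι ℂ) * (φ a * P) = sgn i • φ a := by
  rw [← h.adAct_p, ← hφ, ← A.parity_apply, A.mem_deg.1 ha, units_smul_eq_sgn, map_smul]

theorem IsParity.comm_of_mem_deg (h : IsParity S M P β) {A : EquivariantAlgebra S}
    {φ : A.carrier ≃ₐ[ℂ] Matrix ι ι ℂ}
    (hφ : ∀ g a, φ (A.act g a) = adAct S (S.b g) (M g) (φ a)) {i : ZMod 2} {a : A.carrier}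
    (ha : a ∈ A.deg i) : (P : Matrix ι ι ℂ) * φ a = sgn i • (φ a * P) := by
  rw [← smul_mul_assoc, ← h.conj_of_mem_deg hφ ha, mul_assoc, mul_assoc, h.mul_self, mul_one]

/-- Homogeneous elements of an odd algebra. -/
theorem odd_of_mem_deg {χ : G → ZMod 2} (hχ : χ S.p = 1)
    {M : Gb → Matrix.unitaryGroup ι ℂ} {ω : Gb → Gb → UnitAddCircle} (hM : IsProj S.x M ω)
    {A : EquivariantAlgebra S} {φ : A.carrier ≃ₐ[ℂ] Matrix ι ι ℂ × Matrix ι ι ℂ}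
    (hφ : ∀ g a, φ (A.act g a) = oddAct S (S.b g) (M (S.b g)) (χ g) (φ a)) {i : ZMod 2}
    {a : A.carrier} (ha : a ∈ A.deg i) : φ a = ((φ a).1, sgn i • (φ a).1) := by
  have h1 := hφ S.p a
  have h2 : ∀ N, adAct S (S.b S.p) (M (S.b S.p)) N = N := by
    intro N
    have := adAct_group_one (hM.comp S.b) N
    rwa [S.b_p, ← map_one S.b]
  rw [hχ, oddAct_one_right, h2, h2, ← A.parity_apply, A.mem_deg.1 ha, units_smul_eq_sgn,
    map_smul] at h1
  exact Prod.ext rfl (congrArg Prod.fst h1).symm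

end ParityAct

/-! ### Stacking of model algebras -/

section StackModels

variable {ι κ : Type} [Fintype ι] [DecidableEq ι] [Fintype κ] [DecidableEq κ]
  {A B : EquivariantAlgebra S}

/-- An element `a` of degree `i` is sent to `a ⊗ P'^i`, and `b` to `1 ⊗ b`, so that the inserted
`P'` produces the Koszul sign. A symmetry multiplies `P'` by (-1)^{β'(g)}; conjugating `a` by
`P^{β'(g)}` undoes this, whence the extra factor in the unitary. -/
theorem evenBy_stack {M : G → Matrix.unitaryGroup ι ℂ} {P : Matrix.unitaryGroup ι ℂ}
    {β : Gb → ZMod 2} (hM : IsParity S M P β) {M' : G → Matrix.unitaryGroup κ ℂ}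
    {P' : Matrix.unitaryGroup κ ℂ} {β' : Gb → ZMod 2} (hM' : IsParity S M' P' β')
    (hA : EvenBy A M) (hB : EvenBy B M') :
    EvenBy (A.stack B) (fun g => kronUnitary (powTwo P (β' (S.b g)) * M g) (M' g)) := by
  obtain ⟨φ, hφ⟩ := hA
  obtain ⟨ψ, hψ⟩ := hB
  set z := kronRight ι κ (P' : Matrix κ κ ℂ) with hz
  have hzz : z * z = 1 := by rw [hz, ← map_mul, hM'.mul_self, map_one]
  have hzk : ∀ a, z * kronLeft ι κ a = kronLeft ι κ a * z := fun a => kronRight_mul_kronLeft a _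
  let F := (pairHom (kronLeft ι κ) z hzz hzk).comp (gradedHom _ hM.mul_self)
  refine exists_stack_equiv A B
    (fun g => adAct S (S.b g) (kronUnitary (powTwo P (β' (S.b g)) * M g) (M' g)))
    (F.comp (φ : A.carrier →ₐ[ℂ] Matrix ι ι ℂ))
    ((kronRight ι κ).comp (ψ : B.carrier →ₐ[ℂ] Matrix κ κ ℂ))
    (fun g => adAct_add _ _) (fun g => adAct_mul _ _) ?_ ?_ ?_ ?_ ?_
  · intro i j a b ha hb
    change pairHom (kronLeft ι κ) z hzz hzk (gradedHom _ hM.mul_self (φ a)) *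
      kronRight ι κ (ψ b) = sgn (i * j) • (kronRight ι κ (ψ b) *
      pairHom (kronLeft ι κ) z hzz hzk (gradedHom _ hM.mul_self (φ a)))
    have h1 : z * kronRight ι κ (ψ b) = sgn j • (kronRight ι κ (ψ b) * z) := by
      rw [hz, ← map_mul, ← map_mul, hM'.comm_of_mem_deg hψ hb, map_smul]
    rw [gradedHom_apply, hM.conj_of_mem_deg hφ ha, pairHom_homogeneous, mul_assoc,
      powTwo_mul_comm h1, mul_smul_comm, ← mul_assoc, ← mul_assoc, kronRight_mul_kronLeft]
  · intro g a
    change pairHom (kronLeft ι κ) z hzz hzk (gradedHom _ hM.mul_self (φ (A.act g a))) =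
      adAct S _ _ (pairHom (kronLeft ι κ) z hzz hzk (gradedHom _ hM.mul_self (φ a)))
    rw [adAct_pairHom _ (powTwo P (β' (S.b g)) * M g) _ _ _ _ _ (adAct_kronLeft _ _ _)
      (c := β' (S.b g)), hM.swapPow_gradedHom, hφ]
    rw [hz, adAct_kronRight, hM'.adAct_self, map_smul]
  · intro g b
    change kronRight ι κ (ψ (B.act g b)) = adAct S _ _ (kronRight ι κ (ψ b))
    rw [adAct_kronRight, hψ]
  · intro U h1 h2
    have h2' : ∀ b, kronRight ι κ b ∈ U := fun b => by
      obtain ⟨b, rfl⟩ := ψ.surjective b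
      exact h2 b
    refine eq_top_of_kron U (fun a => ?_) h2'
    -- The second factor supplies the spectral projections of `1 ⊗ P'`. Cutting the images of `a`
    -- and `P a P` with one projection each recovers `a ⊗ 1`.
    have h3 : ∀ a, kronLeft ι κ a * spec z 0 + kronLeft ι κ (P * (a * P)) * spec z 1 ∈ U := by
      intro a
      obtain ⟨a, rfl⟩ := φ.surjective a
      exact h1 a
    have hs : ∀ i, spec z i ∈ U := fun i =>
      U.smul_mem (U.add_mem U.one_mem (U.smul_mem (h2' _) _)) _
    have h4 := U.mul_mem (h3 a) (hs 0)
    have h5 := U.mul_mem (h3 (P * (a * P))) (hs 1)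
    rw [add_mul, mul_assoc, mul_assoc, spec_mul_spec hzz, spec_mul_spec hzz, if_pos rfl,
      if_neg (by decide), mul_zero, add_zero] at h4
    rw [add_mul, mul_assoc, mul_assoc, spec_mul_spec hzz, spec_mul_spec hzz, if_pos rfl,
      if_neg (by decide), mul_zero, zero_add, ← mul_assoc (P : Matrix ι ι ℂ) (_ * _), ← mul_assoc
      (P : Matrix ι ι ℂ) (P : Matrix ι ι ℂ), hM.mul_self, one_mul, mul_assoc a, hM.mul_self,
      mul_one] at h5
    have h6 := U.add_mem h4 h5
    rwa [← mul_add, spec_add_spec, mul_one] at h6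
  · rw [φ.toLinearEquiv.finrank_eq, ψ.toLinearEquiv.finrank_eq]
    simp only [Module.finrank_matrix, Module.finrank_self, Fintype.card_prod]
    ring

/-- With Γ = (1, -1) in the target, an element `a` of degree `i` goes to `(a ⊗ 1) Γ^i`, and the
Clifford generator of `B` goes to `(P ⊗ 1) Γ`, which has the required sign with odd `a`. Thus the
new Γ is the old generator times `P` and acquires the sign β + χ'. Conjugation by the corresponding
power of `P` compensates this sign on the image of `A`. -/
theorem oddBy_stack_even_odd {M : G → Matrix.unitaryGroup ι ℂ} {P : Matrix.unitaryGroup ι ℂ}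
    {β : Gb → ZMod 2} (hM : IsParity S M P β) {M' : Gb → Matrix.unitaryGroup κ ℂ}
    {ω' : Gb → Gb → UnitAddCircle} (hM' : IsProj S.x M' ω') {χ' : G → ZMod 2} (hχ' : χ' S.p = 1)
    (hA : EvenBy A M) (hB : OddBy B (fun g => M' (S.b g)) χ') :
    OddBy (A.stack B) (fun g => kronUnitary (powTwo P (β (S.b g) + χ' g) * M g) (M' (S.b g)))
      (fun g => β (S.b g) + χ' g) := by
  obtain ⟨φ, hφ⟩ := hA
  obtain ⟨ψ, hψ⟩ := hB
  set z := kronLeft ι κ (P : Matrix ι ι ℂ) with hz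
  have hzz : z * z = 1 := by rw [hz, ← map_mul, hM.mul_self, map_one]
  have hzk : ∀ b, z * kronRight ι κ b = kronRight ι κ b * z :=
    fun b => (kronRight_mul_kronLeft _ b).symm
  have hzz' : -z * -z = 1 := by rw [neg_mul_neg, hzz]
  have hzk' : ∀ b, -z * kronRight ι κ b = kronRight ι κ b * -z := fun b => by
    rw [neg_mul, hzk, mul_neg]
  set q := pairHom (kronRight ι κ) z hzz hzk with hq
  set q' := pairHom (kronRight ι κ) (-z) hzz' hzk' with hq'
  have hqq : ∀ y, q' y = q y.swap := fun y => pairHom_neg _ _ _ _ _ _ _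
  let F₁ := (AlgHom.prodMap (kronLeft ι κ) (kronLeft ι κ)).comp (gradedHom _ hM.mul_self)
  have hF₁ : ∀ a, F₁ a = (kronLeft ι κ a, kronLeft ι κ (P * (a * P))) := fun a => rfl
  let F₂ := AlgHom.prod q q'
  have hF₂ : ∀ y, F₂ y = (q y, q' y) := fun y => rfl
  refine exists_stack_equiv A B
    (fun g => oddAct S (S.b g) (kronUnitary (powTwo P (β (S.b g) + χ' g) * M g) (M' (S.b g)))
      (β (S.b g) + χ' g))
    (F₁.comp (φ : A.carrier →ₐ[ℂ] Matrix ι ι ℂ))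
    (F₂.comp (ψ : B.carrier →ₐ[ℂ] Matrix κ κ ℂ × Matrix κ κ ℂ))
    (fun g => oddAct_add _ _ _) (fun g => oddAct_mul _ _ _) ?_ ?_ ?_ ?_ ?_
  · intro i j a b ha hb
    change F₁ (φ a) * F₂ (ψ b) = sgn (i * j) • (F₂ (ψ b) * F₁ (φ a))
    have hb' : ψ b = ((ψ b).1, sgn j • (ψ b).1) := odd_of_mem_deg hχ' hM' hψ hb
    have h1 : kronLeft ι κ (φ a) * z = sgn i • (z * kronLeft ι κ (φ a)) := by
      rw [hz, ← map_mul, ← map_mul, hM.comm_of_mem_deg hφ ha, map_smul, smul_smul, sgn_mul_self,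
        one_smul]
    have h2 : ∀ N, kronLeft ι κ (φ a) * (kronRight ι κ N * powTwo z j) =
        sgn (i * j) • (kronRight ι κ N * powTwo z j * kronLeft ι κ (φ a)) := by
      intro N
      rw [← mul_assoc, ← kronRight_mul_kronLeft, mul_assoc, mul_powTwo_comm h1, mul_smul_comm,
        mul_assoc]
    have h3 : (sgn j • (ψ b).1, (ψ b).1) = ((sgn j • (ψ b).1), sgn j • (sgn j • (ψ b).1)) := by
      rw [smul_smul, sgn_mul_self, one_smul]
    rw [hF₁, hF₂, hb', hqq, Prod.swap_prod_mk, h3, hq, pairHom_homogeneous, pairHom_homogeneous,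
      hM.conj_of_mem_deg hφ ha, Prod.mk_mul_mk, Prod.mk_mul_mk, Prod.smul_mk, map_smul, h2,
      smul_mul_assoc, h2, mul_smul_comm]
    refine Prod.ext rfl ?_
    rw [smul_comm]
  · intro g a
    change F₁ (φ (A.act g a)) = oddAct S _ _ _ (F₁ (φ a))
    have h1 := hM.swapPow_gradedHom g (β (S.b g) + χ' g) (φ a)
    rw [hφ, hF₁, hF₁, oddAct, adAct_kronLeft, adAct_kronLeft]
    rw [gradedHom_apply, gradedHom_apply, oddAct] at h1
    rcases zcases (β (S.b g) + χ' g) with h | h <;> rw [h] at h1 ⊢ <;>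
      simp only [swapPow_zero, swapPow_one, Prod.swap_prod_mk, Prod.mk.injEq] at h1 ⊢ <;>
      rw [h1.1, h1.2] <;> exact ⟨rfl, rfl⟩
  · intro g b
    change F₂ (ψ (B.act g b)) = oddAct S _ _ _ (F₂ (ψ b))
    have hzc : adAct S (S.b g) (kronUnitary (powTwo P (β (S.b g) + χ' g) * M g) (M' (S.b g))) z =
        sgn (β (S.b g)) • z := by
      rw [hz, adAct_kronLeft, hM.adAct_powTwo_mul, hM.adAct_self, mul_smul_comm, smul_mul_assoc,
        map_smul]
      congr 2
      rcases zcases (β (S.b g) + χ' g) with h | h <;> rw [h]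
      · rw [powTwo_zero, one_mul, mul_one]
      · rw [powTwo_one, hM.mul_self, one_mul]
    have h1 : ∀ y, adAct S (S.b g)
        (kronUnitary (powTwo P (β (S.b g) + χ' g) * M g) (M' (S.b g))) (q y) =
        q (oddAct S (S.b g) (M' (S.b g)) (β (S.b g)) y) := fun y =>
      adAct_pairHom _ (M' (S.b g)) _ _ _ _ _ (adAct_kronRight _ _ _) hzc y
    rw [hF₂, hF₂, hψ, hqq, hqq]
    conv_rhs => rw [oddAct]
    dsimp only
    rw [h1, h1]
    generalize hy : ψ b = y
    have hsw : oddAct S (S.b g) (M' (S.b g)) (β (S.b g)) y.swap =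
        (oddAct S (S.b g) (M' (S.b g)) (β (S.b g)) y).swap := by
      rcases zcases (β (S.b g)) with h | h <;> rw [h] <;> rfl
    rw [hsw]
    rcases zcases (β (S.b g)) with h | h <;> rcases zcases (χ' g) with h' | h' <;>
      rw [h, h'] <;> rfl
  · intro U h1 h2
    have h1' : ∀ a, (kronLeft ι κ a, kronLeft ι κ (P * (a * P))) ∈ U := fun a => by
      obtain ⟨a, rfl⟩ := φ.surjective a
      exact h1 a
    have h2' : ∀ y, (q y, q y.swap) ∈ U := fun y => by
      obtain ⟨b, rfl⟩ := ψ.surjective y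
      rw [← hqq]
      exact h2 b
    have hP : ((z, z) : Matrix (ι × κ) (ι × κ) ℂ × Matrix (ι × κ) (ι × κ) ℂ) ∈ U := by
      have := h1' P
      rwa [hM.mul_self, mul_one] at this
    -- The new generator Γ is recovered as the image of the old one times the image of `P`; it then
    -- separates the two factors of the target.
    have hm : ((1, -1) : Matrix (ι × κ) (ι × κ) ℂ × Matrix (ι × κ) (ι × κ) ℂ) ∈ U := by
      have := U.mul_mem (h2' (1, -1)) hP
      rw [← hqq, hq, hq', pairHom_one_neg_one, pairHom_one_neg_one, Prod.mk_mul_mk, neg_mul,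
        hzz] at this
      exact this
    have hl : ((1, 0) : Matrix (ι × κ) (ι × κ) ℂ × Matrix (ι × κ) (ι × κ) ℂ) ∈ U := by
      have := U.smul_mem (U.add_mem U.one_mem hm) (1 / 2 : ℂ)
      convert this using 1
      ext1 <;> simp only [Prod.smul_fst, Prod.smul_snd, Prod.fst_add, Prod.snd_add, Prod.fst_one,
        Prod.snd_one]
      · module
      · simp
    have hr : ((0, 1) : Matrix (ι × κ) (ι × κ) ℂ × Matrix (ι × κ) (ι × κ) ℂ) ∈ U := by
      have := U.sub_mem U.one_mem hl
      convert this using 1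
      ext1 <;> simp
    have hU₁ : U.comap (AlgHom.prod (AlgHom.id ℂ _) (AlgHom.id ℂ _)) = ⊤ := by
      refine eq_top_of_kron _ (fun a => ?_) (fun b => ?_)
      · change (kronLeft ι κ a, kronLeft ι κ a) ∈ U
        have e1 := U.mul_mem (h1' a) hl
        have e2 := U.mul_mem (h1' (P * (a * P))) hr
        have e3 := U.add_mem e1 e2
        have e4 : (P : Matrix ι ι ℂ) * (P * (a * P) * P) = a := by
          rw [← mul_assoc, ← mul_assoc (P : Matrix ι ι ℂ), hM.mul_self, one_mul, mul_assoc,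
            hM.mul_self, mul_one]
        simpa [e4] using e3
      · change (kronRight ι κ b, kronRight ι κ b) ∈ U
        have := h2' (b, b)
        rwa [Prod.swap_prod_mk, hq, pairHom_diag] at this
    have hd : ∀ N : Matrix (ι × κ) (ι × κ) ℂ, (N, N) ∈ U := fun N => by
      have : N ∈ U.comap (AlgHom.prod (AlgHom.id ℂ _) (AlgHom.id ℂ _)) := by
        rw [hU₁]; trivial
      exact this
    rw [eq_top_iff]
    rintro ⟨N, N'⟩ -
    have := U.add_mem (U.mul_mem (hd N) hl) (U.mul_mem (hd N') hr)
    simpa using this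
  · rw [φ.toLinearEquiv.finrank_eq, ψ.toLinearEquiv.finrank_eq]
    simp only [Module.finrank_prod, Module.finrank_matrix, Module.finrank_self, Fintype.card_prod]
    ring

/-- The Pauli matrix `X`. -/
def pauliX : Matrix.unitaryGroup (Fin 2) ℂ :=
  ⟨!![0, 1; 1, 0], by
    rw [Matrix.mem_unitaryGroup_iff]
    ext i j
    fin_cases i <;> fin_cases j <;> simp [Matrix.mul_apply, Matrix.star_apply]⟩

/-- The Pauli matrix `Y`. -/
def pauliY : Matrix.unitaryGroup (Fin 2) ℂ :=
  ⟨!![0, -Complex.I; Complex.I, 0], by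
    rw [Matrix.mem_unitaryGroup_iff]
    ext i j
    fin_cases i <;> fin_cases j <;> simp [Matrix.mul_apply, Matrix.star_apply]⟩

theorem coe_pauliX : (pauliX : Matrix (Fin 2) (Fin 2) ℂ) = !![0, 1; 1, 0] := rfl

theorem coe_pauliY : (pauliY : Matrix (Fin 2) (Fin 2) ℂ) = !![0, -Complex.I; Complex.I, 0] := rfl

theorem pauliX_mul_self : (pauliX : Matrix (Fin 2) (Fin 2) ℂ) * pauliX = 1 := by
  rw [coe_pauliX]
  ext i j
  fin_cases i <;> fin_cases j <;> simp

theorem pauliY_mul_self : (pauliY : Matrix (Fin 2) (Fin 2) ℂ) * pauliY = 1 := by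
  rw [coe_pauliY]
  ext i j
  fin_cases i <;> fin_cases j <;> simp

theorem pauliY_mul_pauliX : (pauliY : Matrix (Fin 2) (Fin 2) ℂ) * pauliX =
    sgn 1 • ((pauliX : Matrix (Fin 2) (Fin 2) ℂ) * pauliY) := by
  rw [coe_pauliX, coe_pauliY, sgn_one]
  ext i j
  fin_cases i <;> fin_cases j <;> simp

theorem pauliX_mul_pauliY : (pauliX : Matrix (Fin 2) (Fin 2) ℂ) * pauliY =
    sgn 1 • ((pauliY : Matrix (Fin 2) (Fin 2) ℂ) * pauliX) := by
  rw [pauliY_mul_pauliX, smul_smul, sgn_mul_self, one_smul]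

theorem cj_pauliX (x : ZMod 2) : cj x (pauliX : Matrix (Fin 2) (Fin 2) ℂ) = pauliX := by
  rcases zcases x with rfl | rfl
  · exact cj_zero _
  · rw [coe_pauliX]
    ext i j
    fin_cases i <;> fin_cases j <;> simp [cj_apply]

theorem cj_pauliY (x : ZMod 2) :
    cj x (pauliY : Matrix (Fin 2) (Fin 2) ℂ) = sgn x • (pauliY : Matrix (Fin 2) (Fin 2) ℂ) := by
  rcases zcases x with rfl | rfl
  · rw [cj_zero, sgn_zero, one_smul]
  · rw [coe_pauliY]
    ext i j
    fin_cases i <;> fin_cases j <;> simp [cj_apply, conjPow_one]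

theorem cj_powTwo_pauliY (x i : ZMod 2) : cj x (powTwo (pauliY : Matrix (Fin 2) (Fin 2) ℂ) i) =
    sgn (x * i) • powTwo (pauliY : Matrix (Fin 2) (Fin 2) ℂ) i := by
  rcases zcases i with rfl | rfl
  · simp [powTwo_zero]
  · rw [powTwo_one, cj_pauliY, mul_one]

/-- The two Clifford generators and their product, with the unit, span the 2 × 2 matrices. This is
needed for generation in the odd-odd case. -/
theorem eq_pauli (N : Matrix (Fin 2) (Fin 2) ℂ) :
    N = ((N 0 0 + N 1 1) / 2) • (1 : Matrix (Fin 2) (Fin 2) ℂ) +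
      ((N 0 1 + N 1 0) / 2) • (pauliX : Matrix (Fin 2) (Fin 2) ℂ) +
      (Complex.I * (N 0 1 - N 1 0) / 2) • (pauliY : Matrix (Fin 2) (Fin 2) ℂ) +
      (-Complex.I * (N 0 0 - N 1 1) / 2) •
        ((pauliX : Matrix (Fin 2) (Fin 2) ℂ) * (pauliY : Matrix (Fin 2) (Fin 2) ℂ)) := by
  have hI : Complex.I * Complex.I = -1 := Complex.I_mul_I
  rw [coe_pauliX, coe_pauliY]
  ext i j
  fin_cases i <;> fin_cases j <;> simp
  · linear_combination ((N 0 0 - N 1 1) / 2) * hI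
  · linear_combination ((N 0 1 - N 1 0) / 2) * hI
  · linear_combination (-(N 0 1 - N 1 0) / 2) * hI
  · linear_combination (-(N 0 0 - N 1 1) / 2) * hI

/-- The action on the two generators of `ℂℓ(2) = M_2(ℂ)`. -/
def pauliUnitary (x i j : ZMod 2) : Matrix.unitaryGroup (Fin 2) ℂ :=
  powTwo pauliX (j + x) * powTwo pauliY i

theorem coe_pauliUnitary (x i j : ZMod 2) :
    (pauliUnitary x i j : Matrix (Fin 2) (Fin 2) ℂ) =
      powTwo (pauliX : Matrix (Fin 2) (Fin 2) ℂ) (j + x) * powTwo (pauliY : Matrix _ _ ℂ) i := by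
  rw [pauliUnitary, Matrix.UnitaryGroup.mul_val, coe_powTwo, coe_powTwo]

theorem adAct_pauliX (g : Gb) (i j : ZMod 2) :
    adAct S g (pauliUnitary (S.x g) i j) pauliX = sgn i • (pauliX : Matrix (Fin 2) (Fin 2) ℂ) := by
  refine adAct_of_comm ?_
  rw [op_of_star (star_of_mul_self pauliX_mul_self), cj_pauliX, coe_pauliUnitary, mul_assoc,
    powTwo_mul_comm pauliY_mul_pauliX, mul_smul_comm, mul_one, ← mul_assoc, ← mul_assoc]
  congr 2
  rcases zcases (j + S.x g) with h | h <;> rw [h]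
  · rw [powTwo_zero, one_mul, mul_one]
  · rfl

/-- Complex conjugation negates `Y`, contributing the sign (-1)^x. The exponent `j + x` of `X` in
`pauliUnitary` cancels it, and this is the origin of the shift by `x` when two odd algebras are
stacked. -/
theorem adAct_pauliY (g : Gb) (i j : ZMod 2) :
    adAct S g (pauliUnitary (S.x g) i j) pauliY = sgn j • (pauliY : Matrix (Fin 2) (Fin 2) ℂ) := by
  refine adAct_of_comm ?_
  have h1 : powTwo (pauliY : Matrix (Fin 2) (Fin 2) ℂ) i * pauliY =
      (pauliY : Matrix (Fin 2) (Fin 2) ℂ) * powTwo (pauliY : Matrix (Fin 2) (Fin 2) ℂ) i := by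
    rcases zcases i with rfl | rfl
    · rw [powTwo_zero, one_mul, mul_one]
    · rfl
  rw [op_of_star (star_of_mul_self pauliY_mul_self), cj_pauliY, coe_pauliUnitary, mul_smul_comm,
    mul_assoc, h1, ← mul_assoc, powTwo_mul_comm pauliX_mul_pauliY, smul_mul_assoc, smul_smul,
    ← sgn_add, mul_assoc]
  congr 2
  linear_combination S.x g * CharTwo.two_eq_zero (R := ZMod 2)

/-- The first term of the cocycle comes from conjugating the power of `Y` in the second operator,
the second from moving that operator's power of `X` past the first operator's power of `Y`. -/
theorem isProj_pauliUnitary {χ χ' : G → ZMod 2} (hχ : ∀ g h, χ (g * h) = χ g + χ h)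
    (hχ' : ∀ g h, χ' (g * h) = χ' g + χ' h) :
    IsProj (fun g => S.x (S.b g)) (fun g => pauliUnitary (S.x (S.b g)) (χ g) (χ' g))
      (fun g h => half (S.x (S.b g) * χ h + χ g * (χ' h + S.x (S.b h)))) := by
  intro g h
  simp only [coe_pauliUnitary]
  rw [map_mul, cj_powTwo, cj_pauliX, cj_powTwo_pauliY, mul_assoc, ← mul_assoc (powTwo _ (χ g)),
    mul_powTwo_comm (powTwo_mul_comm pauliY_mul_pauliX (χ g)), smul_mul_assoc, mul_smul_comm,
    mul_smul_comm, mul_smul_comm, smul_smul, mul_assoc (powTwo _ (χ' h + _)),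
    powTwo_mul_powTwo pauliY_mul_self, ← mul_assoc, powTwo_mul_powTwo pauliX_mul_self, phase_half,
    sgn_add, hχ, hχ', x_b_mul, mul_one, mul_comm (sgn (χ g * _))]
  congr 3
  ring

/-- The graded tensor product of two copies of ℂℓ(1) is ℂℓ(2) = M₂(ℂ), with the anticommuting Pauli
matrices `X` and `Y` as generators. The remaining matrix factors are ungraded and combine by an
ordinary tensor product. -/
theorem evenBy_stack_odd_odd {M : Gb → Matrix.unitaryGroup ι ℂ} {ω : Gb → Gb → UnitAddCircle}
    (hM : IsProj S.x M ω) {χ : G → ZMod 2} (hχ : χ S.p = 1) {M' : Gb → Matrix.unitaryGroup κ ℂ}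
    {ω' : Gb → Gb → UnitAddCircle} (hM' : IsProj S.x M' ω') {χ' : G → ZMod 2} (hχ' : χ' S.p = 1)
    (hA : OddBy A (fun g => M (S.b g)) χ) (hB : OddBy B (fun g => M' (S.b g)) χ') :
    EvenBy (A.stack B) (fun g => kronUnitary (kronUnitary (M (S.b g)) (M' (S.b g)))
      (pauliUnitary (S.x (S.b g)) (χ g) (χ' g))) := by
  obtain ⟨φ, hφ⟩ := hA
  obtain ⟨ψ, hψ⟩ := hB
  let k := kronLeft (ι × κ) (Fin 2)
  set X := kronRight (ι × κ) (Fin 2) pauliX with hX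
  set Y := kronRight (ι × κ) (Fin 2) pauliY with hY
  have hXX : X * X = 1 := by rw [hX, ← map_mul, pauliX_mul_self, map_one]
  have hYY : Y * Y = 1 := by rw [hY, ← map_mul, pauliY_mul_self, map_one]
  have hXY : X * Y = sgn 1 • (Y * X) := by
    rw [hX, hY, ← map_mul, ← map_mul, pauliX_mul_pauliY, map_smul]
  have hXk : ∀ N, X * k N = k N * X := fun N => kronRight_mul_kronLeft N _
  have hYk : ∀ N, Y * k N = k N * Y := fun N => kronRight_mul_kronLeft N _
  have hXk' : ∀ a, X * (k.comp (kronLeft ι κ)) a = (k.comp (kronLeft ι κ)) a * X := fun a => hXk _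
  have hYk' : ∀ a, Y * (k.comp (kronRight ι κ)) a = (k.comp (kronRight ι κ)) a * Y := fun a => hYk _
  obtain ⟨F₁, hF₁⟩ : ∃ F, F = pairHom (k.comp (kronLeft ι κ)) X hXX hXk' := ⟨_, rfl⟩
  obtain ⟨F₂, hF₂⟩ : ∃ F, F = pairHom (k.comp (kronRight ι κ)) Y hYY hYk' := ⟨_, rfl⟩
  refine exists_stack_equiv A B
    (fun g => adAct S (S.b g) (kronUnitary (kronUnitary (M (S.b g)) (M' (S.b g)))
      (pauliUnitary (S.x (S.b g)) (χ g) (χ' g))))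
    (F₁.comp (φ : A.carrier →ₐ[ℂ] Matrix ι ι ℂ × Matrix ι ι ℂ))
    (F₂.comp (ψ : B.carrier →ₐ[ℂ] Matrix κ κ ℂ × Matrix κ κ ℂ))
    (fun g => adAct_add _ _) (fun g => adAct_mul _ _) ?_ ?_ ?_ ?_ ?_
  · intro i j a b ha hb
    change F₁ (φ a) * F₂ (ψ b) = sgn (i * j) • (F₂ (ψ b) * F₁ (φ a))
    rw [odd_of_mem_deg hχ hM hφ ha, odd_of_mem_deg hχ' hM' hψ hb]
    rw [hF₁, hF₂, pairHom_homogeneous, pairHom_homogeneous, AlgHom.comp_apply, AlgHom.comp_apply]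
    generalize (φ a).1 = N
    generalize (ψ b).1 = N'
    have e1 : ∀ i N, powTwo X i * k N = k N * powTwo X i := fun i N => by
      rcases zcases i with rfl | rfl
      · rw [powTwo_zero, one_mul, mul_one]
      · exact hXk N
    have e2 : ∀ i N, powTwo Y i * k N = k N * powTwo Y i := fun i N => by
      rcases zcases i with rfl | rfl
      · rw [powTwo_zero, one_mul, mul_one]
      · exact hYk N
    have e3 : powTwo X i * powTwo Y j = sgn (i * j) • (powTwo Y j * powTwo X i) := by
      rw [mul_powTwo_comm (powTwo_mul_comm hXY i), mul_one]
    rw [mul_assoc, ← mul_assoc (powTwo X i), e1, mul_assoc _ (powTwo X i), e3, mul_smul_comm,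
      mul_smul_comm, mul_assoc _ (powTwo Y j), ← mul_assoc (powTwo Y j), e2, ← mul_assoc, ← mul_assoc,
      ← mul_assoc, ← mul_assoc, ← map_mul k, ← map_mul k, kronRight_mul_kronLeft]
  · intro g a
    change F₁ (φ (A.act g a)) = adAct S _ _ (F₁ (φ a))
    rw [hφ, hF₁]
    refine (adAct_pairHom _ (M (S.b g)) _ _ _ _ _ (fun N => ?_) ?_ _).symm
    · simp only [AlgHom.comp_apply, k, adAct_kronLeft]
    · rw [hX, adAct_kronRight, adAct_pauliX, map_smul]
  · intro g b
    change F₂ (ψ (B.act g b)) = adAct S _ _ (F₂ (ψ b))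
    rw [hψ, hF₂]
    refine (adAct_pairHom _ (M' (S.b g)) _ _ _ _ _ (fun N => ?_) ?_ _).symm
    · simp only [AlgHom.comp_apply, k, adAct_kronLeft, adAct_kronRight]
    · rw [hY, adAct_kronRight, adAct_pauliY, map_smul]
  · intro U h1 h2
    have h1' : ∀ y, F₁ y ∈ U := fun y => by
      obtain ⟨a, rfl⟩ := φ.surjective y
      exact h1 a
    have h2' : ∀ y, F₂ y ∈ U := fun y => by
      obtain ⟨b, rfl⟩ := ψ.surjective y
      exact h2 b
    have hXU : X ∈ U := by
      have := h1' (1, -1)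
      rwa [hF₁, pairHom_one_neg_one] at this
    have hYU : Y ∈ U := by
      have := h2' (1, -1)
      rwa [hF₂, pairHom_one_neg_one] at this
    have hU : U.comap k = ⊤ := by
      refine eq_top_of_kron _ (fun a => ?_) (fun b => ?_)
      · have := h1' (a, a)
        rwa [hF₁, pairHom_diag] at this
      · have := h2' (b, b)
        rwa [hF₂, pairHom_diag] at this
    refine eq_top_of_kron U (fun N => ?_) (fun N => ?_)
    · have : N ∈ U.comap k := by rw [hU]; trivial
      exact this
    · rw [eq_pauli N, map_add, map_add, map_add, map_smul, map_smul, map_smul, map_smul, map_mul,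
        map_one]
      exact U.add_mem (U.add_mem (U.add_mem (U.smul_mem U.one_mem _) (U.smul_mem hXU _))
        (U.smul_mem hYU _)) (U.smul_mem (U.mul_mem hXU hYU) _)
  · rw [φ.toLinearEquiv.finrank_eq, ψ.toLinearEquiv.finrank_eq]
    simp only [Module.finrank_prod, Module.finrank_matrix, Module.finrank_self, Fintype.card_prod,
      Fintype.card_fin]
    ring

end StackModels

end

section

variable {G Gb : Type*} [Group G] [Group Gb] {S : SymmetryClass G Gb}

/-! ### The stacking law -/

/-- The map `ℤ/2 → ℝ/ℤ` sending `1` to a quarter; its failure to be additive is the cup square. -/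
def quarter (i : ZMod 2) : UnitAddCircle := (((i.val : ℝ) / 4 : ℝ) : UnitAddCircle)

theorem quarter_zero : quarter 0 = 0 := by simp [quarter]

theorem quarter_one_add_quarter_one : quarter 1 + quarter 1 = half 1 := by
  simp only [quarter, half, ← AddCircle.coe_add, ZMod.val_one]
  norm_num

/-- Lifting ℤ/2 to quarters fails to be additive by ½ f ∪ f, and the twist negates the quarter,
adding ½ x ∪ f. Thus, for a homomorphism `f`, ½ f ∪ f and ½ x ∪ f are cohomologous. -/
theorem twist_quarter (i j k : ZMod 2) :
    twist i (quarter j) - quarter (k + j) + quarter k = half (k * j + i * j) := by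
  have h : -quarter 1 + half 1 = quarter 1 := by rw [← quarter_one_add_quarter_one]; abel
  rcases zcases i with rfl | rfl <;> rcases zcases j with rfl | rfl <;>
    rcases zcases k with rfl | rfl <;>
    simp [twist_zero_left, twist_one_left, quarter_zero, half_zero,
      show (1 + 1 : ZMod 2) = 0 from rfl, quarter_one_add_quarter_one]
  rw [← quarter_one_add_quarter_one, sub_eq_add_neg]
  have h4 : quarter 1 + quarter 1 + (quarter 1 + quarter 1) = 0 := by
    rw [quarter_one_add_quarter_one, half_one_add_half_one]
  rw [← sub_eq_zero, ← neg_eq_zero]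
  refine Eq.trans ?_ h4
  abel

theorem dOne_quarter {K : Type*} [Group K] (x : K → ZMod 2) {f : K → ZMod 2}
    (hf : ∀ g h, f (g * h) = f g + f h) (g h : K) :
    dOne x (fun k => quarter (f k)) g h = half (f g * f h + x g * f h) := by
  simp only [dOne, hf]
  exact twist_quarter _ _ _

theorem dOne_half {K : Type*} [Group K] (x : K → ZMod 2) (f : K → ZMod 2) (g h : K) :
    dOne x (fun k => half (f k)) g h = half (f h + f (g * h) + f g) := by
  simp only [dOne, twist_half, half_add, sub_eq_add_neg, neg_half]

theorem dOne_add {K : Type*} [Group K] (x : K → ZMod 2) (L L' : K → UnitAddCircle) (g h : K) :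
    dOne x (fun k => L k + L' k) g h = dOne x L g h + dOne x L' g h := by
  simp only [dOne, twist_add]
  abel

theorem dOne_neg {K : Type*} [Group K] (x : K → ZMod 2) (L : K → UnitAddCircle) (g h : K) :
    dOne x (fun k => -L k) g h = -dOne x L g h := by
  simp only [dOne, twist_neg]
  abel

/-- The graded flip `A ⊗ B ≃ B ⊗ A`. -/
theorem eqvIso_stack_comm (A B : EquivariantAlgebra S) : EqvIso (A.stack B) (B.stack A) := by
  refine ⟨GradedTensorProduct.comm A.deg B.deg, fun g z => ?_⟩
  change GradedTensorProduct.comm A.deg B.deg (A.tensorAct B g z) =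
    B.tensorAct A g (GradedTensorProduct.comm A.deg B.deg z)
  have hc : ∀ {i j a b}, a ∈ A.deg i → b ∈ B.deg j →
      GradedTensorProduct.comm A.deg B.deg (a ᵍ⊗ₜ[ℂ] b) = (-1 : ℤˣ) ^ (j * i) • (b ᵍ⊗ₜ[ℂ] a) :=
    fun {i j a b} ha hb => GradedTensorProduct.comm_coe_tmul_coe A.deg B.deg ⟨a, ha⟩ ⟨b, hb⟩
  induction z using EquivariantAlgebra.tensor_induction with
  | hadd z w hz hw => rw [map_add, map_add, map_add, map_add, hz, hw]
  | h i j a b ha hb =>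
    rw [EquivariantAlgebra.tensorAct_tmul A B g ha hb, EquivariantAlgebra.map_units_smul,
      hc (A.act_mem_deg g ha) (B.act_mem_deg g hb), hc ha hb, EquivariantAlgebra.map_units_smul,
      EquivariantAlgebra.tensorAct_tmul B A g hb ha, smul_comm, mul_comm j i]

/-! ### Invariants of a stack in the four parity cases -/

section Law

variable {t : S.Trivialization} {A B : EquivariantAlgebra S} {α α' : Gb → Gb → UnitAddCircle}
  {β β' : Gb → ZMod 2}

theorem map_one_of_map_mul {K : Type*} [Group K] {f : K → ZMod 2}
    (hf : ∀ g h, f (g * h) = f g + f h) : f 1 = 0 := by simpa using hf 1 1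

theorem HasInvariants.evenWith (h : HasInvariants t A ⟨α, β, 0⟩) :
    EvenWith A (Invariants.omega t ⟨α, β, 0⟩) := by
  rcases h with ⟨_, h⟩ | ⟨h, _⟩
  · exact h
  · exact absurd h zero_ne_one

theorem HasInvariants.oddWith (h : HasInvariants t A ⟨α, β, 1⟩) :
    OddWith A α (fun g => β (S.b g) + t.t g) := by
  rcases h with ⟨h, _⟩ | ⟨_, h⟩
  · exact absurd h one_ne_zero
  · exact h

/-- The correction by `P^{β'}` adds ½ β ∪ β' to the first cocycle, and the tensor product of
representations adds the second; no coboundary is needed. -/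
theorem HasInvariants.stack_even_even (hA : HasInvariants t A ⟨α, β, 0⟩)
    (hB : HasInvariants t B ⟨α', β', 0⟩) : HasInvariants t (A.stack B)
      ⟨fun g h => α g h + α' g h + half (β g * β' h), fun g => β g + β' g, 0⟩ := by
  have hβ' := hB.admissible.dβ
  obtain ⟨n, hn, M, hM, hA'⟩ := evenWith_iff.1 hA.evenWith
  obtain ⟨m, hm, M', hM', hB'⟩ := evenWith_iff.1 hB.evenWith
  have : Nonempty (Fin n) := ⟨⟨0, hn⟩⟩
  have : Nonempty (Fin m) := ⟨⟨0, hm⟩⟩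
  obtain ⟨P, hP⟩ := exists_isParity (map_one_of_map_mul hA.admissible.dβ) hM
  obtain ⟨P', hP'⟩ := exists_isParity (map_one_of_map_mul hβ') hM'
  refine Or.inl ⟨rfl, (evenBy_stack hP hP' hA' hB').evenWith
    (((hP.isProj hM (c := fun g => β' (S.b g)) (fun g k => ?_)).kron hM').congr fun g k => ?_)⟩
  · rw [map_mul]; exact hβ' _ _
  · simp only [Invariants.omega, add_mul, half_add]
    abel

/-- The correction by `P^{β + β' + t}` adds ½ β ∪ (β + β' + t) to α + ½ β t. The two terms with `t`
cancel, leaving a cocycle on the bosonic group and the extra ½ β ∪ β. -/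
theorem HasInvariants.stack_even_odd (hA : HasInvariants t A ⟨α, β, 0⟩)
    (hB : HasInvariants t B ⟨α', β', 1⟩) : HasInvariants t (A.stack B)
      ⟨fun g h => α g h + α' g h + half (β g * β' h) + half (β g * β h),
        fun g => β g + β' g, 1⟩ := by
  have hβ : ∀ g k, β (g * k) = β g + β k := hA.admissible.dβ
  have hp : β' (S.b S.p) + t.t S.p = 1 := chi_p hB.oddWith
  obtain ⟨n, hn, M, hM, hA'⟩ := evenWith_iff.1 hA.evenWith
  obtain ⟨m, hm, M', hM', hχ, hB'⟩ := oddWith_iff.1 hB.oddWith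
  have : Nonempty (Fin n) := ⟨⟨0, hn⟩⟩
  have : Nonempty (Fin m) := ⟨⟨0, hm⟩⟩
  obtain ⟨P, hP⟩ := exists_isParity (map_one_of_map_mul hβ) hM
  have hχ' : ∀ g k, β (S.b (g * k)) + (β' (S.b (g * k)) + t.t (g * k)) =
      β (S.b g) + (β' (S.b g) + t.t g) + (β (S.b k) + (β' (S.b k) + t.t k)) := fun g k => by
    rw [hχ, map_mul, hβ (S.b g) (S.b k), add_add_add_comm]
  -- Under `g ↦ pg` the operator `M g` gains one factor `P` and the exponent of `P` changes by 1, so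
  -- the product descends to `Gb`.
  obtain ⟨W, hW⟩ := exists_descent S
    (fun g => powTwo P (β (S.b g) + (β' (S.b g) + t.t g)) * M g) (by
      intro g
      have h1 : ∀ i, powTwo P (i + 1) * P = powTwo P i := fun i => Subtype.ext <| by
        rw [Matrix.UnitaryGroup.mul_val, coe_powTwo, coe_powTwo, ← powTwo_mul_powTwo hP.mul_self,
          powTwo_one, mul_assoc, hP.mul_self, mul_one]
      rw [hP.left, b_p_mul, t.t_p_mul, ← mul_assoc, ← add_assoc (β' _), ← add_assoc (β _), h1])
  have hWp := hP.isProj hM (c := fun g => β (S.b g) + (β' (S.b g) + t.t g)) hχ'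
  have hWp' : IsProj S.x W (fun g k => α g k + half (β g * β' k) + half (β g * β k)) := by
    intro g k
    obtain ⟨g, rfl⟩ := S.b_surjective g
    obtain ⟨k, rfl⟩ := S.b_surjective k
    rw [hW, hW, ← map_mul, hW]
    refine (hWp g k).trans ?_
    congr 2
    simp only [Invariants.omega, add_assoc, ← half_add]
    congr 2
    grind
  have h := oddBy_stack_even_odd hP hM' hp hA' hB'
  simp only [← hW] at h
  refine Or.inr ⟨rfl, ?_⟩
  simp only [add_assoc]
  refine OddBy.oddWith (M := fun g => kronUnitary (W g) (M' g)) h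
    ((hWp'.kron hM').congr fun g k => ?_) hχ'
  abel

/-- The graded flip reduces this to the even-odd case. It exchanges ½ β ∪ β' and ½ β' ∪ β, which
differ by the coboundary of ½ β β'. -/
theorem HasInvariants.stack_odd_even (hA : HasInvariants t A ⟨α, β, 1⟩)
    (hB : HasInvariants t B ⟨α', β', 0⟩) : HasInvariants t (A.stack B)
      ⟨fun g h => α g h + α' g h + half (β g * β' h) + half (β' g * β' h),
        fun g => β g + β' g, 1⟩ := by
  have hβ := hA.admissible.dβ
  have hβ' := hB.admissible.dβ
  dsimp only at hβ hβ'
  have h := (hasInvariants_congr (eqvIso_stack_comm A B) (hB.stack_even_odd hA)).oddWith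
  refine Or.inr ⟨rfl, ?_⟩
  simp only [add_comm (β' _) (β _)] at h
  refine h.rephase (fun g => half (β g * β' g)) fun g k => ?_
  rw [dOne_half, hβ, hβ']
  dsimp only
  rw [add_comm (α' g k)]
  simp only [add_assoc, ← half_add]
  congr 3
  grind

theorem HasInvariants.stack_odd_odd (hA : HasInvariants t A ⟨α, β, 1⟩)
    (hB : HasInvariants t B ⟨α', β', 1⟩) : HasInvariants t (A.stack B)
      ⟨fun g h => α g h + α' g h + half (β g * β' h), fun g => β g + β' g + S.x g, 0⟩ := by
  have hβ := hA.admissible.dβ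
  have hβ' := hB.admissible.dβ
  have ht := t.map_mul_of_splits (hA.admissible.dγ rfl)
  have hp : β (S.b S.p) + t.t S.p = 1 := chi_p hA.oddWith
  have hp' : β' (S.b S.p) + t.t S.p = 1 := chi_p hB.oddWith
  obtain ⟨n, hn, M, hM, hχ, hA'⟩ := oddWith_iff.1 hA.oddWith
  obtain ⟨m, hm, M', hM', hχ', hB'⟩ := oddWith_iff.1 hB.oddWith
  have : Nonempty (Fin n) := ⟨⟨0, hn⟩⟩
  have : Nonempty (Fin m) := ⟨⟨0, hm⟩⟩
  have h := (evenBy_stack_odd_odd hM hp hM' hp' hA' hB').evenWith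
    (((hM.comp S.b).kron (hM'.comp S.b)).kron (isProj_pauliUnitary hχ hχ'))
  -- The Pauli cocycle exceeds the stated one by half of (x ∪ β + β ∪ x) + (t ∪ β' + β' ∪ t) + (x ∪
  -- t + t ∪ x) + (t ∪ t + x ∪ t). The first three are symmetrized cups, trivialized by products,
  -- and the last is trivialized by the quarter cochain.
  refine Or.inl ⟨rfl, h.rephase (fun g => half (S.x (S.b g) * β (S.b g) + t.t g * β' (S.b g) +
    S.x (S.b g) * t.t g) + quarter (t.t g)) fun g k => ?_⟩
  dsimp only at hβ hβ'
  rw [dOne_add, dOne_half, dOne_quarter _ ht, Invariants.omega]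
  simp only [add_assoc, ← half_add, map_mul, ht, hβ, hβ', x_mul]
  congr 3
  grind

end Law

end

section

/-! ### Full idempotents -/

section Full

variable {R : Type*} [Ring R]

/-- `1` is a sum of elements `c e d`. -/
def IsFull (e : R) : Prop :=
  ∃ (σ : Type) (_ : Fintype σ) (c d : σ → R), ∑ i, c i * e * d i = 1

theorem isFull_iff {e : R} : IsFull e ↔ TwoSidedIdeal.span {e} = ⊤ := by
  constructor
  · rintro ⟨σ, _, c, d, h⟩
    have h1 : (1 : R) ∈ TwoSidedIdeal.span {e} := by
      rw [← h]
      exact sum_mem fun i _ => TwoSidedIdeal.mul_mem_right _ _ _ (TwoSidedIdeal.mul_mem_left _ _ _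
        (TwoSidedIdeal.subset_span rfl))
    rw [eq_top_iff]
    intro x _
    rw [← mul_one x]
    exact TwoSidedIdeal.mul_mem_left _ _ _ h1
  · intro h
    have h1 : (1 : R) ∈ TwoSidedIdeal.span {e} := by rw [h]; trivial
    rw [TwoSidedIdeal.mem_span_iff_mem_addSubgroup_closure] at h1
    refine AddSubgroup.closure_induction
      (p := fun x _ => ∃ (σ : Type) (_ : Fintype σ) (c d : σ → R), ∑ i, c i * e * d i = x)
      ?_ ?_ ?_ ?_ h1
    · rintro _ ⟨_, ⟨c, -, _, rfl, rfl⟩, d, -, rfl⟩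
      exact ⟨Unit, inferInstance, fun _ => c, fun _ => d, by simp⟩
    · exact ⟨Empty, inferInstance, fun _ => 0, fun _ => 0, by simp⟩
    · rintro x y - - ⟨σ, _, c, d, rfl⟩ ⟨τ, _, c', d', rfl⟩
      exact ⟨σ ⊕ τ, inferInstance, Sum.elim c c', Sum.elim d d', by simp⟩
    · rintro x - ⟨σ, _, c, d, rfl⟩
      exact ⟨σ, inferInstance, fun i => -c i, d, by simp⟩

/-- A central element is determined by its component in a full corner. -/
theorem IsFull.central_ext {e : R} (he : IsFull e) {z w : R} (hz : ∀ r, z * r = r * z)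
    (hw : ∀ r, w * r = r * w) (h : z * e = w * e) : z = w := by
  obtain ⟨σ, _, c, d, h1⟩ := he
  rw [← mul_one z, ← mul_one w, ← h1, Finset.mul_sum, Finset.mul_sum]
  refine Finset.sum_congr rfl fun i _ => ?_
  rw [← mul_assoc, ← mul_assoc, hz, ← mul_assoc, ← mul_assoc, hw, mul_assoc (c i), mul_assoc (c i),
    h]
  simp only [mul_assoc]

/-- Central elements of a full corner extend to central elements. -/
theorem IsFull.exists_central {e : R} (he : IsFull e) (hee : e * e = e) {z : R}
    (hz : e * z * e = z) (hc : ∀ r, z * (e * r * e) = e * r * e * z) :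
    ∃ w, (∀ r, w * r = r * w) ∧ w * e = z := by
  obtain ⟨σ, _, c, d, h1⟩ := he
  have hl : e * z = z := by rw [← hz, ← mul_assoc, ← mul_assoc, hee]
  have hr : z * e = z := by rw [← hz, mul_assoc, hee]
  have hc' : ∀ r, z * r * e = e * r * z := fun r => by
    have := hc r
    rwa [← mul_assoc, ← mul_assoc, hr, mul_assoc _ e z, hl] at this
  -- Inserting `∑ c e d = 1` on the other side turns both products with `r` into double sums; they
  -- agree termwise because `z` commutes with each `e (d r c) e`.
  refine ⟨∑ i, c i * z * d i, fun r => ?_, ?_⟩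
  · have e1 : (∑ i, c i * z * d i) * r = ∑ i, ∑ j, c i * z * d i * r * (c j * e * d j) := by
      simp_rw [← Finset.mul_sum, h1, mul_one, Finset.sum_mul]
    have e2 : r * (∑ j, c j * z * d j) = ∑ i, ∑ j, c i * e * d i * r * (c j * z * d j) := by
      simp_rw [← Finset.mul_sum, mul_assoc _ r, ← Finset.sum_mul, h1, one_mul]
    rw [e1, e2]
    refine Finset.sum_congr rfl fun i _ => Finset.sum_congr rfl fun j _ => ?_
    have e3 := congrArg (fun y => c i * y * d j) (hc' (d i * r * c j))
    simpa only [mul_assoc] using e3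
  · rw [Finset.sum_mul]
    have e4 : ∀ i, c i * z * d i * e = c i * e * d i * z := fun i => by
      rw [mul_assoc (c i), mul_assoc (c i), hc' (d i)]
      simp only [mul_assoc]
    simp_rw [e4, ← Finset.sum_mul, h1, one_mul]

/-- Rank-one idempotents that generate the same ideal are equivalent. -/
theorem exists_equivalence [Algebra ℂ R] {E F : R} (hEE : E * E = E) (hFF : F * F = F) (hE₀ : E ≠ 0)
    (hE : ∀ c, ∃ l : ℂ, E * c * E = l • E) (hF : ∀ c, ∃ l : ℂ, F * c * F = l • F)
    (hfull : IsFull F) : ∃ u v, E * u * F = u ∧ F * v * E = v ∧ u * v = E ∧ v * u = F ∧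
      (∀ c, ∃ l : ℂ, E * c * F = l • u) ∧ ∀ c, ∃ l : ℂ, F * c * E = l • v := by
  obtain ⟨σ, _, c, d, h1⟩ := hfull
  -- Expanding `E = E 1 E` through the full idempotent `F`, not every term can vanish. A
  -- nonvanishing term is a scalar multiple of `E` and yields the two partial isomorphisms.
  have h2 : ∃ i, E * (c i * F * d i) * E ≠ 0 := by
    by_contra! h
    apply hE₀
    have h3 : E = E * (∑ i, c i * F * d i) * E := by rw [h1, mul_one, hEE]
    rw [h3, Finset.mul_sum, Finset.sum_mul]
    exact Finset.sum_eq_zero fun i _ => h i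
  obtain ⟨i, hi⟩ := h2
  obtain ⟨l, hl⟩ := hE (c i * F * d i)
  have hl0 : l ≠ 0 := by
    rintro rfl
    rw [zero_smul] at hl
    exact hi hl
  obtain ⟨u, hu⟩ : ∃ u, u = E * c i * F := ⟨_, rfl⟩
  obtain ⟨v, hv⟩ : ∃ v, v = l⁻¹ • (F * d i * E) := ⟨_, rfl⟩
  have hEu : E * u = u := by rw [hu, ← mul_assoc, ← mul_assoc, hEE]
  have huF : u * F = u := by rw [hu, mul_assoc, hFF]
  have hFv : F * v = v := by rw [hv, mul_smul_comm, ← mul_assoc, ← mul_assoc, hFF]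
  have hvE : v * E = v := by rw [hv, smul_mul_assoc, mul_assoc, hEE]
  have huv : u * v = E := by
    have e1 : E * c i * F * (F * d i * E) = E * (c i * F * d i) * E := by
      rw [← mul_assoc, ← mul_assoc, mul_assoc _ F F, hFF]
      simp only [mul_assoc]
    rw [hu, hv, mul_smul_comm, e1, hl, smul_smul, inv_mul_cancel₀ hl0, one_smul]
  have hu0 : u ≠ 0 := by
    rintro rfl
    rw [zero_mul] at huv
    exact hE₀ huv.symm
  have hvu : v * u = F := by
    obtain ⟨m, hm⟩ := hF (v * u)
    rw [← mul_assoc, hFv, mul_assoc, huF] at hm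
    -- The product `v u` is a multiple of `F`; evaluating `u v u` in two ways shows that the factor
    -- is 1.
    have e1 : u = m • u := by
      conv_lhs => rw [← hEu, ← huv, mul_assoc, hm, mul_smul_comm, huF]
    have e2 : m = 1 := by
      have : (1 - m) • u = 0 := by rw [sub_smul, one_smul, ← e1, sub_self]
      rcases smul_eq_zero.1 this with h | h
      · exact (sub_eq_zero.1 h).symm
      · exact absurd h hu0
    rw [hm, e2, one_smul]
  refine ⟨u, v, by rw [hEu, huF], by rw [hFv, hvE], huv, hvu, fun c => ?_, fun c => ?_⟩
  · obtain ⟨m, hm⟩ := hE (c * v)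
    refine ⟨m, ?_⟩
    rw [← hEu, ← smul_mul_assoc, ← hm, ← mul_assoc, mul_assoc _ v E, hvE, mul_assoc _ v u, hvu]
  · obtain ⟨m, hm⟩ := hF (c * u)
    refine ⟨m, ?_⟩
    rw [← hFv, ← smul_mul_assoc, ← hm, ← mul_assoc, mul_assoc _ u F, huF, mul_assoc _ u v, huv]

end Full

end

section

variable {G Gb : Type*} [Group G] [Group Gb] {S : SymmetryClass G Gb}

/-! ### Corners of equivariant algebras -/

/-- Automorphisms and anti-automorphisms alike preserve the centre. -/
theorem act_mul_comm_of_central (C : EquivariantAlgebra S) {z : C.carrier}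
    (hz : ∀ c, z * c = c * z) (g : G) (c : C.carrier) :
    C.act g z * c = c * C.act g z := by
  have h1 : C.act g (C.act g⁻¹ c) = c := by rw [← C.act_mul, mul_inv_cancel, C.act_one]
  have h2 := C.act_map_mul g z (C.act g⁻¹ c)
  have h3 := C.act_map_mul g (C.act g⁻¹ c) z
  rw [h1] at h2 h3
  rw [← hz, h2] at h3
  split_ifs at h3
  · exact h3.symm
  · exact h3

section Corner

variable {A C : EquivariantAlgebra S} {e : C.carrier}

theorem corner_map_one {ι : A.carrier →ₗ[ℂ] C.carrier} (hee : e * e = e)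
    (hm : ∀ a a', ι (a * a') = ι a * ι a') (hr : ∀ c, c ∈ Set.range ι ↔ e * c * e = c) :
    ι 1 = e := by
  obtain ⟨a, ha⟩ := (hr e).2 (by rw [hee, hee])
  have h1 : e * ι 1 * e = ι 1 := (hr _).1 ⟨1, rfl⟩
  rw [← h1, ← ha, ← hm, ← hm, mul_one, hm, ha, hee]

/-- Central involutions of a full corner on which the symmetries act by signs extend. -/
theorem IsFullCorner.extend (h : IsFullCorner A C e) {z : A.carrier} (hz : ∀ a, z * a = a * z)
    (hzz : z * z = 1) {c : G → ZMod 2} (hc : ∀ g, A.act g z = sgn (c g) • z) :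
    ∃ w : C.carrier, (∀ r, w * r = r * w) ∧ w * w = 1 ∧ ∀ g, C.act g w = sgn (c g) • w := by
  obtain ⟨hee, hge, hf, ι, hi, hm, hr, ha⟩ := h
  have hf' := isFull_iff.2 hf
  have h1 := corner_map_one hee hm hr
  obtain ⟨w, hw, hwe⟩ := hf'.exists_central hee (z := ι z) ((hr _).1 ⟨z, rfl⟩) (fun r => by
    obtain ⟨a, ha⟩ := (hr (e * r * e)).2 (by
      rw [← mul_assoc, ← mul_assoc, hee, mul_assoc _ e e, hee])
    rw [← ha, ← hm, hz, hm])
  refine ⟨w, hw, hf'.central_ext (fun r => by rw [mul_assoc, hw, mul_assoc, hw, mul_assoc])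
    (fun r => by rw [one_mul, mul_one]) ?_, fun g => hf'.central_ext
    (act_mul_comm_of_central C hw g) (fun r => by rw [smul_mul_assoc, hw, mul_smul_comm]) ?_⟩
  · have h3 : ι z = e * ι z := by rw [← h1, ← hm, one_mul]
    rw [mul_assoc, hwe, one_mul, h3, ← mul_assoc, hwe, ← hm, hzz, h1]
  · have h2 : C.act g (w * e) = C.act g w * e := by
      rw [C.act_map_mul, hge]
      split_ifs
      · exact (act_mul_comm_of_central C hw g e).symm
      · rfl
    rw [← h2, hwe, ← ha, hc, map_smul, smul_mul_assoc, hwe]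

theorem IsFullCorner.restrict (h : IsFullCorner A C e) {w : C.carrier} (hw : ∀ r, w * r = r * w)
    (hww : w * w = 1) {c : G → ZMod 2} (hc : ∀ g, C.act g w = sgn (c g) • w) :
    ∃ z : A.carrier, (∀ a, z * a = a * z) ∧ z * z = 1 ∧ ∀ g, A.act g z = sgn (c g) • z := by
  obtain ⟨hee, hge, hf, ι, hi, hm, hr, ha⟩ := h
  have h1 := corner_map_one hee hm hr
  obtain ⟨z, hz⟩ := (hr (w * e)).2 (by rw [← mul_assoc, ← hw, mul_assoc, mul_assoc, hee, hee])
  have hwe : w * e * (w * e) = e := by rw [mul_assoc, ← mul_assoc e, ← hw, mul_assoc, hee,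
    ← mul_assoc, hww, one_mul]
  have h2 : ∀ g, C.act g (w * e) = sgn (c g) • (w * e) := fun g => by
    rw [C.act_map_mul, hge, hc, mul_smul_comm, smul_mul_assoc, ← hw, ite_self]
  refine ⟨z, fun a => hi ?_, hi ?_, fun g => hi ?_⟩
  · have h3 : ι a = e * ι a := by rw [← h1, ← hm, one_mul]
    have h4 : ι a = ι a * e := by rw [← h1, ← hm, mul_one]
    rw [hm, hm, hz, mul_assoc, ← h3, ← mul_assoc, ← hw, mul_assoc, ← h4]
  · rw [hm, hz, hwe, h1]
  · rw [ha, hz, h2, map_smul, hz]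

/-- A full corner has the same centre as the whole algebra. A central involution therefore passes
from one corner to the linking algebra and down to the other corner, together with the signs of the
symmetries. -/
theorem MoritaEquivalent.transfer {B : EquivariantAlgebra S} (h : MoritaEquivalent A B)
    {z : A.carrier} (hz : ∀ a, z * a = a * z) (hzz : z * z = 1) {c : G → ZMod 2}
    (hc : ∀ g, A.act g z = sgn (c g) • z) :
    ∃ w : B.carrier, (∀ b, w * b = b * w) ∧ w * w = 1 ∧ ∀ g, B.act g w = sgn (c g) • w := by
  obtain ⟨C, e, hA, hB⟩ := h
  obtain ⟨w, hw, hww, hcw⟩ := hA.extend hz hzz hc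
  exact hB.restrict hw hww hcw

theorem MoritaEquivalent.symm {B : EquivariantAlgebra S} (h : MoritaEquivalent A B) :
    MoritaEquivalent B A := by
  obtain ⟨C, e, hA, hB⟩ := h
  exact ⟨C, 1 - e, hB, by rwa [sub_sub_cancel]⟩

end Corner

/-! ### Matrix corners -/

section MatrixCorner

set_option linter.unusedSectionVars false

variable {ι κ : Type} [Fintype ι] [DecidableEq ι] [Fintype κ] [DecidableEq κ]

/-- The corner `e C e` is equivariantly isomorphic to `End U`. -/
structure MatrixCorner (C : EquivariantAlgebra S) (M : G → Matrix.unitaryGroup ι ℂ)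
    (e : C.carrier) where
  map : Matrix ι ι ℂ →ₗ[ℂ] C.carrier
  injective : Function.Injective map
  map_mul : ∀ N N', map (N * N') = map N * map N'
  map_one : map 1 = e
  exists_eq : ∀ c, ∃ N, e * c * e = map N
  act_map : ∀ g N, C.act g (map N) = map (adAct S (S.b g) (M g) N)

namespace MatrixCorner

variable {C : EquivariantAlgebra S} {M : G → Matrix.unitaryGroup ι ℂ} {e : C.carrier}
  (k : MatrixCorner C M e)

theorem map_unitary' (U : Matrix.unitaryGroup ι ℂ) :
    k.map (star (U : Matrix ι ι ℂ)) * k.map (U : Matrix ι ι ℂ) = e := by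
  rw [← k.map_mul, unitary_star_mul, k.map_one]

theorem mul_map (N : Matrix ι ι ℂ) : e * k.map N = k.map N := by
  have := k.map_mul 1 N
  rwa [one_mul, k.map_one, eq_comm] at this

theorem map_mul_idem (N : Matrix ι ι ℂ) : k.map N * e = k.map N := by
  have := k.map_mul N 1
  rwa [mul_one, k.map_one, eq_comm] at this

/-- A rank-one idempotent in the corner. -/
def rankOne (i : ι) : C.carrier := k.map (Matrix.single i i 1)

theorem rankOne_mul_self (i : ι) : k.rankOne i * k.rankOne i = k.rankOne i := by
  rw [rankOne, ← k.map_mul, Matrix.single_mul_single_same, mul_one]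

theorem rankOne_ne_zero (i : ι) : k.rankOne i ≠ 0 := by
  rw [rankOne, ← k.map.map_zero, k.injective.ne_iff]
  intro h
  have := congrFun (congrFun h i) i
  simp at this

theorem rankOne_corner (i : ι) (c : C.carrier) :
    ∃ l : ℂ, k.rankOne i * c * k.rankOne i = l • k.rankOne i := by
  obtain ⟨N, hN⟩ := k.exists_eq c
  refine ⟨N i i, ?_⟩
  have h1 : k.rankOne i * c * k.rankOne i = k.rankOne i * (e * c * e) * k.rankOne i := by
    have h2 : k.rankOne i * e = k.rankOne i := k.map_mul_idem _
    have h3 : e * k.rankOne i = k.rankOne i := k.mul_map _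
    rw [← mul_assoc, ← mul_assoc, h2, mul_assoc _ e, h3]
  rw [h1, hN, rankOne, ← k.map_mul, ← k.map_mul, ← map_smul, Matrix.single_mul_mul_single,
    Matrix.smul_single]
  simp

/-- The unit of the corner is the sum over `j` of `E_ji E_ii E_ij`, so fullness of the corner
idempotent is inherited. -/
theorem rankOne_isFull (i : ι) (he : IsFull e) : IsFull (k.rankOne i) := by
  obtain ⟨σ, _, c, d, h⟩ := he
  refine ⟨σ × ι, inferInstance, fun q => c q.1 * k.map (Matrix.single q.2 i 1),
    fun q => k.map (Matrix.single i q.2 1) * d q.1, ?_⟩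
  rw [Fintype.sum_prod_type, ← h]
  refine Finset.sum_congr rfl fun s _ => ?_
  have h1 : ∀ j, c s * k.map (Matrix.single j i 1) * k.rankOne i *
      (k.map (Matrix.single i j 1) * d s) = c s * k.map (Matrix.single j j 1) * d s := by
    intro j
    have h2 : k.map (Matrix.single j i 1) * (k.rankOne i * k.map (Matrix.single i j 1)) =
        k.map (Matrix.single j j 1) := by
      rw [rankOne, ← k.map_mul, ← k.map_mul, Matrix.single_mul_single_same,
        Matrix.single_mul_single_same, mul_one, mul_one]
    rw [← h2]
    simp only [mul_assoc]
  simp only [h1]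
  rw [← Finset.sum_mul, ← Finset.mul_sum, ← map_sum, Matrix.sum_single_one, k.map_one]

/-- The diagonal matrix unit is real and self-adjoint, so only conjugation by the unitary is
visible. -/
theorem act_rankOne (i : ι) (g : G) : C.act g (k.rankOne i) =
    k.map (M g) * k.rankOne i * k.map (star (M g : Matrix ι ι ℂ)) := by
  have h : op (S.refl (S.b g)) (S.x (S.b g)) (Matrix.single i i (1 : ℂ)) = Matrix.single i i 1 := by
    have h1 : ∀ y, cj y (Matrix.single i i (1 : ℂ)) = Matrix.single i i 1 := fun y => by
      rw [cj_apply, Matrix.map_single, _root_.map_one]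
    rw [op_of_star, h1]
    rw [Matrix.star_eq_conjTranspose, Matrix.conjTranspose_single, star_one]
  rw [rankOne, k.act_map, adAct, h, k.map_mul, k.map_mul]

end MatrixCorner

end MatrixCorner

end

section

variable {G Gb : Type*} [Group G] [Group Gb] {S : SymmetryClass G Gb}

/-! ### Complementary matrix corners have cohomologous cocycles -/

section Linking

set_option linter.unusedSectionVars false

variable {ι κ : Type} [Fintype ι] [DecidableEq ι] [Fintype κ] [DecidableEq κ]
  {C : EquivariantAlgebra S} {M : G → Matrix.unitaryGroup ι ℂ} {M' : G → Matrix.unitaryGroup κ ℂ}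
  {e f : C.carrier}

namespace MatrixCorner

variable (k : MatrixCorner C M e) (k' : MatrixCorner C M' f)

/-- The off-diagonal elements `X u Y*` and `Y v X*`. -/
def link (u v : C.carrier) (i : ZMod 2) (X : Matrix ι ι ℂ) (Y : Matrix κ κ ℂ) : C.carrier :=
  if i = 1 then k'.map Y * v * k.map (star X) else k.map X * u * k'.map (star Y)

variable {k k'} {u v : C.carrier}

theorem link_zero (X : Matrix ι ι ℂ) (Y : Matrix κ κ ℂ) :
    k.link k' u v 0 X Y = k.map X * u * k'.map (star Y) := rfl

theorem link_one (X : Matrix ι ι ℂ) (Y : Matrix κ κ ℂ) :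
    k.link k' u v 1 X Y = k'.map Y * v * k.map (star X) := rfl

theorem link_phase (i : ZMod 2) (a b : UnitAddCircle) (X : Matrix ι ι ℂ) (Y : Matrix κ κ ℂ) :
    k.link k' u v i (phase a • X) (phase b • Y) =
      phase (twist i (a - b)) • k.link k' u v i X Y := by
  rcases zcases i with rfl | rfl
  · rw [link_zero, link_zero, star_smul, Complex.star_def, star_phase, map_smul, map_smul,
      smul_mul_assoc, smul_mul_smul_comm, ← phase_add, ← sub_eq_add_neg, twist_zero_left]
  · rw [link_one, link_one, star_smul, Complex.star_def, star_phase, map_smul, map_smul,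
      smul_mul_assoc, smul_mul_smul_comm, ← phase_add, ← sub_eq_add_neg, twist_one_left, neg_sub]

theorem link_ne_zero (hu : e * u * f = u) (hv : f * v * e = v) (hu₀ : u ≠ 0) (hv₀ : v ≠ 0)
    (i : ZMod 2) (U : Matrix.unitaryGroup ι ℂ) (V : Matrix.unitaryGroup κ ℂ) :
    k.link k' u v i (U : Matrix ι ι ℂ) (V : Matrix κ κ ℂ) ≠ 0 := by
  intro h
  rcases zcases i with rfl | rfl
  · have := congrArg (fun y => k.map (star (U : Matrix ι ι ℂ)) * y * k'.map (V : Matrix κ κ ℂ)) h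
    simp only [link_zero, mul_zero, zero_mul] at this
    rw [mul_assoc, mul_assoc, k'.map_unitary', ← mul_assoc, ← mul_assoc, k.map_unitary', hu] at this
    exact hu₀ this
  · have := congrArg (fun y => k'.map (star (V : Matrix κ κ ℂ)) * y * k.map (U : Matrix ι ι ℂ)) h
    simp only [link_one, mul_zero, zero_mul] at this
    rw [mul_assoc, mul_assoc, k.map_unitary', ← mul_assoc, ← mul_assoc, k'.map_unitary', hv] at this
    exact hv₀ this

/-- The action on `link i X Y` is determined by the action on `link i 1 1`. -/
theorem act_link {g : G} {i : ZMod 2} {l : ℂ} (hu : e * u * f = u) (hv : f * v * e = v)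
    (hl : C.act g (k.link k' u v i 1 1) = l • k.link k' u v (i + S.refl (S.b g)) (M g) (M' g))
    (he : e * e = e) (hf : f * f = f) (X : Matrix ι ι ℂ) (Y : Matrix κ κ ℂ) :
    C.act g (k.link k' u v i X Y) = l • k.link k' u v (i + S.refl (S.b g))
      ((M g : Matrix ι ι ℂ) * cj (S.x (S.b g)) X) ((M' g : Matrix κ κ ℂ) * cj (S.x (S.b g)) Y) := by
  have heu : e * u = u := by rw [← hu, ← mul_assoc, ← mul_assoc, he]
  have huf : u * f = u := by rw [← hu, mul_assoc, hf]
  have hfv : f * v = v := by rw [← hv, ← mul_assoc, ← mul_assoc, hf]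
  have hve : v * e = v := by rw [← hv, mul_assoc, he]
  have e2 : ∀ y : C.carrier, k'.map (star (M' g : Matrix κ κ ℂ)) *
      (k'.map (M' g) * y) = f * y := fun y => by rw [← mul_assoc, k'.map_unitary']
  have e3 : ∀ y : C.carrier, k.map (star (M g : Matrix ι ι ℂ)) *
      (k.map (M g) * y) = e * y := fun y => by rw [← mul_assoc, k.map_unitary']
  have h3 : k.link k' u v i X Y = if i = 1 then k'.map Y * k.link k' u v i 1 1 * k.map (star X)
      else k.map X * k.link k' u v i 1 1 * k'.map (star Y) := by
    rcases zcases i with rfl | rfl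
    · rw [if_neg (by decide), link_zero, link_zero, star_one, k.map_one, k'.map_one, hu]
    · rw [if_pos rfl, link_one, link_one, star_one, k.map_one, k'.map_one, hv]
  rw [h3]
  rcases zcases i with rfl | rfl <;> rcases zcases (S.refl (S.b g)) with hr | hr <;>
    simp only [hr, zero_add, add_zero, show (1 + 1 : ZMod 2) = 0 from rfl, if_true,
      if_neg (show ¬ ((0 : ZMod 2) = 1) by decide), C.act_map_mul, k.act_map, k'.act_map] at hl ⊢ <;>
    rw [hl] <;>
    simp only [adAct, hr, op, starPow_zero, starPow_one, link_zero, link_one, k.map_mul, k'.map_mul,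
      star_mul, mul_smul_comm, smul_mul_assoc, mul_assoc, cj_star, star_star, e2, e3] <;>
    simp only [← mul_assoc, heu, huf, hfv, hve]

/-- The action on the linking elements, for some signs and absolute values. -/
theorem exists_act_link {E F : C.carrier} (heE : e * E = E) (hEe : E * e = E) (hfF : f * F = F)
    (hFf : F * f = F) (hE₀ : E ≠ 0) (hu : E * u * F = u) (hv : F * v * E = v) (huv : u * v = E)
    (hEF : ∀ c, ∃ l : ℂ, E * c * F = l • u) (hFE : ∀ c, ∃ l : ℂ, F * c * E = l • v) (g : G)
    (hgE : C.act g E = k.map (M g) * E * k.map (star (M g : Matrix ι ι ℂ)))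
    (hgF : C.act g F = k'.map (M' g) * F * k'.map (star (M' g : Matrix κ κ ℂ))) :
    ∃ (L : UnitAddCircle) (ρ : ZMod 2 → ℝ), (∀ i, 0 < ρ i) ∧ ∀ i,
      C.act g (k.link k' u v i 1 1) = ((ρ i : ℂ) * phase (twist (i + S.refl (S.b g)) L)) •
        k.link k' u v (i + S.refl (S.b g)) (M g) (M' g) := by
  have hu' : k.link k' u v 0 1 1 = u := by
    rw [link_zero, star_one, k.map_one, k'.map_one, ← hu]
    simp only [← mul_assoc, heE]
    simp only [mul_assoc, hFf]
  have hv' : k.link k' u v 1 1 1 = v := by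
    rw [link_one, star_one, k.map_one, k'.map_one, ← hv]
    simp only [← mul_assoc, hfF]
    simp only [mul_assoc, hEe]
  have hfv : f * v = v := by rw [← hv]; simp only [← mul_assoc, hfF]
  have hl0 : ∀ w, C.act g w = C.act g E * C.act g w * C.act g F →
      ∃ l : ℂ, C.act g w = l • k.link k' u v 0 (M g) (M' g) := by
    intro w hw
    obtain ⟨l, hl⟩ := hEF (k.map (star (M g : Matrix ι ι ℂ)) * C.act g w * k'.map (M' g))
    refine ⟨l, ?_⟩
    calc C.act g w = k.map (M g) * (E * (k.map (star (M g : Matrix ι ι ℂ)) * C.act g w *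
          k'.map (M' g)) * F) * k'.map (star (M' g : Matrix κ κ ℂ)) := by
          conv_lhs => rw [hw, hgE, hgF]
          simp only [mul_assoc]
      _ = _ := by rw [hl, mul_smul_comm, smul_mul_assoc, link_zero]
  have hl1 : ∀ w, C.act g w = C.act g F * C.act g w * C.act g E →
      ∃ l : ℂ, C.act g w = l • k.link k' u v 1 (M g) (M' g) := by
    intro w hw
    obtain ⟨l, hl⟩ := hFE (k'.map (star (M' g : Matrix κ κ ℂ)) * C.act g w * k.map (M g))
    refine ⟨l, ?_⟩
    calc C.act g w = k'.map (M' g) * (F * (k'.map (star (M' g : Matrix κ κ ℂ)) * C.act g w *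
          k.map (M g)) * E) * k.map (star (M g : Matrix ι ι ℂ)) := by
          conv_lhs => rw [hw, hgE, hgF]
          simp only [mul_assoc]
      _ = _ := by rw [hl, mul_smul_comm, smul_mul_assoc, link_one]
  -- This product will force the scalars on `u` and `v` to be mutually inverse.
  have hprod : k.link k' u v 0 (M g) (M' g) * k.link k' u v 1 (M g) (M' g) = C.act g E := by
    rw [link_zero, link_one, hgE, ← huv]
    have h1 : k'.map (star (M' g : Matrix κ κ ℂ)) * (k'.map (M' g) * v) = v := by
      rw [← mul_assoc, k'.map_unitary', hfv]
    have h2 := congrArg (fun y => k.map (M g) * u * y * k.map (star (M g : Matrix ι ι ℂ))) h1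
    simpa only [mul_assoc] using h2
  have hgE₀ : C.act g E ≠ 0 := by
    intro h
    have h1 := C.act_mul g⁻¹ g E
    rw [inv_mul_cancel, C.act_one, h, map_zero] at h1
    exact hE₀ h1
  have hone : ∀ l : ℂ, C.act g E = l • C.act g E → l = 1 := by
    intro l hl
    have h1 : (1 - l) • C.act g E = 0 := by rw [sub_smul, one_smul, ← hl, sub_self]
    exact ((sub_eq_zero.1 ((smul_eq_zero.1 h1).resolve_right hgE₀))).symm
  obtain ⟨l, m, hl, hm, hlm⟩ : ∃ l m : ℂ, C.act g u = l • k.link k' u v (S.refl (S.b g)) (M g) (M' g) ∧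
      C.act g v = m • k.link k' u v (1 + S.refl (S.b g)) (M g) (M' g) ∧ l * m = 1 := by
    rcases zcases (S.refl (S.b g)) with hr | hr
    · have hT : ∀ a b, C.act g (a * b) = C.act g a * C.act g b := fun a b => by
        rw [C.act_map_mul, hr, if_neg (by decide)]
      obtain ⟨l, hl⟩ := hl0 u (by rw [← hT, ← hT, hu])
      obtain ⟨m, hm⟩ := hl1 v (by rw [← hT, ← hT, hv])
      refine ⟨l, m, by rw [hr, hl], by rw [hr, hm, add_zero], hone _ ?_⟩
      conv_lhs => rw [← huv, hT, hl, hm, smul_mul_smul_comm, hprod]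
    -- An anti-automorphism exchanges the two off-diagonal corners, so `u` and `v` trade places.
    · have hT : ∀ a b, C.act g (a * b) = C.act g b * C.act g a := fun a b => by
        rw [C.act_map_mul, hr, if_pos rfl]
      obtain ⟨l, hl⟩ := hl1 u (by rw [mul_assoc, ← hT, ← hT, hu])
      obtain ⟨m, hm⟩ := hl0 v (by rw [mul_assoc, ← hT, ← hT, hv])
      refine ⟨l, m, by rw [hr, hl], by rw [hr, hm]; rfl, hone _ ?_⟩
      conv_lhs => rw [← huv, hT, hl, hm, smul_mul_smul_comm, hprod, mul_comm]
  have hl₀ : l ≠ 0 := left_ne_zero_of_mul_eq_one hlm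
  obtain ⟨a, ha⟩ := exists_norm_mul_phase hl₀
  have hρ : 0 < ‖l‖ := norm_pos_iff.2 hl₀
  -- The scalars are `l` on `u` and `l⁻¹` on `v`. Recording the phase with the twist by `refl`
  -- describes both by the single formula `twist (i + refl) L`.
  refine ⟨twist (S.refl (S.b g)) a, fun i => if i = 1 then ‖l‖⁻¹ else ‖l‖, fun i => ?_, fun i => ?_⟩
  · dsimp only
    split_ifs
    · exact inv_pos.2 hρ
    · exact hρ
  · dsimp only
    rw [twist_twist, add_assoc, CharTwo.add_self_eq_zero, add_zero]
    rcases zcases i with rfl | rfl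
    · rw [if_neg zero_ne_one, twist_zero_left, ← ha, zero_add, hu', hl]
    · have hm' : m = l⁻¹ := eq_inv_of_mul_eq_one_right hlm
      rw [if_pos rfl, twist_one_left, hv', hm, hm']
      conv_lhs => rw [ha]
      rw [mul_inv, phase_neg, Complex.ofReal_inv]

/-- Complementary matrix corners have cohomologous cocycles. -/
theorem exists_cochain [Nonempty ι] [Nonempty κ] (k : MatrixCorner C M e) (k' : MatrixCorner C M' f)
    (hf : IsFull f) {ω ω' : G → G → UnitAddCircle} (hM : IsProj (fun g => S.x (S.b g)) M ω)
    (hM' : IsProj (fun g => S.x (S.b g)) M' ω') :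
    ∃ L : G → UnitAddCircle, ∀ g h, ω g h - ω' g h = dOne (fun g => S.x (S.b g)) L g h := by
  obtain ⟨i₀⟩ := ‹Nonempty ι›
  obtain ⟨j₀⟩ := ‹Nonempty κ›
  have hee : e * e = e := by
    have := k.map_mul 1 1
    rwa [one_mul, k.map_one, eq_comm] at this
  have hff : f * f = f := by
    have := k'.map_mul 1 1
    rwa [one_mul, k'.map_one, eq_comm] at this
  obtain ⟨u, v, hu, hv, huv, hvu, hEF, hFE⟩ := exists_equivalence (k.rankOne_mul_self i₀)
    (k'.rankOne_mul_self j₀) (k.rankOne_ne_zero i₀) (k.rankOne_corner i₀) (k'.rankOne_corner j₀)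
    (k'.rankOne_isFull j₀ hf)
  have heE : e * k.rankOne i₀ = k.rankOne i₀ := k.mul_map _
  have hEe : k.rankOne i₀ * e = k.rankOne i₀ := k.map_mul_idem _
  have hfF : f * k'.rankOne j₀ = k'.rankOne j₀ := k'.mul_map _
  have hFf : k'.rankOne j₀ * f = k'.rankOne j₀ := k'.map_mul_idem _
  have hu' : e * u * f = u := by
    rw [← hu]
    simp only [← mul_assoc, heE]
    simp only [mul_assoc, hFf]
  have hv' : f * v * e = v := by
    rw [← hv]
    simp only [← mul_assoc, hfF]
    simp only [mul_assoc, hEe]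
  have hu₀ : u ≠ 0 := by
    rintro rfl
    rw [zero_mul] at huv
    exact k.rankOne_ne_zero i₀ huv.symm
  have hv₀ : v ≠ 0 := by
    rintro rfl
    rw [mul_zero] at huv
    exact k.rankOne_ne_zero i₀ huv.symm
  have hL := fun g => exists_act_link (k := k) (k' := k') heE hEe hfF hFf (k.rankOne_ne_zero i₀)
    hu hv huv hEF hFE g (k.act_rankOne i₀ g) (k'.act_rankOne j₀ g)
  choose L ρ hρ hL using hL
  have hact := fun g i X Y => act_link hu' hv' (hL g i) hee hff X Y
  -- The comparison below gives ω − ω' as minus the coboundary of `L`, hence the sign.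
  refine ⟨fun g => -L g, fun g h => ?_⟩
  -- The action of `gh` on the same linking element is computed directly and as `g` after `h`; the
  -- latter brings in the ratio of the two cocycles.
  have h1 := hL (g * h) 0
  rw [C.act_mul, hL h 0, LinearMap.map_smulₛₗ, hact] at h1
  have hMM : (M g : Matrix ι ι ℂ) * cj (S.x (S.b g)) (M h) = phase (ω g h) • (M (g * h) : Matrix ι ι ℂ) :=
    hM g h
  have hMM' : (M' g : Matrix κ κ ℂ) * cj (S.x (S.b g)) (M' h) =
    phase (ω' g h) • (M' (g * h) : Matrix κ κ ℂ) := hM' g h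
  have hr : S.refl (S.b (g * h)) = S.refl (S.b h) + S.refl (S.b g) := by
    rw [_root_.map_mul, S.refl_mul, add_comm]
  rw [hMM, hMM', link_phase, smul_smul, smul_smul, zero_add, zero_add, ← hr] at h1
  have h2 := smul_left_injective ℂ (link_ne_zero hu' hv' hu₀ hv₀ _ _ _) h1
  rw [scal_eq, _root_.map_mul, conjPow_phase, ← x_add_refl] at h2
  have h3 : ∀ i (r : ℝ), conjPow i (r : ℂ) = r := fun i r => by
    rcases zcases i with rfl | rfl
    · rfl
    · exact Complex.conj_ofReal r
  have h4 : ((ρ h 0 * ρ g (S.refl (S.b h)) : ℝ) : ℂ) * phase (twist (S.x (S.b g) + S.refl (S.b g))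
      (twist (S.refl (S.b h)) (L h)) + twist (S.refl (S.b (g * h))) (L g) +
      twist (S.refl (S.b (g * h))) (ω g h - ω' g h)) =
      (ρ (g * h) 0 : ℂ) * phase (twist (S.refl (S.b (g * h))) (L (g * h))) := by
    rw [← h2, h3, phase_add, phase_add, Complex.ofReal_mul]
    ring
  -- The moduli are real, hence fixed by conjugation, and drop out.
  have h5 := eq_of_pos_mul_phase (mul_pos (hρ _ _) (hρ _ _)) (hρ _ _) h4
  have h6 := congrArg (twist (S.refl (S.b (g * h)))) h5
  simp only [twist_add, twist_twist, CharTwo.add_self_eq_zero, twist_zero_left] at h6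
  -- The twists caused by exchanging off-diagonal corners cancel against the part of `anti` not
  -- contained in `x`, so the coboundary is twisted by `x` alone.
  have h7 : S.refl (S.b (g * h)) + (S.x (S.b g) + S.refl (S.b g) + S.refl (S.b h)) =
      S.x (S.b g) := by rw [hr]; grind
  rw [h7] at h6
  rw [dOne_neg, dOne, ← h6]
  abel

end MatrixCorner

end Linking

end

section

variable {G Gb : Type*} [Group G] [Group Gb] {S : SymmetryClass G Gb}

/-! ### Morita equivalent algebras have equivalent invariants -/

section CornersOfSRE

set_option linter.unusedSectionVars false

variable {ι : Type} [Fintype ι] [DecidableEq ι] {A C : EquivariantAlgebra S} {e : C.carrier}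

theorem IsFullCorner.isFull (h : IsFullCorner A C e) : IsFull e := isFull_iff.2 h.2.2.1

theorem IsFullCorner.nonempty_matrixCorner (h : IsFullCorner A C e)
    {M : G → Matrix.unitaryGroup ι ℂ} (hA : EvenBy A M) : Nonempty (MatrixCorner C M e) := by
  obtain ⟨hee, hge, hf, k, hi, hm, hr, ha⟩ := h
  obtain ⟨φ, hφ⟩ := hA
  refine ⟨⟨k.comp φ.symm.toLinearMap, hi.comp φ.symm.injective, fun N N' => ?_, ?_, fun c => ?_,
    fun g N => ?_⟩⟩
  · change k (φ.symm (N * N')) = k (φ.symm N) * k (φ.symm N')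
    rw [map_mul, hm]
  · change k (φ.symm 1) = e
    rw [map_one, corner_map_one hee hm hr]
  · obtain ⟨a, ha⟩ := (hr (e * c * e)).2 (by
      rw [← mul_assoc, ← mul_assoc, hee, mul_assoc _ e e, hee])
    refine ⟨φ a, ?_⟩
    change _ = k (φ.symm (φ a))
    rw [φ.symm_apply_apply, ha]
  · change C.act g (k (φ.symm N)) = k (φ.symm _)
    rw [← ha]
    congr 1
    rw [φ.eq_symm_apply, hφ, φ.apply_symm_apply]

namespace EquivariantAlgebra

variable (A) in
/-- The subalgebra of elements fixed by fermion parity. -/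
def evenSubalgebra : Subalgebra ℂ A.carrier where
  carrier := {a | A.parity a = a}
  mul_mem' {a a'} ha ha' := by
    change A.parity (a * a') = a * a'
    rw [A.parity_mul, ha, ha']
  add_mem' {a a'} ha ha' := by
    change A.parity (a + a') = a + a'
    rw [map_add, ha, ha']
  algebraMap_mem' r := by
    change A.parity (algebraMap ℂ _ r) = algebraMap ℂ _ r
    rw [Algebra.algebraMap_eq_smul_one, map_smul, A.parity_one]

variable (A) in
/-- The even part of an equivariant algebra. -/
def evenPart : EquivariantAlgebra S where
  carrier := A.evenSubalgebra
  act g :=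
    { toFun := fun a => ⟨A.act g a, by
        change A.parity (A.act g a) = A.act g a
        rw [A.parity_act]
        exact congrArg _ a.2⟩
      map_add' := fun a a' => Subtype.ext (map_add _ _ _)
      map_smul' := fun c a => Subtype.ext (LinearMap.map_smulₛₗ _ _ _) }
  act_one a := Subtype.ext (A.act_one a)
  act_mul g h a := Subtype.ext (A.act_mul g h a)
  act_map_one g := Subtype.ext (A.act_map_one g)
  act_map_mul g a a' := Subtype.ext <| by
    refine (A.act_map_mul g a a').trans ?_
    split_ifs <;> rfl

end EquivariantAlgebra

/-- An idempotent stays full in the even part if its corner has an odd unit. -/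
theorem IsFull.evenPart (he : IsFull e) (hp : e ∈ C.evenSubalgebra) {Γ : C.carrier}
    (hΓ : C.parity Γ = -Γ) (hΓe : Γ * e * Γ = e) : IsFull (R := C.evenSubalgebra) ⟨e, hp⟩ := by
  obtain ⟨σ, _, c, d, h1⟩ := he
  have hc : ∀ i, (1 / 2 : ℂ) • (c i + C.parity (c i)) ∈ C.evenSubalgebra :=
    fun i => C.mem_deg_zero.1 (C.half_add_mem _)
  have hd : ∀ i, (1 / 2 : ℂ) • (d i + C.parity (d i)) ∈ C.evenSubalgebra :=
    fun i => C.mem_deg_zero.1 (C.half_add_mem _)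
  have hc' : ∀ i, (1 / 2 : ℂ) • (c i - C.parity (c i)) * Γ ∈ C.evenSubalgebra := fun i => by
    change C.parity _ = _
    rw [C.parity_mul, C.mem_deg_one.1 (C.half_sub_mem _), hΓ, neg_mul_neg]
  have hd' : ∀ i, Γ * (1 / 2 : ℂ) • (d i - C.parity (d i)) ∈ C.evenSubalgebra := fun i => by
    change C.parity _ = _
    rw [C.parity_mul, C.mem_deg_one.1 (C.half_sub_mem _), hΓ, neg_mul_neg]
  -- The even part of `∑ c e d = 1` consists of even-even and odd-odd terms. In the latter, `Γ e Γ =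
  -- e` lets one Γ be attached to each odd coefficient, making it even.
  refine ⟨σ ⊕ σ, inferInstance, Sum.elim (fun i => ⟨_, hc i⟩) (fun i => ⟨_, hc' i⟩),
    Sum.elim (fun i => ⟨_, hd i⟩) (fun i => ⟨_, hd' i⟩), Subtype.ext ?_⟩
  have hpe : C.parity e = e := hp
  have h2 : ∀ i, (1 / 2 : ℂ) • (c i + C.parity (c i)) * e * (1 / 2 : ℂ) • (d i + C.parity (d i)) +
      (1 / 2 : ℂ) • (c i - C.parity (c i)) * Γ * e * (Γ * (1 / 2 : ℂ) • (d i - C.parity (d i))) =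
      (1 / 2 : ℂ) • (c i * e * d i + C.parity (c i * e * d i)) := by
    intro i
    have h3 : ∀ a b : C.carrier, a * Γ * e * (Γ * b) = a * e * b := fun a b => by
      have h4 := congrArg (fun y => a * y * b) hΓe
      simpa only [mul_assoc] using h4
    rw [h3, C.parity_mul, C.parity_mul, hpe]
    simp only [smul_mul_assoc, mul_smul_comm, add_mul, sub_mul, mul_add, mul_sub]
    module
  have h5 : ∑ i, (1 / 2 : ℂ) • (c i * e * d i + C.parity (c i * e * d i)) = 1 := by
    rw [← Finset.smul_sum, Finset.sum_add_distrib, ← map_sum, h1, C.parity_one]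
    module
  rw [Fintype.sum_sum_type, ← Finset.sum_add_distrib]
  refine Eq.trans ?_ h5
  refine (AddSubmonoidClass.coe_finsetSum _ _).trans (Finset.sum_congr rfl fun i _ => ?_)
  exact h2 i

/-- On `M_n × M_n` fermion parity is the exchange of factors, so the even part is the diagonal
`M_n`. The image of Γ is an odd unit of the corner, which keeps the idempotent full in the even
part. The comparison of α for odd algebras thus reduces to matrix corners. -/
theorem IsFullCorner.exists_evenPart (h : IsFullCorner A C e) {M : Gb → Matrix.unitaryGroup ι ℂ}
    {ω : Gb → Gb → UnitAddCircle} (hM : IsProj S.x M ω) {χ : G → ZMod 2} (hχ : χ S.p = 1)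
    (hA : OddBy A (fun g => M (S.b g)) χ) : ∃ hp : e ∈ C.evenSubalgebra,
      IsFull (R := C.evenPart.carrier) ⟨e, hp⟩ ∧
      Nonempty (MatrixCorner C.evenPart (fun g => M (S.b g)) ⟨e, hp⟩) := by
  have hfull := h.isFull
  obtain ⟨hee, hge, hf, k, hi, hm, hr, ha⟩ := h
  obtain ⟨φ, hφ⟩ := hA
  have h1 := corner_map_one hee hm hr
  have hsw : ∀ a, φ (A.act S.p a) = (φ a).swap := fun a => by
    have h2 : ∀ N, adAct S (S.b S.p) (M (S.b S.p)) N = N := by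
      intro N
      have := adAct_group_one (hM.comp S.b) N
      rwa [S.b_p, ← map_one S.b]
    rw [hφ, hχ, oddAct_one_right, h2, h2]
    rfl
  have hp : e ∈ C.evenSubalgebra := hge S.p
  have hk : ∀ N, k (φ.symm (N, N)) ∈ C.evenSubalgebra := fun N => by
    change C.act S.p _ = _
    rw [← ha]
    congr 1
    rw [φ.eq_symm_apply, hsw, φ.apply_symm_apply]
    rfl
  refine ⟨hp, hfull.evenPart hp (Γ := k (φ.symm (1, -1))) ?_ ?_, ⟨⟨?_, ?_, ?_, ?_, ?_, ?_⟩⟩⟩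
  · change C.act S.p _ = _
    rw [← ha, ← map_neg]
    congr 1
    rw [← map_neg, φ.eq_symm_apply, hsw, φ.apply_symm_apply]
    simp
  · rw [← h1, ← hm, ← hm, mul_one, ← map_mul, Prod.mk_mul_mk, one_mul, neg_mul_neg, one_mul]
    exact congrArg k (map_one φ.symm)
  · exact
      { toFun := fun N => ⟨k (φ.symm (N, N)), hk N⟩
        map_add' := fun N N' => Subtype.ext <| by
          change k (φ.symm (N + N', N + N')) = k (φ.symm (N, N)) + k (φ.symm (N', N'))
          rw [← map_add, ← map_add]
          rfl
        map_smul' := fun c N => Subtype.ext <| by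
          change k (φ.symm (c • N, c • N)) = c • k (φ.symm (N, N))
          rw [← map_smul, ← map_smul]
          rfl }
  · intro N N' hN
    have h2 := φ.symm.injective (hi (congrArg Subtype.val hN))
    exact congrArg Prod.fst h2
  · intro N N'
    refine Subtype.ext ?_
    change k (φ.symm (N * N', N * N')) = k (φ.symm (N, N)) * k (φ.symm (N', N'))
    rw [← hm, ← map_mul]
    rfl
  · refine Subtype.ext ?_
    change k (φ.symm 1) = e
    rw [map_one, h1]
  · rintro ⟨c, hc⟩
    obtain ⟨a, ha'⟩ := (hr (e * c * e)).2 (by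
      rw [← mul_assoc, ← mul_assoc, hee, mul_assoc _ e e, hee])
    have h2 : A.act S.p a = a := hi (by
      rw [ha, ha']
      change C.parity _ = _
      rw [C.parity_mul, C.parity_mul]
      have h3 : C.parity e = e := hp
      have h4 : C.parity c = c := hc
      rw [h3, h4])
    have h5 := hsw a
    rw [h2] at h5
    refine ⟨(φ a).1, Subtype.ext ?_⟩
    change e * c * e = k (φ.symm ((φ a).1, (φ a).1))
    have h6 : ((φ a).1, (φ a).1) = φ a := Prod.ext rfl (congrArg Prod.fst h5)
    rw [h6, φ.symm_apply_apply, ha']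
  · intro g N
    refine Subtype.ext ?_
    change C.act g (k (φ.symm (N, N))) = k (φ.symm (adAct S _ _ N, adAct S _ _ N))
    rw [← ha]
    congr 1
    rw [φ.eq_symm_apply, hφ, φ.apply_symm_apply]
    rcases zcases (χ g) with h | h <;> rw [h] <;> rfl

end CornersOfSRE

/-! ### Central involutions and their signs -/

section Signs

set_option linter.unusedSectionVars false

variable {ι : Type} [Fintype ι] [DecidableEq ι] [Nonempty ι] {A : EquivariantAlgebra S}

theorem exists_eq_smul_one {N : Matrix ι ι ℂ} (hN : ∀ N', N * N' = N' * N) :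
    ∃ l : ℂ, N = l • (1 : Matrix ι ι ℂ) := by
  obtain ⟨l, hl⟩ := Matrix.mem_range_scalar_iff_commute_single'.2 fun i j => (hN _).symm
  exact ⟨l, by rw [← hl, Matrix.scalar_apply, Matrix.smul_one_eq_diagonal]⟩

/-- There is no odd central involution in an even algebra. -/
theorem EvenBy.not_central_odd {M : G → Matrix.unitaryGroup ι ℂ} (h : EvenBy A M) {w : A.carrier}
    (hw : ∀ a, w * a = a * w) (hww : w * w = 1) (hp : A.act S.p w = -w) : False := by
  obtain ⟨φ, hφ⟩ := h
  obtain ⟨l, hl⟩ := exists_eq_smul_one (N := φ w) fun N => by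
    obtain ⟨a, rfl⟩ := φ.surjective N
    rw [← map_mul, hw, map_mul]
  have h1 := hφ S.p w
  rw [hp, hl, adAct_smul, adAct_one, S.scal_b_p, map_neg, hl, RingHom.id_apply, ← hl] at h1
  have h2 : φ w = 0 := by
    have h4 : (2 : ℂ) • φ w = 0 := by
      rw [two_smul]
      nth_rewrite 1 [← h1]
      exact neg_add_cancel _
    exact (smul_eq_zero.1 h4).resolve_left two_ne_zero
  have h3 := congrArg φ hww
  rw [map_mul, h2, mul_zero, map_one] at h3
  exact zero_ne_one h3

/-- An odd central involution is `(l, -l)` with `l = ±1`, i.e. Γ up to sign, so its character is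
that of Γ. -/
theorem OddBy.sign_eq {M : Gb → Matrix.unitaryGroup ι ℂ} {ω : Gb → Gb → UnitAddCircle}
    (hM : IsProj S.x M ω) {χ : G → ZMod 2} (hχ : χ S.p = 1)
    (h : OddBy A (fun g => M (S.b g)) χ) {w : A.carrier}
    (hw : ∀ a, w * a = a * w) (hww : w * w = 1) {c : G → ZMod 2} (hcp : c S.p = 1)
    (hc : ∀ g, A.act g w = sgn (c g) • w) : c = χ := by
  obtain ⟨φ, hφ⟩ := h
  have hcomm : ∀ y, φ w * y = y * φ w := fun y => by
    obtain ⟨a, rfl⟩ := φ.surjective y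
    rw [← map_mul, hw, map_mul]
  obtain ⟨l, hl⟩ := exists_eq_smul_one (N := (φ w).1) fun N =>
    congrArg Prod.fst (hcomm (N, 0))
  have hdeg := odd_of_mem_deg hχ hM hφ ((A.mem_deg_one (a := w)).2 (by
    rw [A.parity_apply, hc, hcp, sgn_one, neg_one_smul]))
  rw [sgn_one, hl] at hdeg
  have hll : l * l = 1 := by
    have h1 := congrArg Prod.fst (congrArg φ hww)
    rw [map_mul, map_one, Prod.fst_mul, hl, smul_mul_smul_comm, mul_one, Prod.fst_one] at h1
    obtain ⟨i⟩ := ‹Nonempty ι›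
    have h2 := congrFun (congrFun h1 i) i
    simpa using h2
  have hl₀ : l ≠ 0 := left_ne_zero_of_mul_eq_one hll
  have hls : ∀ g, S.scal (S.b g) l = l := fun g => by
    rcases mul_self_eq_one_iff.1 hll with h | h <;> rw [h] <;> simp
  funext g
  have h1 := congrArg Prod.fst (hφ g w)
  rw [hc, map_smul, Prod.smul_fst, hl, hdeg, oddAct, adAct_smul, adAct_smul, adAct_smul, adAct_one,
    hls, map_neg, map_one] at h1
  have h2 : (swapPow (χ g) (l • (1 : Matrix ι ι ℂ), (-1 : ℂ) • l • (1 : Matrix ι ι ℂ))).1 =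
      sgn (χ g) • l • (1 : Matrix ι ι ℂ) := by
    rcases zcases (χ g) with h | h <;> rw [h]
    · rw [swapPow_zero, sgn_zero, one_smul]
    · rw [swapPow_one, sgn_one]; rfl
  rw [h2] at h1
  have h3 : l • (1 : Matrix ι ι ℂ) ≠ 0 := smul_ne_zero hl₀ one_ne_zero
  exact sgn_injective (smul_left_injective ℂ h3 h1)

end Signs

/-! ### Invariants as Morita invariants -/

section Equivalence

variable {t : S.Trivialization} {A B : EquivariantAlgebra S} {I J : Invariants Gb}

theorem OddBy.exists_central {ι : Type} [Fintype ι] [DecidableEq ι]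
    {M : G → Matrix.unitaryGroup ι ℂ} {χ : G → ZMod 2} (h : OddBy A M χ) :
    ∃ z : A.carrier, (∀ a, z * a = a * z) ∧ z * z = 1 ∧ ∀ g, A.act g z = sgn (χ g) • z := by
  obtain ⟨φ, hφ⟩ := h
  refine ⟨φ.symm (1, -1), fun a => φ.injective ?_, φ.injective ?_, fun g => φ.injective ?_⟩
  · rw [map_mul, map_mul, φ.apply_symm_apply]
    ext1 <;> simp
  · rw [map_mul, φ.apply_symm_apply, map_one]
    ext1 <;> simp
  · rw [hφ, map_smul, φ.apply_symm_apply, oddAct, adAct_neg, adAct_one]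
    rcases zcases (χ g) with h | h <;> rw [h]
    · rw [swapPow_zero, sgn_zero, one_smul]
    · rw [swapPow_one, sgn_one, neg_one_smul]
      simp

/-- The central involution Γ is odd and would transfer to the even algebra, whose centre consists of
scalars fixed by parity. -/
theorem MoritaEquivalent.not_odd_even {α : Gb → Gb → UnitAddCircle} {χ : G → ZMod 2}
    {ω : G → G → UnitAddCircle} (h : MoritaEquivalent A B) (hA : OddWith A α χ) (hp : χ S.p = 1)
    (hB : EvenWith B ω) : False := by
  obtain ⟨n, hn, M, hM, hχ, hA⟩ := oddWith_iff.1 hA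
  obtain ⟨m, hm, M', hM', hB⟩ := evenWith_iff.1 hB
  have : Nonempty (Fin m) := ⟨⟨0, hm⟩⟩
  obtain ⟨z, hz, hzz, hcz⟩ := hA.exists_central
  obtain ⟨w, hw, hww, hcw⟩ := h.transfer hz hzz hcz
  exact hB.not_central_odd hw hww (by rw [hcw, hp, sgn_one, neg_one_smul])

/-- Evaluating at `p` shows that `L(pg) - L(g)` is a constant of order at most two. Subtracting the
relations at `(g, 1)` and `(g, p)` then cancels `L` and leaves ½ β on each side. -/
theorem beta_eq_of_cochain (hI : ∀ g h, I.β (g * h) = I.β g + I.β h)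
    (hJ : ∀ g h, J.β (g * h) = J.β g + J.β h) {L : G → UnitAddCircle}
    (hL : ∀ g h, I.omega t g h - J.omega t g h = dOne (fun g => S.x (S.b g)) L g h) : I.β = J.β := by
  have hI1 := map_one_of_map_mul hI
  have hJ1 := map_one_of_map_mul hJ
  simp only [Invariants.omega, dOne] at hL
  have h1 : ∀ h, I.α 1 (S.b h) - J.α 1 (S.b h) = L 1 := fun h => by
    have := hL 1 h
    rw [map_one, hI1, hJ1, zero_mul, half_zero, x_one, twist_zero_left, one_mul] at this
    simpa using this
  have h2 : ∀ h, L 1 = L h - L (S.p * h) + L S.p := fun h => by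
    have := hL S.p h
    rw [S.b_p, hI1, hJ1, zero_mul, half_zero, x_one, twist_zero_left] at this
    rw [← this, ← h1 h]
    abel
  have h3 : L 1 - L S.p + (L 1 - L S.p) = 0 := by
    have := h2 S.p
    rw [S.p_mul_p] at this
    rw [← sub_eq_zero.2 this]
    abel
  obtain ⟨i, hi⟩ := exists_half h3
  funext k
  obtain ⟨g, rfl⟩ := S.b_surjective k
  have h4 := hL g 1
  have h5 := hL g S.p
  rw [map_one, t.t_one, mul_zero, mul_zero, half_zero, mul_one] at h4
  rw [S.b_p, t.t_p, mul_one, mul_one, ← S.p_central] at h5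
  have h6 : L S.p = L 1 + half i := by rw [← neg_half i, ← hi]; abel
  have h7 := h2 g
  have h8 : half (I.β (S.b g)) = half (J.β (S.b g)) := by
    rw [h6, twist_add, twist_half] at h5
    rw [← sub_eq_zero]
    rw [h6] at h7
    have h9 : half (I.β (S.b g)) - half (J.β (S.b g)) =
      (I.α (S.b g) 1 + half (I.β (S.b g)) - (J.α (S.b g) 1 + half (J.β (S.b g)))) -
      (I.α (S.b g) 1 + 0 - (J.α (S.b g) 1 + 0)) := by abel
    rw [h9, h5, h4]
    have h10 : L (S.p * g) = L g + half i := by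
      rw [← sub_eq_zero, ← sub_eq_zero.2 h7]
      abel
    rw [h10]
    abel
  exact half_injective h8

/-- For two even algebras the linking cochain yields `β` and α together. For two odd ones `β` is
read from the signs on Γ, and α from the even parts of the corners. Mixed parities are excluded by
the central involution. -/
theorem MoritaEquivalent.equivalent (h : MoritaEquivalent A B) (hA : HasInvariants t A I)
    (hB : HasInvariants t B J) : I.Equivalent S J := by
  have hIβ := hA.admissible.dβ
  have hJβ := hB.admissible.dβ
  rcases hA with ⟨hI, hA⟩ | ⟨hI, hA⟩ <;> rcases hB with ⟨hJ, hB⟩ | ⟨hJ, hB⟩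
  · obtain ⟨n, hn, M, hM, hA⟩ := evenWith_iff.1 hA
    obtain ⟨m, hm, M', hM', hB⟩ := evenWith_iff.1 hB
    have : Nonempty (Fin n) := ⟨⟨0, hn⟩⟩
    have : Nonempty (Fin m) := ⟨⟨0, hm⟩⟩
    obtain ⟨C, e, hAC, hBC⟩ := h
    obtain ⟨k⟩ := hAC.nonempty_matrixCorner hA
    obtain ⟨k'⟩ := hBC.nonempty_matrixCorner hB
    obtain ⟨L, hL⟩ := k.exists_cochain k' hBC.isFull hM hM'
    have hβ := beta_eq_of_cochain hIβ hJβ hL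
    refine ⟨hβ, hI.trans hJ.symm, L, fun g h => ?_⟩
    rw [← hL, Invariants.omega, Invariants.omega, hβ]
    abel
  · exact (h.symm.not_odd_even hB (chi_p hB) hA).elim
  · exact (h.not_odd_even hA (chi_p hA) hB).elim
  · have hp := chi_p hA
    have hp' := chi_p hB
    obtain ⟨n, hn, M, hM, hχ, hA⟩ := oddWith_iff.1 hA
    obtain ⟨m, hm, M', hM', hχ', hB⟩ := oddWith_iff.1 hB
    have : Nonempty (Fin n) := ⟨⟨0, hn⟩⟩
    have : Nonempty (Fin m) := ⟨⟨0, hm⟩⟩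
    obtain ⟨z, hz, hzz, hcz⟩ := hA.exists_central
    obtain ⟨w, hw, hww, hcw⟩ := h.transfer hz hzz hcz
    have hsign := hB.sign_eq hM' hp' hw hww hp hcw
    obtain ⟨C, e, hAC, hBC⟩ := h
    obtain ⟨hpe, _, ⟨k⟩⟩ := hAC.exists_evenPart hM hp hA
    obtain ⟨hpf, hf, ⟨k'⟩⟩ := hBC.exists_evenPart hM' hp' hB
    obtain ⟨L, hL⟩ := k.exists_cochain k' hf (hM.comp S.b) (hM'.comp S.b)
    refine ⟨funext fun x => ?_, hI.trans hJ.symm, L, hL⟩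
    obtain ⟨g, rfl⟩ := S.b_surjective x
    exact add_right_cancel (congrFun hsign g)

end Equivalence

end

section

variable {G Gb : Type*} [Group G] [Group Gb] {S : SymmetryClass G Gb}

/-! ### Algebras with equivalent invariants are Morita equivalent -/

section Blocks

set_option linter.unusedSectionVars false

variable {ι κ : Type} [Fintype ι] [DecidableEq ι] [Fintype κ] [DecidableEq κ]

theorem adAct_fromBlocks (g : Gb) (U : Matrix.unitaryGroup ι ℂ) (V : Matrix.unitaryGroup κ ℂ)
    (N : Matrix ι ι ℂ) (N' : Matrix κ κ ℂ) :
    adAct S g (blockUnitary U V) (Matrix.fromBlocks N 0 0 N') =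
      Matrix.fromBlocks (adAct S g U N) 0 0 (adAct S g V N') := by
  rw [adAct, coe_blockUnitary, op_fromBlocks, star_blocks, Matrix.fromBlocks_multiply,
    Matrix.fromBlocks_multiply]
  simp [adAct]

theorem adAct_zero (g : Gb) (U : Matrix.unitaryGroup ι ℂ) : adAct S g U 0 = 0 := by
  have := adAct_smul (S := S) g U 0 0
  rwa [zero_smul, map_zero, zero_smul] at this

/-- Matrix algebras are simple, so fullness of the block idempotents is automatic. -/
theorem isFull_of_ne_zero [Nonempty ι] {N : Matrix ι ι ℂ} (hN : N ≠ 0) : IsFull N := by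
  rw [isFull_iff]
  refine (IsSimpleOrder.eq_bot_or_eq_top _).resolve_left fun h => hN ?_
  have h1 : N ∈ TwoSidedIdeal.span {N} := TwoSidedIdeal.subset_span rfl
  rw [h] at h1
  exact h1

theorem IsFull.prod {R : Type*} [Ring R] {e : R} (he : IsFull e) : IsFull (e, e) := by
  obtain ⟨σ, _, c, d, h⟩ := he
  refine ⟨σ, inferInstance, fun i => (c i, c i), fun i => (d i, d i), ?_⟩
  refine Prod.ext ?_ ?_
  · rw [Prod.fst_sum]; exact h
  · rw [Prod.snd_sum]; exact h

/-- The embedding of a diagonal block. -/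
def blockLeft (ι κ : Type) : Matrix ι ι ℂ →ₗ[ℂ] Matrix (ι ⊕ κ) (ι ⊕ κ) ℂ where
  toFun N := Matrix.fromBlocks N 0 0 0
  map_add' N N' := by rw [Matrix.fromBlocks_add]; simp
  map_smul' c N := by rw [Matrix.fromBlocks_smul]; simp

/-- The embedding of a diagonal block. -/
def blockRight (ι κ : Type) : Matrix κ κ ℂ →ₗ[ℂ] Matrix (ι ⊕ κ) (ι ⊕ κ) ℂ where
  toFun N := Matrix.fromBlocks 0 0 0 N
  map_add' N N' := by rw [Matrix.fromBlocks_add]; simp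
  map_smul' c N := by rw [Matrix.fromBlocks_smul]; simp

/-- A corner of the matrix algebra of a block sum of projective actions. -/
structure IsBlock (f : Matrix ι ι ℂ →ₗ[ℂ] Matrix κ κ ℂ) : Prop where
  injective : Function.Injective f
  map_mul : ∀ N N', f (N * N') = f N * f N'
  exists_eq : ∀ c, ∃ N, f 1 * c * f 1 = f N

theorem isBlock_left : IsBlock (blockLeft ι κ) where
  injective N N' h := (Matrix.fromBlocks_inj.1 h).1
  map_mul N N' := by
    change Matrix.fromBlocks _ _ _ _ = Matrix.fromBlocks _ _ _ _ * Matrix.fromBlocks _ _ _ _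
    rw [Matrix.fromBlocks_multiply]; simp
  exists_eq c := by
    obtain ⟨a, b, c, d, rfl⟩ : ∃ a b c' d, c = Matrix.fromBlocks a b c' d :=
      ⟨_, _, _, _, (Matrix.fromBlocks_toBlocks c).symm⟩
    refine ⟨a, ?_⟩
    change Matrix.fromBlocks _ _ _ _ * _ * Matrix.fromBlocks _ _ _ _ = Matrix.fromBlocks _ _ _ _
    rw [Matrix.fromBlocks_multiply, Matrix.fromBlocks_multiply]; simp

theorem isBlock_right : IsBlock (blockRight ι κ) where
  injective N N' h := (Matrix.fromBlocks_inj.1 h).2.2.2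
  map_mul N N' := by
    change Matrix.fromBlocks _ _ _ _ = Matrix.fromBlocks _ _ _ _ * Matrix.fromBlocks _ _ _ _
    rw [Matrix.fromBlocks_multiply]; simp
  exists_eq c := by
    obtain ⟨a, b, c, d, rfl⟩ : ∃ a b c' d, c = Matrix.fromBlocks a b c' d :=
      ⟨_, _, _, _, (Matrix.fromBlocks_toBlocks c).symm⟩
    refine ⟨d, ?_⟩
    change Matrix.fromBlocks _ _ _ _ * _ * Matrix.fromBlocks _ _ _ _ = Matrix.fromBlocks _ _ _ _
    rw [Matrix.fromBlocks_multiply, Matrix.fromBlocks_multiply]; simp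

theorem blockLeft_add_blockRight : blockLeft ι κ 1 + blockRight ι κ 1 = 1 := by
  change Matrix.fromBlocks _ _ _ _ + Matrix.fromBlocks _ _ _ _ = 1
  rw [Matrix.fromBlocks_add, ← Matrix.fromBlocks_one]
  simp

theorem adAct_blockLeft (g : Gb) (U : Matrix.unitaryGroup ι ℂ) (V : Matrix.unitaryGroup κ ℂ)
    (N : Matrix ι ι ℂ) : adAct S g (blockUnitary U V) (blockLeft ι κ N) =
      blockLeft ι κ (adAct S g U N) := by
  refine (adAct_fromBlocks _ _ _ _ _).trans ?_
  rw [adAct_zero]; rfl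

theorem adAct_blockRight (g : Gb) (U : Matrix.unitaryGroup ι ℂ) (V : Matrix.unitaryGroup κ ℂ)
    (N : Matrix κ κ ℂ) : adAct S g (blockUnitary U V) (blockRight ι κ N) =
      blockRight ι κ (adAct S g V N) := by
  refine (adAct_fromBlocks _ _ _ _ _).trans ?_
  rw [adAct_zero]; rfl

variable {f : Matrix ι ι ℂ →ₗ[ℂ] Matrix κ κ ℂ} {A : EquivariantAlgebra S}

theorem IsBlock.map_one_ne_zero [Nonempty ι] (hf : IsBlock f) : f 1 ≠ 0 := by
  rw [← f.map_zero, hf.injective.ne_iff]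
  exact one_ne_zero

theorem IsBlock.isFullCorner_even [Nonempty ι] [Nonempty κ] (hf : IsBlock f)
    {M : G → Matrix.unitaryGroup ι ℂ} (hA : EvenBy A M) {W : G → Matrix.unitaryGroup κ ℂ}
    {ω : G → G → UnitAddCircle} (hW : IsProj (fun g => S.x (S.b g)) W ω)
    (hWf : ∀ g N, adAct S (S.b g) (W g) (f N) = f (adAct S (S.b g) (M g) N)) :
    IsFullCorner A (evenModel W hW) (f 1) := by
  obtain ⟨φ, hφ⟩ := hA
  refine ⟨?_, fun g => ?_, isFull_iff.1 (isFull_of_ne_zero hf.map_one_ne_zero),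
    f.comp φ.toLinearMap, hf.injective.comp φ.injective, fun a a' => ?_, fun c => ?_, fun g a => ?_⟩
  · exact (hf.map_mul 1 1).symm.trans (by rw [one_mul])
  · exact (hWf g 1).trans (by rw [adAct_one])
  · change f (φ (a * a')) = f (φ a) * f (φ a')
    rw [_root_.map_mul, hf.map_mul]
  · constructor
    · rintro ⟨a, rfl⟩
      change f 1 * f (φ a) * f 1 = f (φ a)
      rw [← hf.map_mul, ← hf.map_mul, one_mul, mul_one]
    · intro hc
      obtain ⟨N, hN⟩ := hf.exists_eq c
      refine ⟨φ.symm N, ?_⟩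
      change f (φ (φ.symm N)) = c
      rw [φ.apply_symm_apply, ← hN]
      exact hc
  · change f (φ (A.act g a)) = adAct S (S.b g) (W g) (f (φ a))
    rw [hφ, hWf]

theorem IsBlock.isFullCorner_odd [Nonempty ι] [Nonempty κ] (hf : IsBlock f)
    {M : G → Matrix.unitaryGroup ι ℂ} {χ : G → ZMod 2} (hA : OddBy A M χ)
    {W : G → Matrix.unitaryGroup κ ℂ} {ω : G → G → UnitAddCircle}
    (hW : IsProj (fun g => S.x (S.b g)) W ω) (hχ : ∀ g h, χ (g * h) = χ g + χ h)
    (hWf : ∀ g N, adAct S (S.b g) (W g) (f N) = f (adAct S (S.b g) (M g) N)) :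
    IsFullCorner A (oddModel W hW χ hχ) (f 1, f 1) := by
  obtain ⟨φ, hφ⟩ := hA
  have hW1 : ∀ g, adAct S (S.b g) (W g) (f 1) = f 1 := fun g => by rw [hWf, adAct_one]
  refine ⟨?_, fun g => ?_, isFull_iff.1 (isFull_of_ne_zero hf.map_one_ne_zero).prod,
    (LinearMap.prodMap f f).comp φ.toLinearMap, (hf.injective.prodMap hf.injective).comp φ.injective,
    fun a a' => ?_, fun c => ?_, fun g a => ?_⟩
  · refine Prod.ext ?_ ?_ <;> exact (hf.map_mul 1 1).symm.trans (by rw [one_mul])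
  · change oddAct S (S.b g) (W g) (χ g) (f 1, f 1) = (f 1, f 1)
    rw [oddAct, hW1]
    rcases zcases (χ g) with h | h <;> rw [h] <;> rfl
  · change (f (φ (a * a')).1, f (φ (a * a')).2) =
      (f (φ a).1 * f (φ a').1, f (φ a).2 * f (φ a').2)
    rw [_root_.map_mul, ← hf.map_mul, ← hf.map_mul]
    rfl
  · constructor
    · rintro ⟨a, rfl⟩
      refine Prod.ext ?_ ?_
      · change f 1 * f (φ a).1 * f 1 = f (φ a).1
        rw [← hf.map_mul, ← hf.map_mul, one_mul, mul_one]
      · change f 1 * f (φ a).2 * f 1 = f (φ a).2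
        rw [← hf.map_mul, ← hf.map_mul, one_mul, mul_one]
    · intro hc
      obtain ⟨N, hN⟩ := hf.exists_eq c.1
      obtain ⟨N', hN'⟩ := hf.exists_eq c.2
      refine ⟨φ.symm (N, N'), ?_⟩
      change (f (φ (φ.symm (N, N'))).1, f (φ (φ.symm (N, N'))).2) = c
      rw [φ.apply_symm_apply, ← hN, ← hN']
      exact hc
  · change (f (φ (A.act g a)).1, f (φ (A.act g a)).2) =
      oddAct S (S.b g) (W g) (χ g) (f (φ a).1, f (φ a).2)
    rw [hφ, oddAct, oddAct, hWf, hWf]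
    rcases zcases (χ g) with h | h <;> rw [h] <;> rfl

end Blocks

variable {t : S.Trivialization} {A B : EquivariantAlgebra S} {I J : Invariants Gb}

/-- Equal cocycles allow the direct sum of the two representations to be formed; its endomorphism
algebra is the linking algebra. -/
theorem EvenWith.moritaEquivalent {ω : G → G → UnitAddCircle} (hA : EvenWith A ω)
    (hB : EvenWith B ω) : MoritaEquivalent A B := by
  obtain ⟨n, hn, M, hM, hA⟩ := evenWith_iff.1 hA
  obtain ⟨m, hm, M', hM', hB⟩ := evenWith_iff.1 hB
  have : Nonempty (Fin n) := ⟨⟨0, hn⟩⟩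
  have : Nonempty (Fin m) := ⟨⟨0, hm⟩⟩
  refine ⟨evenModel _ (hM.block hM'), blockLeft (Fin n) (Fin m) 1,
    isBlock_left.isFullCorner_even hA _ fun g N => adAct_blockLeft _ _ _ _, ?_⟩
  have h := isBlock_right.isFullCorner_even hB (hM.block hM') fun g N =>
    adAct_blockRight (S.b g) (M g) (M' g) N
  rwa [eq_sub_of_add_eq' blockLeft_add_blockRight] at h

/-- The linking algebra is again built on the direct sum, with Γ common to both corners; this needs
the same `χ` on both sides. -/
theorem OddWith.moritaEquivalent {α : Gb → Gb → UnitAddCircle} {χ : G → ZMod 2}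
    (hA : OddWith A α χ) (hB : OddWith B α χ) : MoritaEquivalent A B := by
  obtain ⟨n, hn, M, hM, hχ, hA⟩ := oddWith_iff.1 hA
  obtain ⟨m, hm, M', hM', -, hB⟩ := oddWith_iff.1 hB
  have : Nonempty (Fin n) := ⟨⟨0, hn⟩⟩
  have : Nonempty (Fin m) := ⟨⟨0, hm⟩⟩
  refine ⟨oddModel _ ((hM.block hM').comp S.b) χ hχ,
    (blockLeft (Fin n) (Fin m) 1, blockLeft (Fin n) (Fin m) 1),
    isBlock_left.isFullCorner_odd hA _ hχ fun g N => adAct_blockLeft _ _ _ _, ?_⟩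
  have h := isBlock_right.isFullCorner_odd hB ((hM.block hM').comp S.b) hχ fun g N =>
    adAct_blockRight (S.b g) (M (S.b g)) (M' (S.b g)) N
  rwa [eq_sub_of_add_eq' blockLeft_add_blockRight] at h

/-- A splitting yields a section of `G → Gb`. -/
theorem exists_section {τ : G → ZMod 2} (hτ : ∀ g h, τ (g * h) = τ g + τ h) (hp : τ S.p = 1) :
    ∃ s : Gb → G, (∀ k, S.b (s k) = k) ∧ ∀ k l, s (k * l) = s k * s l := by
  have h : ∀ k, ∃ g, S.b g = k ∧ τ g = 0 := fun k => by
    obtain ⟨g, rfl⟩ := S.b_surjective k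
    rcases zcases (τ g) with h | h
    · exact ⟨g, rfl, h⟩
    · exact ⟨S.p * g, b_p_mul S g, by rw [hτ, hp, h]; rfl⟩
  choose s hs hs' using h
  refine ⟨s, hs, fun k l => ?_⟩
  rcases eq_or_eq_p_mul S (g := s k * s l) (h := s (k * l)) (by rw [map_mul, hs, hs, hs]) with h | h
  · exact h
  · have h1 := hs' (k * l)
    rw [h, hτ, hτ, hs', hs', hp] at h1
    exact absurd h1 (by decide)

theorem Invariants.Equivalent.moritaEquivalent (h : I.Equivalent S J) (hA : HasInvariants t A I)
    (hB : HasInvariants t B J) : MoritaEquivalent A B := by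
  obtain ⟨hβ, hγ, L, hL⟩ := h
  have hsp := hA.admissible.dγ
  rcases hA with ⟨hI, hA⟩ | ⟨hI, hA⟩ <;> rcases hB with ⟨hJ, hB⟩ | ⟨hJ, hB⟩
  · refine hA.moritaEquivalent (hB.rephase L fun g k => ?_)
    rw [Invariants.omega, Invariants.omega, ← hL, hβ]
    abel
  · exact absurd (hI.symm.trans (hγ.trans hJ)) zero_ne_one
  · exact absurd (hI.symm.trans (hγ.trans hJ)) one_ne_zero
  -- The cochain lives on `G`, but an odd algebra must be rephased over `Gb`; pulling back along a
  -- homomorphic section preserves the coboundary.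
  · obtain ⟨s, hs, hsm⟩ := exists_section (t.map_mul_of_splits (hsp hI)) t.t_p
    rw [← hβ] at hB
    refine hA.moritaEquivalent (hB.rephase (fun k => L (s k)) fun g k => ?_)
    have h1 := hL (s g) (s k)
    simp only [hs, dOne] at h1
    rw [dOne, hsm, ← h1]
    abel

theorem moritaEquivalent_iff (hA : HasInvariants t A I) (hB : HasInvariants t B J) :
    MoritaEquivalent A B ↔ I.Equivalent S J :=
  ⟨fun h => h.equivalent hA hB, fun h => h.moritaEquivalent hA hB⟩

end

section

variable {G Gb : Type*} [Group G] [Group Gb] {S : SymmetryClass G Gb}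

/-! ### The group of phases -/

namespace Invariants

variable {I I' J J' K : Invariants Gb}

variable (S I J) in
/-- The invariants of a stack. -/
def stack : Invariants Gb where
  α g h := I.α g h + J.α g h + half (I.β g * J.β h + J.γ * (1 + I.γ) * (I.β g * I.β h) +
    I.γ * (1 + J.γ) * (J.β g * J.β h))
  β g := I.β g + J.β g + I.γ * J.γ * S.x g
  γ := I.γ + J.γ

theorem Equivalent.refl (I : Invariants Gb) : I.Equivalent S I :=
  ⟨rfl, rfl, fun _ => 0, fun g h => by simp [dOne, twist_zero]⟩

theorem Equivalent.of_cochain (hβ : ∀ g, I.β g = J.β g) (hγ : I.γ = J.γ) (L : Gb → UnitAddCircle)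
    (hL : ∀ g h, I.α g h - J.α g h = dOne S.x L g h) : I.Equivalent S J :=
  ⟨funext hβ, hγ, fun g => L (S.b g), fun g h => by rw [hL, dOne, dOne, map_mul]⟩

/-- Equivalence leaves `β` and γ unchanged, so the cup terms coincide and the trivializing cochains
add. This makes stacking well defined on phases. -/
theorem Equivalent.stack (h : I.Equivalent S I') (h' : J.Equivalent S J') :
    (I.stack S J).Equivalent S (I'.stack S J') := by
  obtain ⟨hβ, hγ, L, hL⟩ := h
  obtain ⟨hβ', hγ', L', hL'⟩ := h'
  refine ⟨by simp only [Invariants.stack, hβ, hγ, hβ', hγ'], by simp only [Invariants.stack, hγ, hγ'],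
    fun g => L g + L' g, fun g h => ?_⟩
  rw [dOne_add, ← hL, ← hL']
  simp only [Invariants.stack, hβ, hγ, hβ', hγ']
  abel

/-- The two bracketings differ by symmetrized cups, trivialized by products, and, when two adjacent
factors are odd, by ½ β ∪ β + ½ β ∪ x for the third factor, coming from the shift by `x`. The
quarter cochains account for the latter. The coefficients in γ select the parity cases. -/
theorem stack_assoc_equivalent (hI : ∀ g h, I.β (g * h) = I.β g + I.β h)
    (hJ : ∀ g h, J.β (g * h) = J.β g + J.β h) (hK : ∀ g h, K.β (g * h) = K.β g + K.β h) :
    ((I.stack S J).stack S K).Equivalent S (I.stack S (J.stack S K)) := by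
  refine Equivalent.of_cochain (fun g => ?_) (add_assoc _ _ _) (fun g =>
    half (((1 + I.γ) * (1 + J.γ) * K.γ + I.γ * J.γ * K.γ) * (I.β g * J.β g) +
      (I.γ * (1 + J.γ) * (1 + K.γ) + I.γ * J.γ * K.γ) * (J.β g * K.β g) +
      (1 + I.γ) * J.γ * K.γ * (I.β g * S.x g) + I.γ * J.γ * K.γ * (K.β g * S.x g)) +
    (quarter (J.γ * K.γ * I.β g) + quarter (I.γ * J.γ * K.β g))) fun g h => ?_
  · simp only [Invariants.stack]
    ring
  · rw [dOne_add, dOne_add, dOne_half, dOne_quarter _ (fun g h => by rw [hI, mul_add]),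
      dOne_quarter _ (fun g h => by rw [hK, mul_add])]
    simp only [hI, hJ, hK, x_mul]
    have e : ∀ (a b c : UnitAddCircle) (p q r s : ZMod 2),
        a + b + half p + c + half q - (a + (b + c + half r) + half s) = half (p + q + (r + s)) := by
      intro a b c p q r s
      simp only [half_add, sub_eq_add_neg, neg_add, neg_half]
      abel
    refine (e _ _ _ _ _ _ _).trans ?_
    rw [← half_add, ← half_add]
    congr 1
    dsimp only [Invariants.stack]
    generalize I.β g = a
    generalize I.β h = a'
    generalize J.β g = b
    generalize J.β h = b'
    generalize K.β g = c
    generalize K.β h = c'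
    generalize S.x g = x
    generalize S.x h = x'
    rcases zcases I.γ with h1 | h1 <;> rcases zcases J.γ with h2 | h2 <;>
      rcases zcases K.γ with h3 | h3 <;> rw [h1, h2, h3] <;> grind

theorem stack_unit_equivalent {I : Invariants Gb} :
    (I.stack S ⟨fun _ _ => 0, fun _ => 0, 0⟩).Equivalent S I := by
  refine Equivalent.of_cochain (fun g => ?_) (add_zero _) (fun _ => 0) fun g h => ?_
  · simp [Invariants.stack]
  · simp [Invariants.stack, dOne, twist_zero, half_zero]

variable (S I) in
/-- The invariants of the inverse phase. -/
def inverse : Invariants Gb where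
  α g h := -I.α g h + half (I.β g * (I.β h + I.γ * S.x h))
  β g := I.β g + I.γ * S.x g
  γ := I.γ

/-- The cup term in `inverse` was chosen to equal the one created by stacking, and two halves
cancel. In the odd case the added `x` cancels the shift of `β`, so no coboundary is needed. -/
theorem stack_inverse_equivalent :
    (I.stack S (I.inverse S)).Equivalent S ⟨fun _ _ => 0, fun _ => 0, 0⟩ := by
  refine Equivalent.of_cochain (fun g => ?_) (CharTwo.add_self_eq_zero _) (fun _ => 0) fun g h => ?_
  · dsimp only [Invariants.stack, inverse]
    rcases zcases I.γ with h1 | h1 <;> rw [h1] <;> grind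
  · have e : ∀ (a : UnitAddCircle) (p q : ZMod 2), p = q → a + (-a + half p) + half q = 0 := by
      rintro a p q rfl
      rw [add_neg_cancel_left, half_add_self]
    simp only [dOne, twist_zero, sub_zero, add_zero]
    refine e _ _ _ ?_
    dsimp only [inverse]
    rcases zcases I.γ with h1 | h1 <;> rw [h1] <;> grind

/-- The added cup of two homomorphisms is closed, and half-integers equal their negatives, so the
equation for α persists. The extra `x` in `β` occurs only for γ = 1, where ρ vanishes. -/
theorem Admissible.inverse {t : S.Trivialization} (h : I.Admissible t) :
    (I.inverse S).Admissible t where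
  dβ g k := by
    dsimp only [Invariants.inverse]
    rw [h.dβ, x_mul]
    ring
  dα g k l := by
    have h1 := h.dα g k l
    have h2 : dTwo S.x (I.inverse S).α (S.b g) (S.b k) (S.b l) =
        -dTwo S.x I.α (S.b g) (S.b k) (S.b l) := by
      have e : ∀ (x : ZMod 2) (a b c d : UnitAddCircle) (p q r s : ZMod 2), p + q + (r + s) = 0 →
          twist x (-a + half p) - (-b + half q) + (-c + half r) - (-d + half s) =
          -(twist x a - b + c - d) := by
        intro x a b c d p q r s hp
        have h3 : half p + half q + (half r + half s) = 0 := by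
          rw [← half_add, ← half_add, ← half_add, hp, half_zero]
        rw [← add_zero (-(twist x a - b + c - d)), ← h3]
        simp only [twist_add, twist_neg, twist_half, sub_eq_add_neg, neg_add, neg_neg, neg_half]
        abel
      refine e _ _ _ _ _ _ _ _ _ ?_
      rw [h.dβ, h.dβ, x_mul]
      grind
    rw [h2, h1, neg_half]
    dsimp only [Invariants.inverse]
    rcases zcases I.γ with hγ | hγ
    · rw [hγ, zero_mul, add_zero]
    · rw [t.map_mul_of_splits (h.dγ hγ), CharTwo.sub_eq_add, CharTwo.add_self_eq_zero, mul_zero,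
        mul_zero]
  dγ := h.dγ

end Invariants

variable {t : S.Trivialization} {A B C : EquivariantAlgebra S} {I J : Invariants Gb}

/-- The factors γ'(1 + γ), γ(1 + γ') and γγ' in `Invariants.stack` are the indicators of the three
cases involving an odd factor, so one formula covers all four rules. -/
theorem HasInvariants.stack (hA : HasInvariants t A I) (hB : HasInvariants t B J) :
    HasInvariants t (A.stack B) (I.stack S J) := by
  obtain ⟨α, β, γ⟩ := I
  obtain ⟨α', β', γ'⟩ := J
  rcases zcases γ with rfl | rfl <;> rcases zcases γ' with rfl | rfl
  · convert hA.stack_even_even hB using 1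
    simp [Invariants.stack]
  · convert hA.stack_even_odd hB using 1
    simp [Invariants.stack, half_add, add_assoc]
  · convert hA.stack_odd_even hB using 1
    simp [Invariants.stack, half_add, add_assoc]
  · convert hA.stack_odd_odd hB using 1
    simp [Invariants.stack, show (1 + 1 : ZMod 2) = 0 from rfl]

theorem IsSRE.stack (t : S.Trivialization) (hA : IsSRE A) (hB : IsSRE B) : IsSRE (A.stack B) := by
  obtain ⟨I, hI⟩ := (isSRE_iff t A).1 hA
  obtain ⟨J, hJ⟩ := (isSRE_iff t B).1 hB
  exact (hI.stack hJ).isSRE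

theorem phase_eq (hA : HasInvariants t A I) (hB : HasInvariants t B J) (h : I.Equivalent S J)
    (hA' : IsSRE A) (hB' : IsSRE B) : Phase.mk A hA' = Phase.mk B hB' :=
  Quot.sound (h.moritaEquivalent hA hB)

theorem phase_induction {P : Phase S → Prop} (t : S.Trivialization)
    (h : ∀ A hA I, HasInvariants t A I → P (Phase.mk A hA)) (a : Phase S) : P a := by
  induction a using Quot.ind with
  | mk A =>
    obtain ⟨I, hI⟩ := (isSRE_iff t A.1).1 A.2
    exact h A.1 A.2 I hI

/-- Stacking of phases. -/
def phaseMul (t : S.Trivialization) : Phase S → Phase S → Phase S :=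
  Quot.map₂ (fun A B => ⟨A.1.stack B.1, A.2.stack t B.2⟩)
    (by
      rintro ⟨A, hA⟩ ⟨B, hB⟩ ⟨C, hC⟩ h
      obtain ⟨I, hI⟩ := (isSRE_iff t A).1 hA
      obtain ⟨J, hJ⟩ := (isSRE_iff t B).1 hB
      obtain ⟨K, hK⟩ := (isSRE_iff t C).1 hC
      exact ((Invariants.Equivalent.refl I).stack (h.equivalent hJ hK)).moritaEquivalent
        (hI.stack hJ) (hI.stack hK))
    (by
      rintro ⟨A, hA⟩ ⟨B, hB⟩ ⟨C, hC⟩ h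
      obtain ⟨I, hI⟩ := (isSRE_iff t A).1 hA
      obtain ⟨J, hJ⟩ := (isSRE_iff t B).1 hB
      obtain ⟨K, hK⟩ := (isSRE_iff t C).1 hC
      exact ((h.equivalent hI hJ).stack (Invariants.Equivalent.refl K)).moritaEquivalent
        (hI.stack hK) (hJ.stack hK))

theorem phaseMul_comm (t : S.Trivialization) (a b : Phase S) :
    phaseMul t a b = phaseMul t b a := by
  induction a using phase_induction t with
  | h A hA I hI =>
  induction b using phase_induction t with
  | h B hB J hJ =>
    exact phase_eq (hasInvariants_congr (eqvIso_stack_comm A B) (hJ.stack hI)) (hJ.stack hI)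
      (Invariants.Equivalent.refl _) _ _

theorem phaseMul_assoc (t : S.Trivialization) (a b c : Phase S) :
    phaseMul t (phaseMul t a b) c = phaseMul t a (phaseMul t b c) := by
  induction a using phase_induction t with
  | h A hA I hI =>
  induction b using phase_induction t with
  | h B hB J hJ =>
  induction c using phase_induction t with
  | h C hC K hK =>
    exact phase_eq ((hI.stack hJ).stack hK) (hI.stack (hJ.stack hK))
      (Invariants.stack_assoc_equivalent hI.admissible.dβ hJ.admissible.dβ hK.admissible.dβ) _ _

variable [Finite G]

/-- The zero triple and the inverse of an admissible triple are admissible, so each is realized by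
an algebra; finiteness of `G` enters through the regular representation. -/
theorem exists_trivial (t : S.Trivialization) : ∃ e : Phase S, (∀ a, phaseMul t a e = a) ∧
    ∀ a, ∃ b, phaseMul t a b = e := by
  obtain ⟨E, hE⟩ := Invariants.Admissible.exists_hasInvariants (t := t)
    (I := ⟨fun _ _ => 0, fun _ => 0, 0⟩) ⟨fun _ _ => (add_zero _).symm,
      fun _ _ _ => by simp [dTwo, twist_zero, half_zero], fun h => absurd h zero_ne_one⟩
  refine ⟨Phase.mk E hE.isSRE, fun a => ?_, fun a => ?_⟩
  · induction a using phase_induction t with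
    | h A hA I hI =>
      exact phase_eq (hI.stack hE) hI Invariants.stack_unit_equivalent _ _
  · induction a using phase_induction t with
    | h A hA I hI =>
      obtain ⟨B, hB⟩ := hI.admissible.inverse.exists_hasInvariants
      exact ⟨Phase.mk B hB.isSRE,
        phase_eq (hI.stack hB) hE Invariants.stack_inverse_equivalent _ _⟩

/-- The group of phases under stacking. -/
@[reducible]
def phaseCommGroup (t : S.Trivialization) : CommGroup (Phase S) where
  mul := phaseMul t
  mul_assoc := phaseMul_assoc t
  mul_comm := phaseMul_comm t
  one := Classical.choose (exists_trivial t)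
  one_mul a := (phaseMul_comm t _ _).trans ((Classical.choose_spec (exists_trivial t)).1 a)
  mul_one := (Classical.choose_spec (exists_trivial t)).1
  inv a := Classical.choose ((Classical.choose_spec (exists_trivial t)).2 a)
  inv_mul_cancel a := (phaseMul_comm t _ _).trans
    (Classical.choose_spec ((Classical.choose_spec (exists_trivial t)).2 a))

end

end FermionicStacking

end

/-! ### The classification and stacking theorem -/

theorem mainTheorem1 {G Gb : Type*} [Group G] [Group Gb] [Finite G]
    (S : SymmetryClass G Gb) (t : S.Trivialization) :
    -- the invariants classify SRE phases
    (∀ A : EquivariantAlgebra S, IsSRE A ↔ ∃ I, HasInvariants t A I) ∧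
    (∀ I : Invariants Gb, I.Admissible t ↔ ∃ A : EquivariantAlgebra S, HasInvariants t A I) ∧
    (∀ (A B : EquivariantAlgebra S) (I J : Invariants Gb), HasInvariants t A I →
      HasInvariants t B J → (MoritaEquivalent A B ↔ I.Equivalent S J)) ∧
    -- stacking is a group law on SRE phases
    (∃ (hst : ∀ A B : EquivariantAlgebra S, IsSRE A → IsSRE B → IsSRE (A.stack B))
      (_ : CommGroup (Phase S)), ∀ (A B : EquivariantAlgebra S) (hA : IsSRE A) (hB : IsSRE B),
        Phase.mk A hA * Phase.mk B hB = Phase.mk (A.stack B) (hst A B hA hB)) ∧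
    -- the stacking law in terms of the invariants
    (∀ (A₁ A₂ : EquivariantAlgebra S) (α₁ α₂ : Gb → Gb → UnitAddCircle) (β₁ β₂ : Gb → ZMod 2),
      (HasInvariants t A₁ ⟨α₁, β₁, 0⟩ → HasInvariants t A₂ ⟨α₂, β₂, 0⟩ →
        HasInvariants t (A₁.stack A₂)
          ⟨fun g h => α₁ g h + α₂ g h + half (β₁ g * β₂ h), fun g => β₁ g + β₂ g, 0⟩) ∧
      (HasInvariants t A₁ ⟨α₁, β₁, 0⟩ → HasInvariants t A₂ ⟨α₂, β₂, 1⟩ →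
        HasInvariants t (A₁.stack A₂)
          ⟨fun g h => α₁ g h + α₂ g h + half (β₁ g * β₂ h) + half (β₁ g * β₁ h),
            fun g => β₁ g + β₂ g, 1⟩) ∧
      (HasInvariants t A₁ ⟨α₁, β₁, 1⟩ → HasInvariants t A₂ ⟨α₂, β₂, 0⟩ →
        HasInvariants t (A₁.stack A₂)
          ⟨fun g h => α₁ g h + α₂ g h + half (β₁ g * β₂ h) + half (β₂ g * β₂ h),
            fun g => β₁ g + β₂ g, 1⟩) ∧
      (HasInvariants t A₁ ⟨α₁, β₁, 1⟩ → HasInvariants t A₂ ⟨α₂, β₂, 1⟩ →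
        HasInvariants t (A₁.stack A₂)
          ⟨fun g h => α₁ g h + α₂ g h + half (β₁ g * β₂ h),
            fun g => β₁ g + β₂ g + S.x g, 0⟩)) ∧
    -- without a splitting there are no odd phases
    (¬ S.Splits → ∀ (A : EquivariantAlgebra S),
      ¬ IsOdd A ∧ ∀ I, HasInvariants t A I → I.γ = 0) := by
  refine ⟨isSRE_iff t, admissible_iff t, fun A B I J hA hB => moritaEquivalent_iff hA hB,
    ⟨fun A B hA hB => hA.stack t hB, phaseCommGroup t, fun A B hA hB => rfl⟩,
    fun A₁ A₂ α₁ α₂ β₁ β₂ => ⟨HasInvariants.stack_even_even, HasInvariants.stack_even_odd,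
      HasInvariants.stack_odd_even, HasInvariants.stack_odd_odd⟩,
    fun hs A => ⟨not_isOdd_of_not_splits hs A, fun I hI => hI.gamma_eq_zero hs⟩⟩
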